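/- **Setting.** A secret, an element of a finite set $\mathcal S$, is shared by a dealer among $n$ players. The dealer draws random coins, gives each player a share, and leaves the game. A set $A$ of $m$ players is active; $A$ is known to the active players but is fixed independently of the dealer's coins (the dealer's protocol does not depend on $A$). The active players then communicate synchronously by bit strings over private point-to-point channels, and each eventually outputs an element of $\mathcal S$; a player learns the secret if its output is the secret. A deviating player may rush, i.e. choose its messages of a communication step after seeing the messages sent to it in that step. The utility $u_j(R)$ of player $j$ depends on the set $R$ of players who learn the secret, and is learning-preferring: $u_j(R)>u_j(R')$ whenever $j\in R\setminus R'$. Put $U_j^+=\max_{R\ni j}u_j(R)$, $U_j=\min_{R\ni j}u_j(R)$, $U_j^-=\max_{R\not\ni j}u_j(R)$. To the players the secret is a priori uniform on $\mathcal S$. **Theorem.** Fix reals $k,\lambda>0$, a threshold $\tau$, and constants $\mathcal U$, $B$. There is a constant $C$, depending only on $k,\lambda,\tau,\mathcal U,B$, such that for all $n\ge 3$ and every finite non-empty set $\mathcal S$ with $\mathcal U<|\mathcal S|\le Bn$ there is a protocol (for the dealer and the players) with the following property. For every set $A$ of $m$ active players there is an event $E$ in the dealer's coins, of probability at least $1-1/n^k$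 and not depending on the secret, such that, conditioned on $E$: * following the protocol is a Nash equilibrium of the active players (no active player can increase its expected utility by a unilateral deviation), for all learning-preferring utilities with $\max_j \frac{U_j^+-U_j^-}{U_j-U_j^-}\le\mathcal U$; this is claimed except in the case that $m=2$ and $m/n\ge\tau+\lambda$; * if $m/n\ge\tau+\lambda$, then all active players learn the secret (with probability one, whatever the secret is) when they follow the protocol; if $m/n\le\tau-\lambda$, then the secret cannot be recovered: the joint distribution of the shares of all active players does not depend on the secret; * when the active players follow the protocol, each of them sends at most $C\log^2 n$ bits in expectation, and the expected number of communication steps until all active players have produced their output is at most $C\log n$. -/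

import Mathlib

open scoped ENNReal

namespace RationalSharing

/-- What a player receives in one communication step: the bit string sent to it by each player over
the private channel between the two.  The empty string means that nothing was sent. -/
abbrev Inbox (n : ℕ) : Type := Fin n → List Bool

/-- A strategy (for a player whose input is already fixed): what to send to each player, and the
value that the player outputs as the secret (if any yet), as functions of everything received so
far, listed step by step.  Nothing is assumed about computability. -/
structure Strategy (n : ℕ) (S : Type) where
  send : List (Inbox n) → Fin n → List Bool
  out : List (Inbox n) → Option S

/-- A protocol for sharing a secret from `S` among `n` players: a dealer, who draws `coins` and gives
each player a share of the secret and then leaves the game, and the players' prescribed strategies.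
The dealer does not know the set of active players; the active players do, and each of them plays
according to that set, its identity and its share. -/
structure Protocol (n : ℕ) (S : Type) where
  Coins : Type
  coins : PMF Coins
  Share : Type
  deal : S → Coins → Fin n → Share
  player : Finset (Fin n) → Fin n → Share → Strategy n S

section Play

variable {n : ℕ} {S : Type}

/-- `o k i` is what `k` sends to `i`; player `i` receives what the others send to it. -/
def deliver (o : Fin n → Fin n → List Bool) (i : Fin n) : Inbox n :=
  fun k => if k = i then [] else o k i

/-- What everybody sends in a step in which the players have received `h` in the earlier steps.
Absent players send nothing. -/
def sent (A : Finset (Fin n)) (σ : Fin n → Strategy n S) (h : Fin n → List (Inbox n)) :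
    Fin n → Fin n → List Bool :=
  fun i => if i ∈ A then (σ i).send (h i) else fun _ => []

/-- `views A σ r i`: what player `i` has received in the first `r` steps, when the set of active
players is `A` and they use the strategies `σ`. -/
def views (A : Finset (Fin n)) (σ : Fin n → Strategy n S) : ℕ → Fin n → List (Inbox n)
  | 0 => fun _ => []
  | r + 1 => fun i => views A σ r i ++ [deliver (sent A σ (views A σ r)) i]

/-- The messages of a step in which player `j` uses the strategy `ρ` instead of `σ j`.  Player `j`
may rush: it chooses its messages of the step after it has received those that the others send to it
in the same step. -/
def sentDev (A : Finset (Fin n)) (σ : Fin n → Strategy n S) (j : Fin n) (ρ : Strategy n S)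
    (h : Fin n → List (Inbox n)) : Fin n → Fin n → List Bool :=
  Function.update (sent A σ h) j (ρ.send (h j ++ [deliver (sent A σ h) j]))

/-- As `views`, when player `j` deviates to the (rushing) strategy `ρ`. -/
def viewsDev (A : Finset (Fin n)) (σ : Fin n → Strategy n S) (j : Fin n) (ρ : Strategy n S) :
    ℕ → Fin n → List (Inbox n)
  | 0 => fun _ => []
  | r + 1 => fun i =>
      viewsDev A σ j ρ r i ++ [deliver (sentDev A σ j ρ (viewsDev A σ j ρ r)) i]

/-- A player with the views `v` who uses the strategy `ρ` learns the secret `s`: the first value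
that it outputs is `s`. -/
def Learns (ρ : Strategy n S) (v : ℕ → List (Inbox n)) (s : S) : Prop :=
  ∃ r, ρ.out (v r) = some s ∧ ∀ r' < r, ρ.out (v r') = none

open Classical in
/-- The set of active players who learn the secret `s` when all of them use the strategies `σ`. -/
noncomputable def learners (A : Finset (Fin n)) (σ : Fin n → Strategy n S) (s : S) :
    Finset (Fin n) :=
  A.filter fun i => Learns (σ i) (fun r => views A σ r i) s

open Classical in
/-- The set of active players who learn the secret `s` when `j` deviates to `ρ`. -/
noncomputable def learnersDev (A : Finset (Fin n)) (σ : Fin n → Strategy n S) (j : Fin n)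
    (ρ : Strategy n S) (s : S) : Finset (Fin n) :=
  A.filter fun i =>
    Learns (Function.update σ j ρ i) (fun r => viewsDev A σ j ρ r i) s

/-- The number of bits that player `i` sends, in total. -/
noncomputable def bitsSent (A : Finset (Fin n)) (σ : Fin n → Strategy n S) (i : Fin n) : ℝ≥0∞ :=
  ∑' r : ℕ, ∑ k : Fin n, ((sent A σ (views A σ r) i k).length : ℝ≥0∞)

/-- The number of communication steps until every active player has produced its output
(infinite if that never happens). -/
noncomputable def latency (A : Finset (Fin n)) (σ : Fin n → Strategy n S) : ℝ≥0∞ :=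
  ⨅ r ∈ {r : ℕ | ∀ i ∈ A, ∃ r' ≤ r, ((σ i).out (views A σ r' i)).isSome}, (r : ℝ≥0∞)

end Play

section Utility

variable {n : ℕ}

/-- Utilities: `u j R` is the utility of player `j` when `R` is the set of players who learn the
secret.  They are learning-preferring if every player prefers all outcomes in which it learns the
secret to all those in which it does not. -/
def LearningPreferring (u : Fin n → Finset (Fin n) → ℝ) : Prop :=
  ∀ j R R', j ∈ R → j ∉ R' → u j R' < u j R

/-- `U⁺ⱼ`, the best utility of player `j`, over the outcomes in which it learns the secret. -/
noncomputable def bestLearning (u : Fin n → Finset (Fin n) → ℝ) (j : Fin n) : ℝ :=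
  (Finset.univ.filter fun R : Finset (Fin n) => j ∈ R).sup' ⟨Finset.univ, by simp⟩ (u j)

/-- `Uⱼ`, the worst utility of player `j`, over the outcomes in which it learns the secret. -/
noncomputable def worstLearning (u : Fin n → Finset (Fin n) → ℝ) (j : Fin n) : ℝ :=
  (Finset.univ.filter fun R : Finset (Fin n) => j ∈ R).inf' ⟨Finset.univ, by simp⟩ (u j)

/-- `U⁻ⱼ`, the best utility of player `j`, over the outcomes in which it does not learn the
secret. -/
noncomputable def bestNotLearning (u : Fin n → Finset (Fin n) → ℝ) (j : Fin n) : ℝ :=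
  (Finset.univ.filter fun R : Finset (Fin n) => j ∉ R).sup' ⟨∅, by simp⟩ (u j)

end Utility

namespace Protocol

variable {n : ℕ} {S : Type} (P : Protocol n S)

/-- The prescribed strategies, when `A` is the set of active players and the dealer shares the
secret `s` with the coins `ω`. -/
def strat (A : Finset (Fin n)) (s : S) (ω : P.Coins) : Fin n → Strategy n S :=
  fun i => P.player A i (P.deal s ω i)

/-- The law of the dealer's coins, conditioned on the event `E`. -/
noncomputable def condCoins (E : Set P.Coins) (hE : ∃ ω ∈ E, ω ∈ P.coins.support) :
    PMF P.Coins :=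
  P.coins.filter E hE

/-- The law, given the event `E`, of the set of players who learn the (uniformly distributed) secret
when everybody follows the protocol. -/
noncomputable def outcome [Fintype S] [Nonempty S] (A : Finset (Fin n)) (E : Set P.Coins)
    (hE : ∃ ω ∈ E, ω ∈ P.coins.support) : PMF (Finset (Fin n)) :=
  (PMF.uniformOfFintype S).bind fun s =>
    (P.condCoins E hE).map fun ω => learners A (P.strat A s ω) s

/-- The same law when player `j` deviates: knowing its share, it uses the strategy `ρ share`. -/
noncomputable def outcomeDev [Fintype S] [Nonempty S] (A : Finset (Fin n)) (E : Set P.Coins)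
    (hE : ∃ ω ∈ E, ω ∈ P.coins.support) (j : Fin n) (ρ : P.Share → Strategy n S) :
    PMF (Finset (Fin n)) :=
  (PMF.uniformOfFintype S).bind fun s =>
    (P.condCoins E hE).map fun ω => learnersDev A (P.strat A s ω) j (ρ (P.deal s ω j)) s

/-- Expected utility. -/
noncomputable def expUtility (law : PMF (Finset (Fin n))) (v : Finset (Fin n) → ℝ) : ℝ :=
  ∑ R : Finset (Fin n), (law R).toReal * v R

/-- Given the event `E`, following the protocol is a Nash equilibrium of the active players: no
active player can increase its expected utility by a unilateral deviation.  (A randomized deviation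
is a mixture of deviations as considered here, hence is covered as well.  A deviation may
depend on the set `A`, which is fixed.) -/
def IsNash [Fintype S] [Nonempty S] (A : Finset (Fin n)) (E : Set P.Coins)
    (hE : ∃ ω ∈ E, ω ∈ P.coins.support) (u : Fin n → Finset (Fin n) → ℝ) : Prop :=
  ∀ j ∈ A, ∀ ρ : P.Share → Strategy n S,
    expUtility (P.outcomeDev A E hE j ρ) (u j) ≤ expUtility (P.outcome A E hE) (u j)

/-- Given the event `E`, all active players learn the secret, whatever it is (with conditional
probability one) when they follow the protocol. -/
def AllLearn (A : Finset (Fin n)) (E : Set P.Coins) : Prop :=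
  ∀ s : S, ∀ ω ∈ E, ω ∈ P.coins.support → learners A (P.strat A s ω) s = A

/-- Given the event `E`, the secret cannot be recovered from the shares of all active players
together: their joint law does not depend on the secret. -/
def Hidden (A : Finset (Fin n)) (E : Set P.Coins)
    (hE : ∃ ω ∈ E, ω ∈ P.coins.support) : Prop :=
  ∀ s s' : S,
    (P.condCoins E hE).map (fun ω (i : {i // i ∈ A}) => P.deal s ω i) =
      (P.condCoins E hE).map (fun ω (i : {i // i ∈ A}) => P.deal s' ω i)

/-- The expected number of bits sent by player `i`, given `E`, when the secret is `s`. -/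
noncomputable def expBits (A : Finset (Fin n)) (E : Set P.Coins)
    (hE : ∃ ω ∈ E, ω ∈ P.coins.support) (s : S) (i : Fin n) : ℝ≥0∞ :=
  ∑' ω, P.condCoins E hE ω * bitsSent A (P.strat A s ω) i

/-- The expected latency, given `E`, when the secret is `s`. -/
noncomputable def expLatency (A : Finset (Fin n)) (E : Set P.Coins)
    (hE : ∃ ω ∈ E, ω ∈ P.coins.support) (s : S) : ℝ≥0∞ :=
  ∑' ω, P.condCoins E hE ω * latency A (P.strat A s ω)

end Protocol

end RationalSharing

/-!
The dealer need not know the set `A` of active players, because it may prepare one sharing of the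
secret for every possible `A`, with independent coins, and hand out all of them
(`Protocol.exists_handles_all`). If a single share of each of these sharings reveals nothing about
the secret, then the shares for the other sets are just independent noise for a deviating player
(`Protocol.Handles.transfer`). So it suffices to find, for each `A`, a protocol that does what is
asked for when `A` is the active set and whose shares hide the secret from all sets `A'` with
`|A'| / n ≤ τ - lam`. No conditioning on the dealer's coins is needed: the event `E` is everything.

* If `(τ - lam) * n < 1`, then only the empty set has to be kept ignorant, and every share is the
  secret itself.
* If `|A| / n < τ + lam`, nobody needs to learn the secret. Every player gets, and outputs, an
  independent uniform guess (`guessProtocol`). Whatever a player outputs instead, it is right with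
  at most the same probability, independently of the others.
* If `|A| / n ≥ τ + lam` and `2 * lam * n ≥ 3`, the active players are divided into blocks of
  bounded size, their number being of the order of `lam * n`. Each block holds random pieces, one
  for each set of at least three of its members, known to exactly these, and the secret is a public
  element plus the sum of all pieces. Three absent members of one block suffice to hide the secret
  (`Blocks.protocol_hiddenFrom`). The sum is collected by repeated doubling, in logarithmically many
  steps; every value is sent by at least three players, so that a single liar is outvoted
  (`Blocks.estimate_eq`), and a deviation cannot keep anybody from learning the secret.
* In the remaining case `n` is bounded, and so are all costs of the iterated protocol
  (`Iterated.protocol`). In each iteration the players exchange authenticated pieces of a value, in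
  two steps; in the second step of iteration `r` the player `r % n` is idle. One iteration, whose
  number is random, is the definitive one: its value, plus a public element, is the secret. That it
  was the definitive one shows only afterwards, when the tags become invalid or a player runs out of
  pieces. Consider the first lie of a deviating player `j`. If it comes after the definitive
  iteration, the others learn the secret all the same (`Iterated.learnersDev_of_not_lie`). Otherwise
  `j` gains only if the tag of the lie is accepted (`Iterated.tagEvent_le`), if the current
  iteration happens to be the definitive one and `j` can complete it (`Iterated.stopEvent_le`), or
  if `j` guesses the piece that is withheld by the player to whom it has lied
  (`Iterated.winEvent_le`). The conditional probabilities are at most `1 / d`, `1 / d` and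
  `1 / |S|`. Since `|S| > U`, their sum is at most `1 / U` for large `d`, which makes the lie
  unprofitable (`expUtility_map_le`).

The number of the definitive iteration is built from a geometric random number for each player,
which tells after how many of its idle turns the player runs out of pieces. The share of `j`
therefore does not tell whether an iteration in which another player `k` is idle is definitive: this
depends on the number of `k`, whose hazard rate is constantly `1 / d`. If `j` itself is idle, it may
know that the iteration is definitive, but then it cannot profit from a lie in the first step, for
it still lacks the pieces of the second step, and it sends nothing in the second step.
-/

namespace RationalSharing

/-! ### Discrete laws and expected utilities -/

section Laws

variable {α β : Type}

theorem tsum_map_mul (p : PMF α) (f : α → β) (g : β → ℝ≥0∞) :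
    ∑' b, p.map f b * g b = ∑' a, p a * g (f a) := by
  classical
  have h : ∀ b, p.map f b * g b = ∑' a, if b = f a then p a * g (f a) else 0 := by
    intro b
    rw [PMF.map_apply, ← ENNReal.tsum_mul_right]
    refine tsum_congr fun a => ?_
    by_cases hb : b = f a
    · simp [hb]
    · simp [hb]
  simp_rw [h]
  rw [ENNReal.tsum_comm]
  exact tsum_congr fun a => tsum_ite_eq (f a) _

/-- The law of a pair of independent random variables. -/
noncomputable def prodLaw (p : PMF α) (q : PMF β) : PMF (α × β) :=
  p.bind fun a => q.map fun b => (a, b)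

theorem prodLaw_apply (p : PMF α) (q : PMF β) (a : α) (b : β) :
    prodLaw p q (a, b) = p a * q b := by
  classical
  unfold prodLaw
  rw [PMF.bind_apply, tsum_eq_single a]
  · congr 1
    rw [PMF.map_apply, tsum_eq_single b]
    · simp
    · intro b' h
      simp [Ne.symm h]
  · intro a' h
    have : (PMF.map (fun b => (a', b)) q) (a, b) = 0 := by
      rw [PMF.map_apply, ENNReal.tsum_eq_zero]
      intro b'
      simp [Ne.symm h]
    rw [this, mul_zero]

theorem prodLaw_comm (p : PMF α) (q : PMF β) :
    prodLaw p q = q.bind fun b => p.map fun a => (a, b) := by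
  unfold prodLaw
  simp_rw [← PMF.bind_pure_comp]
  exact PMF.bind_comm p q _

theorem map_fst_prodLaw (p : PMF α) (q : PMF β) : (prodLaw p q).map Prod.fst = p := by
  unfold prodLaw
  rw [PMF.map_bind]
  simp_rw [PMF.map_comp]
  have h : ∀ a : α, (Prod.fst ∘ fun b : β => (a, b)) = Function.const β a := fun a => rfl
  simp_rw [h, PMF.map_const]
  exact PMF.bind_pure p

theorem map_snd_prodLaw (p : PMF α) (q : PMF β) : (prodLaw p q).map Prod.snd = q := by
  unfold prodLaw
  rw [PMF.map_bind]
  simp_rw [PMF.map_comp]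
  have h : ∀ a : α, (Prod.snd ∘ fun b : β => (a, b)) = id := fun a => rfl
  simp_rw [h, PMF.map_id]
  exact PMF.bind_const p q

theorem map_prodLaw {γ δ : Type} (p : PMF α) (q : PMF β) (f : α → γ) (g : β → δ) :
    (prodLaw p q).map (fun x => (f x.1, g x.2)) = prodLaw (p.map f) (q.map g) := by
  unfold prodLaw
  rw [PMF.map_bind, PMF.bind_map]
  congr 1
  funext a
  simp only [Function.comp, PMF.map_comp]
  rfl

/-- If the members of a finite group act by maps that preserve a law and an event `D`, and at most
one point of each orbit through `D` lies in `B`, then `B ∩ D` has at most the fraction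
`1 / |G|` of the probability of `D`. -/
theorem card_mul_tsum_le {G : Type} [Fintype G] (p : PMF α) (φ : G → α ≃ α)
    (hp : ∀ g a, p (φ g a) = p a) (D B : Set α) (hD : ∀ g a, φ g a ∈ D ↔ a ∈ D)
    (hB : ∀ a ∈ D, ∀ g g', φ g a ∈ B → φ g' a ∈ B → g = g') :
    (Fintype.card G : ℝ≥0∞) * ∑' a, (B ∩ D).indicator p a ≤ ∑' a, D.indicator p a := by
  classical
  have h1 : ∀ g, ∑' a, (B ∩ D).indicator p a = ∑' a, (B ∩ D).indicator p (φ g a) := fun g =>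
    ((φ g).tsum_eq _).symm
  have h2 : (Fintype.card G : ℝ≥0∞) * ∑' a, (B ∩ D).indicator p a
      = ∑ g : G, ∑' a, (B ∩ D).indicator p (φ g a) := by
    rw [← Finset.sum_congr rfl fun g _ => h1 g]
    simp [Finset.card_univ]
  rw [h2, ← tsum_fintype (L := .unconditional G), ENNReal.tsum_comm]
  refine ENNReal.tsum_le_tsum fun a => ?_
  rw [tsum_fintype]
  by_cases ha : a ∈ D
  · by_cases hex : ∃ g, φ g a ∈ B
    · obtain ⟨g, hg⟩ := hex
      rw [Finset.sum_eq_single g]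
      · rw [Set.indicator_of_mem ha]
        exact (Set.indicator_le_self _ _ _).trans (hp g a).le
      · intro g' _ hne
        apply Set.indicator_of_notMem
        exact fun h => hne (hB a ha g' g h.1 hg)
      · simp
    · rw [Finset.sum_eq_zero]
      · exact zero_le
      · intro g _
        apply Set.indicator_of_notMem
        exact fun h => hex ⟨g, h.1⟩
  · rw [Finset.sum_eq_zero]
    · exact zero_le
    · intro g _
      apply Set.indicator_of_notMem
      exact fun h => ha ((hD g a).1 h.2)

/-- If the members of a finite group act on an event `D` and preserve the law, and at most one point
of each orbit lies in `B`, then `B` has at most the conditional probability `1 / |G|`, given `D`. -/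
theorem card_mul_tsum_le_of_act {G : Type} [AddGroup G] [Fintype G] (p : PMF α) (m : G → α → α)
    (D B : Set α) (h0 : ∀ a ∈ D, m 0 a = a) (hadd : ∀ a ∈ D, ∀ g g', m g (m g' a) = m (g + g') a)
    (hD : ∀ a ∈ D, ∀ g, m g a ∈ D) (hp : ∀ a ∈ D, ∀ g, p (m g a) = p a)
    (hB : ∀ a ∈ D, a ∈ B → ∀ g, m g a ∈ B → g = 0) :
    (Fintype.card G : ℝ≥0∞) * ∑' a, (B ∩ D).indicator p a ≤ ∑' a, D.indicator p a := by
  classical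
  have hinv : ∀ g g', g + g' = 0 → ∀ a,
      (if (if a ∈ D then m g' a else a) ∈ D then m g (if a ∈ D then m g' a else a)
        else if a ∈ D then m g' a else a) = a := by
    intro g g' hg a
    by_cases ha : a ∈ D
    · simp only [ha, if_true, hD a ha g']
      rw [hadd a ha, hg, h0 a ha]
    · simp only [ha, if_false]
  refine card_mul_tsum_le p (fun g => ⟨fun a => if a ∈ D then m g a else a,
    fun a => if a ∈ D then m (-g) a else a, hinv (-g) g (neg_add_cancel g),
    hinv g (-g) (add_neg_cancel g)⟩) (fun g a => ?_) D B (fun g a => ?_) fun a ha g g' hg hg' => ?_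
  · change p (if a ∈ D then m g a else a) = p a
    split_ifs with ha
    · exact hp a ha g
    · rfl
  · change (if a ∈ D then m g a else a) ∈ D ↔ a ∈ D
    split_ifs with ha
    · simp [ha, hD a ha g]
    · rfl
  · change (if a ∈ D then m g a else a) ∈ B at hg
    change (if a ∈ D then m g' a else a) ∈ B at hg'
    rw [if_pos ha] at hg hg'
    have h1 := hB (m g' a) (hD a ha g') hg' (g - g') (by
      rw [hadd a ha, sub_add_cancel]; exact hg)
    exact sub_eq_zero.1 h1

/-- A bound on a conditional probability, given a union of disjoint events, follows from the bounds
given the individual events. -/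
theorem tsum_inter_iUnion_le {ι : Type} (p : α → ℝ≥0∞) (B : Set α) (D : ι → Set α)
    (hdisj : ∀ a c c', a ∈ D c → a ∈ D c' → c = c') (κ : ℝ≥0∞)
    (h : ∀ c, ∑' a, (B ∩ D c).indicator p a ≤ κ * ∑' a, (D c).indicator p a) :
    ∑' a, (B ∩ ⋃ c, D c).indicator p a ≤ κ * ∑' a, (⋃ c, D c).indicator p a := by
  classical
  have h1 : ∀ (E : Set α) a, (E ∩ ⋃ c, D c).indicator p a = ∑' c, (E ∩ D c).indicator p a := by
    intro E a
    by_cases ha : a ∈ E ∩ ⋃ c, D c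
    · obtain ⟨hE, hU⟩ := ha
      obtain ⟨c, hc⟩ := Set.mem_iUnion.1 hU
      rw [tsum_eq_single c, Set.indicator_of_mem (show a ∈ E ∩ ⋃ c, D c from ⟨hE, hU⟩),
        Set.indicator_of_mem (show a ∈ E ∩ D c from ⟨hE, hc⟩)]
      intro c' hne
      exact Set.indicator_of_notMem (fun h' => hne (hdisj a c' c h'.2 hc)) _
    · rw [Set.indicator_of_notMem ha, eq_comm, ENNReal.tsum_eq_zero]
      intro c
      exact Set.indicator_of_notMem
        (fun h' => ha ⟨h'.1, Set.mem_iUnion.2 ⟨c, h'.2⟩⟩) _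
  have h2 := h1 Set.univ
  simp only [Set.univ_inter] at h2
  simp_rw [h1, h2]
  rw [ENNReal.tsum_comm, ENNReal.tsum_comm (f := fun a c => (D c).indicator p a),
    ← ENNReal.tsum_mul_left]
  exact ENNReal.tsum_le_tsum h

theorem tsum_indicator_mono (p : α → ℝ≥0∞) {D E : Set α} (h : D ⊆ E) :
    ∑' a, D.indicator p a ≤ ∑' a, E.indicator p a :=
  ENNReal.tsum_le_tsum fun a => Set.indicator_le_indicator_of_subset h (fun _ => zero_le) a

theorem tsum_indicator_union_le (p : α → ℝ≥0∞) (D E : Set α) :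
    ∑' a, (D ∪ E).indicator p a ≤ ∑' a, D.indicator p a + ∑' a, E.indicator p a := by
  rw [← ENNReal.tsum_add]
  refine ENNReal.tsum_le_tsum fun a => ?_
  by_cases h1 : a ∈ D <;> by_cases h2 : a ∈ E <;> simp [h1, h2]

theorem tsum_indicator_le_inv_mul (p : α → ℝ≥0∞) {D D' E B : Set α} {N : ℕ}
    (hN : N ≠ 0) (h : (N : ℝ≥0∞) * ∑' a, (B ∩ D').indicator p a ≤ ∑' a, D'.indicator p a)
    (hE : E ⊆ B ∩ D') (hD : D' ⊆ D) :
    ∑' a, E.indicator p a ≤ (N : ℝ≥0∞)⁻¹ * ∑' a, D.indicator p a := by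
  rw [← ENNReal.div_eq_inv_mul, ENNReal.le_div_iff_mul_le (by simp [hN]) (by simp), mul_comm]
  calc (N : ℝ≥0∞) * ∑' a, E.indicator p a ≤ N * ∑' a, (B ∩ D').indicator p a := by
        gcongr
    _ ≤ _ := h.trans (tsum_indicator_mono p hD)

end Laws

section Utility

variable {n : ℕ}

theorem expUtility_bind_le {α : Type} (p : PMF α) (f : α → PMF (Finset (Fin n)))
    (v : Finset (Fin n) → ℝ) (c : ℝ) (h : ∀ a, Protocol.expUtility (f a) v ≤ c) :
    Protocol.expUtility (p.bind f) v ≤ c := by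
  unfold Protocol.expUtility at *
  have hsum : Summable fun a => (p a).toReal :=
    ENNReal.summable_toReal (by rw [p.tsum_coe]; exact ENNReal.one_ne_top)
  have hle : ∀ a R, (f a R).toReal ≤ 1 := fun a R =>
    ENNReal.toReal_le_of_le_ofReal zero_le_one (by simpa using (f a).coe_le_one R)
  have hsumR : ∀ R, Summable fun a => (p a).toReal * (f a R).toReal := fun R =>
    Summable.of_nonneg_of_le (fun a => by positivity)
      (fun a => mul_le_of_le_one_right ENNReal.toReal_nonneg (hle a R)) hsum
  have h1 : ∀ R, (p.bind f R).toReal * v R = ∑' a, (p a).toReal * (f a R).toReal * v R := by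
    intro R
    rw [PMF.bind_apply, ENNReal.tsum_toReal_eq, ← tsum_mul_right]
    · simp_rw [ENNReal.toReal_mul]
    · intro a
      exact ENNReal.mul_ne_top (p.apply_ne_top a) ((f a).apply_ne_top R)
  simp_rw [h1]
  rw [← Summable.tsum_finsetSum fun R _ => (hsumR R).mul_right (v R)]
  have hone : ∑' a, (p a).toReal = 1 := by
    rw [← ENNReal.tsum_toReal_eq fun a => p.apply_ne_top a, p.tsum_coe]; simp
  calc ∑' a, ∑ R, (p a).toReal * (f a R).toReal * v R
      ≤ ∑' a, (p a).toReal * c := by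
        refine Summable.tsum_le_tsum (fun a => ?_)
          (summable_sum fun R _ => (hsumR R).mul_right (v R)) (hsum.mul_right c)
        simp_rw [mul_assoc, ← Finset.mul_sum]
        exact mul_le_mul_of_nonneg_left (h a) ENNReal.toReal_nonneg
    _ = c := by rw [tsum_mul_right, hone, one_mul]

theorem expUtility_map_fintype {α : Type} [Fintype α] (p : PMF α)
    (f : α → Finset (Fin n)) (v : Finset (Fin n) → ℝ) :
    Protocol.expUtility (p.map f) v = ∑ a, (p a).toReal * v (f a) := by
  classical
  unfold Protocol.expUtility
  have h : ∀ R, ((p.map f) R).toReal * v R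
      = ∑ a, if R = f a then (p a).toReal * v (f a) else 0 := by
    intro R
    rw [PMF.map_apply, tsum_fintype, ENNReal.toReal_sum, Finset.sum_mul]
    · refine Finset.sum_congr rfl fun a _ => ?_
      by_cases hR : R = f a
      · simp [hR]
      · simp [hR]
    · intro a _
      split_ifs
      · exact p.apply_ne_top a
      · simp
  simp_rw [h]
  rw [Finset.sum_comm]
  exact Finset.sum_congr rfl fun a _ => by simp

theorem le_bestLearning (u : Fin n → Finset (Fin n) → ℝ) {j : Fin n} {R : Finset (Fin n)}
    (h : j ∈ R) : u j R ≤ bestLearning u j :=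
  Finset.le_sup' (u j) (by simpa using h)

theorem worstLearning_le (u : Fin n → Finset (Fin n) → ℝ) {j : Fin n} {R : Finset (Fin n)}
    (h : j ∈ R) : worstLearning u j ≤ u j R :=
  Finset.inf'_le (u j) (by simpa using h)

theorem le_bestNotLearning (u : Fin n → Finset (Fin n) → ℝ) {j : Fin n} {R : Finset (Fin n)}
    (h : j ∉ R) : u j R ≤ bestNotLearning u j :=
  Finset.le_sup' (u j) (by simpa using h)

theorem LearningPreferring.bestNotLearning_lt {u : Fin n → Finset (Fin n) → ℝ}
    (hu : LearningPreferring u) (j : Fin n) : bestNotLearning u j < worstLearning u j := by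
  have h1 : (Finset.univ.filter fun R : Finset (Fin n) => j ∉ R).Nonempty := ⟨∅, by simp⟩
  have h2 : (Finset.univ.filter fun R : Finset (Fin n) => j ∈ R).Nonempty :=
    ⟨Finset.univ, by simp⟩
  obtain ⟨R', hR', e'⟩ := Finset.exists_mem_eq_sup' h1 (u j)
  obtain ⟨R, hR, e⟩ := Finset.exists_mem_eq_inf' h2 (u j)
  have e1 : bestNotLearning u j = u j R' := e'
  have e2 : worstLearning u j = u j R := e
  rw [e1, e2]
  exact hu j R R' (by simpa using hR) (by simpa using hR')

/-- The utility ratio is at least `1`, so a bound on it is at least `1`, too. -/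
theorem LearningPreferring.one_le_of_ratio_le {u : Fin n → Finset (Fin n) → ℝ}
    (hu : LearningPreferring u) {U : ℝ} {j : Fin n}
    (hU : (bestLearning u j - bestNotLearning u j) /
      (worstLearning u j - bestNotLearning u j) ≤ U) : 1 ≤ U := by
  refine le_trans ?_ hU
  rw [one_le_div (sub_pos.2 (hu.bestNotLearning_lt j))]
  have h1 := worstLearning_le u (Finset.mem_univ j)
  have h2 := le_bestLearning u (Finset.mem_univ j)
  linarith

theorem expUtility_pure (R : Finset (Fin n)) (v : Finset (Fin n) → ℝ) :
    Protocol.expUtility (PMF.pure R) v = v R := by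
  classical
  unfold Protocol.expUtility
  rw [Finset.sum_eq_single R]
  · simp
  · intro R' _ h
    simp [h]
  · simp

/-- A deviation does not pay if, outside of an event `D`, all the other players learn the secret,
and if, given `D`, the deviating player learns it with probability at most `1 / U`. -/
theorem expUtility_map_le {α : Type} (p : PMF α) (f : α → Finset (Fin n)) (D : Set α)
    {A : Finset (Fin n)} {j : Fin n} (hj : j ∈ A) {u : Fin n → Finset (Fin n) → ℝ}
    (hu : LearningPreferring u) {U : ℝ}
    (hU : (bestLearning u j - bestNotLearning u j) /
      (worstLearning u j - bestNotLearning u j) ≤ U)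
    (hout : ∀ a, a ∉ D → f a = A ∨ f a = A.erase j)
    (hin : ∑' a, ({a | j ∈ f a} ∩ D).indicator p a
      ≤ ENNReal.ofReal (1 / U) * ∑' a, D.indicator p a) :
    Protocol.expUtility (p.map f) (u j) ≤ u j A := by
  classical
  have hU1 : 1 ≤ U := hu.one_le_of_ratio_le hU
  set J : PMF (Finset (Fin n) × Bool) := p.map fun a => (f a, decide (a ∈ D)) with hJ
  set q : Finset (Fin n) → Bool → ℝ := fun R b => (J (R, b)).toReal with hq
  have hq0 : ∀ R b, 0 ≤ q R b := fun R b => ENNReal.toReal_nonneg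
  have hmap : p.map f = J.map Prod.fst := by
    rw [hJ, PMF.map_comp]; rfl
  have hlaw : ∀ R, ((p.map f) R).toReal = q R false + q R true := by
    intro R
    have : p.map f R = J (R, false) + J (R, true) := by
      rw [hmap, PMF.map_apply, tsum_fintype, Fintype.sum_prod_type]
      rw [Finset.sum_eq_single R]
      · simp [add_comm]
      · intro R' _ h
        simp [Ne.symm h]
      · simp
    rw [this, ENNReal.toReal_add (J.apply_ne_top _) (J.apply_ne_top _)]
  have htot : ∑ R, q R false + ∑ R, q R true = 1 := by
    have h1 : ∑ x : Finset (Fin n) × Bool, J x = 1 := by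
      rw [← tsum_fintype (L := .unconditional _), J.tsum_coe]
    have h2 := congrArg ENNReal.toReal h1
    rw [ENNReal.toReal_sum fun x _ => J.apply_ne_top x, Fintype.sum_prod_type] at h2
    simp only [Fintype.sum_bool, ENNReal.toReal_one] at h2
    rw [← Finset.sum_add_distrib, ← h2]
    exact Finset.sum_congr rfl fun R _ => add_comm _ _
  have hfalse : ∀ R, q R false * u j R ≤ q R false * u j A := by
    intro R
    by_cases h : R = A ∨ R = A.erase j
    · refine mul_le_mul_of_nonneg_left ?_ (hq0 _ _)
      rcases h with h | h
      · rw [h]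
      · exact (hu j A R hj (by simp [h])).le
    · have : J (R, false) = 0 := by
        rw [hJ, PMF.map_apply, ENNReal.tsum_eq_zero]
        intro a
        rw [if_neg]
        intro h'
        simp only [Prod.mk.injEq] at h'
        have hD : a ∉ D := by simpa using h'.2.symm
        rw [h'.1] at h
        exact h (hout a hD)
      simp [hq, this]
  have hD : ∑ R, q R true = (∑' a, D.indicator p a).toReal := by
    have h1 := tsum_map_mul p (fun a => (f a, decide (a ∈ D)))
      (fun x : Finset (Fin n) × Bool => if x.2 then 1 else 0)
    rw [← hJ, tsum_fintype, Fintype.sum_prod_type] at h1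
    have h2 : ∑' a, D.indicator p a = ∑ R, J (R, true) := by
      simp only [Fintype.sum_bool] at h1
      simp only [if_true, mul_one, Bool.false_eq_true, if_false, mul_zero, add_zero] at h1
      rw [h1]
      refine tsum_congr fun a => ?_
      by_cases ha : a ∈ D <;> simp [ha]
    rw [h2, ENNReal.toReal_sum fun x _ => J.apply_ne_top _]
  have hB : ∑ R, (if j ∈ R then q R true else 0)
      = (∑' a, ({a | j ∈ f a} ∩ D).indicator p a).toReal := by
    have h1 := tsum_map_mul p (fun a => (f a, decide (a ∈ D)))
      (fun x : Finset (Fin n) × Bool => if x.2 ∧ j ∈ x.1 then 1 else 0)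
    rw [← hJ, tsum_fintype, Fintype.sum_prod_type] at h1
    have h2 : ∑' a, ({a | j ∈ f a} ∩ D).indicator p a
        = ∑ R, (if j ∈ R then J (R, true) else 0) := by
      simp only [Fintype.sum_bool] at h1
      simp only [true_and, mul_ite, mul_one, Bool.false_eq_true, false_and, if_false, mul_zero,
        add_zero] at h1
      rw [h1]
      refine tsum_congr fun a => ?_
      by_cases ha : a ∈ D <;> by_cases hja : j ∈ f a <;> simp [ha, hja]
    rw [h2, ENNReal.toReal_sum]
    · refine Finset.sum_congr rfl fun R _ => ?_
      split_ifs <;> simp [hq]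
    · intro R _
      split_ifs
      · exact J.apply_ne_top _
      · simp
  set a := ∑ R, q R true with ha
  set b := ∑ R, (if j ∈ R then q R true else 0) with hb
  have hab : b ≤ (1 / U) * a := by
    rw [hD, hB]
    have hfin : ∑' a, D.indicator p a ≠ ⊤ :=
      ne_top_of_le_ne_top (by rw [p.tsum_coe]; exact ENNReal.one_ne_top)
        (ENNReal.tsum_le_tsum fun a => Set.indicator_le_self D p a)
    have := ENNReal.toReal_mono (ENNReal.mul_ne_top ENNReal.ofReal_ne_top hfin) hin
    rwa [ENNReal.toReal_mul, ENNReal.toReal_ofReal (by positivity)] at this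
  set x := bestLearning u j
  set y := bestNotLearning u j
  set w := worstLearning u j
  have hyw : y < w := hu.bestNotLearning_lt j
  have hwx : w ≤ x := (worstLearning_le u (Finset.mem_univ j)).trans
    (le_bestLearning u (Finset.mem_univ j))
  have hwA : w ≤ u j A := worstLearning_le u hj
  have htrue : ∑ R, q R true * u j R ≤ a * y + b * (x - y) := by
    rw [ha, hb, Finset.sum_mul, Finset.sum_mul, ← Finset.sum_add_distrib]
    refine Finset.sum_le_sum fun R _ => ?_
    by_cases hR : j ∈ R
    · have := mul_le_mul_of_nonneg_left (le_bestLearning u hR) (hq0 R true)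
      simp only [hR, if_true]
      change _ ≤ q R true * x at this
      linarith
    · have := mul_le_mul_of_nonneg_left (le_bestNotLearning u hR) (hq0 R true)
      simp only [hR, if_false]
      change _ ≤ q R true * y at this
      linarith
  have ha0 : 0 ≤ a := Finset.sum_nonneg fun R _ => hq0 _ _
  have hxy : (1 / U) * (x - y) ≤ w - y := by
    rw [div_le_iff₀ (sub_pos.2 hyw)] at hU
    rw [one_div, inv_mul_le_iff₀ (by linarith)]
    exact hU
  have hmain : a * y + b * (x - y) ≤ a * u j A := by
    have h1 : b * (x - y) ≤ a * (w - y) := by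
      calc b * (x - y) ≤ (1 / U) * a * (x - y) :=
            mul_le_mul_of_nonneg_right hab (by linarith)
        _ = a * ((1 / U) * (x - y)) := by ring
        _ ≤ a * (w - y) := mul_le_mul_of_nonneg_left hxy ha0
    have h2 := mul_le_mul_of_nonneg_left hwA ha0
    linarith
  unfold Protocol.expUtility
  simp_rw [hlaw, add_mul]
  rw [Finset.sum_add_distrib]
  have h3 : ∑ R, q R false * u j R ≤ (∑ R, q R false) * u j A := by
    rw [Finset.sum_mul]
    exact Finset.sum_le_sum fun R _ => hfalse R
  have h4 : (∑ R, q R false) = 1 - a := by linarith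
  rw [h4] at h3
  linarith

end Utility

/-! ### Protocols for one active set and their combination -/

namespace Protocol

variable {n : ℕ} {S : Type} (P : Protocol n S)

theorem exists_mem_univ : ∃ ω ∈ (Set.univ : Set P.Coins), ω ∈ P.coins.support :=
  let ⟨ω, h⟩ := P.coins.support_nonempty
  ⟨ω, trivial, h⟩

theorem condCoins_univ (h : ∃ ω ∈ (Set.univ : Set P.Coins), ω ∈ P.coins.support) :
    P.condCoins Set.univ h = P.coins := by
  ext ω
  simp [condCoins, PMF.filter_apply, P.coins.tsum_coe]

/-- The shares of the players in `A` reveal nothing about the secret. -/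
def HiddenFrom (A : Finset (Fin n)) : Prop :=
  P.Hidden A Set.univ P.exists_mem_univ

theorem hiddenFrom_iff {A : Finset (Fin n)} : P.HiddenFrom A ↔ ∀ s s' : S,
    P.coins.map (fun ω (i : {i // i ∈ A}) => P.deal s ω i) =
      P.coins.map (fun ω (i : {i // i ∈ A}) => P.deal s' ω i) := by
  unfold HiddenFrom Hidden
  rw [condCoins_univ]

/-- If replacing the secret can be compensated by a permutation of the coins that preserves their
law and the shares of the players in `A`, then those players know nothing about the secret. -/
theorem hiddenFrom_of_equiv {A : Finset (Fin n)}
    (h : ∀ s s' : S, ∃ φ : P.Coins ≃ P.Coins, (∀ ω, P.coins (φ ω) = P.coins ω) ∧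
      ∀ ω, ∀ i ∈ A, P.deal s' (φ ω) i = P.deal s ω i) : P.HiddenFrom A := by
  rw [hiddenFrom_iff]
  intro s s'
  obtain ⟨φ, hφ, hd⟩ := h s s'
  have hlaw : P.coins.map φ = P.coins := by
    ext ω
    classical
    rw [PMF.map_apply, tsum_eq_single (φ.symm ω)]
    · rw [if_pos (by simp), ← hφ]; simp
    · intro ω' hne
      rw [if_neg]
      rintro rfl
      simp at hne
  conv_rhs => rw [← hlaw, PMF.map_comp]
  congr 1
  funext ω i
  exact (hd ω i i.2).symm

open Classical in
/-- Two protocols are run side by side, on independent coins of the dealer; the set of active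
players decides which of the two the players actually follow. -/
noncomputable def either (𝒜 : Finset (Fin n) → Prop) (P₁ P₂ : Protocol n S) : Protocol n S where
  Coins := P₁.Coins × P₂.Coins
  coins := prodLaw P₁.coins P₂.coins
  Share := P₁.Share × P₂.Share
  deal s ω i := (P₁.deal s ω.1 i, P₂.deal s ω.2 i)
  player A i x := if 𝒜 A then P₁.player A i x.1 else P₂.player A i x.2

theorem HiddenFrom.map_deal {P : Protocol n S} {j : Fin n} (h : P.HiddenFrom {j}) (s s' : S) :
    P.coins.map (fun ω => P.deal s ω j) = P.coins.map (fun ω => P.deal s' ω j) := by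
  have h1 := congrArg (PMF.map fun x => x ⟨j, Finset.mem_singleton_self j⟩)
    (P.hiddenFrom_iff.1 h s s')
  rw [PMF.map_comp, PMF.map_comp] at h1
  exact h1

theorem HiddenFrom.either {𝒜 : Finset (Fin n) → Prop} {P₁ P₂ : Protocol n S}
    {A : Finset (Fin n)} (h₁ : P₁.HiddenFrom A) (h₂ : P₂.HiddenFrom A) :
    (either 𝒜 P₁ P₂).HiddenFrom A := by
  rw [hiddenFrom_iff] at *
  intro s s'
  have key : ∀ s, (Protocol.either 𝒜 P₁ P₂).coins.map
      (fun ω (i : {i // i ∈ A}) => (Protocol.either 𝒜 P₁ P₂).deal s ω i)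
      = (prodLaw (P₁.coins.map fun ω (i : {i // i ∈ A}) => P₁.deal s ω i)
          (P₂.coins.map fun ω (i : {i // i ∈ A}) => P₂.deal s ω i)).map
        fun x i => (x.1 i, x.2 i) := by
    intro s
    rw [← map_prodLaw, PMF.map_comp]
    rfl
  rw [key, key, h₁ s s', h₂ s s']

variable [Fintype S] [Nonempty S]

/-- Without any conditioning of the dealer's coins, the protocol does what is asked for when `A` is
the set of active players. -/
structure Handles (A : Finset (Fin n)) (U C thr : ℝ) : Prop where
  nash : (A.card ≠ 2 ∨ (A.card : ℝ) / n < thr) → ∀ u : Fin n → Finset (Fin n) → ℝ,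
    LearningPreferring u →
    (∀ j, (bestLearning u j - bestNotLearning u j) /
      (worstLearning u j - bestNotLearning u j) ≤ U) →
    P.IsNash A Set.univ P.exists_mem_univ u
  learn : thr ≤ (A.card : ℝ) / n → P.AllLearn A Set.univ
  bits : ∀ s : S, ∀ i ∈ A,
    P.expBits A Set.univ P.exists_mem_univ s i ≤ ENNReal.ofReal (C * Real.log n ^ 2)
  latency : ∀ s : S,
    P.expLatency A Set.univ P.exists_mem_univ s ≤ ENNReal.ofReal (C * Real.log n)

variable {P}

/-- A protocol `P'` inherits the properties of `P` for the active set `A` if the active players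
behave as in `P`, and if the share of each of them consists of its share in `P` and of side
information that is independent of the coins of `P` and of the secret. -/
theorem Handles.transfer {P' : Protocol n S} {A : Finset (Fin n)} {U C thr : ℝ}
    (h : P.Handles A U C thr) (π : P'.Coins → P.Coins)
    (hstrat : ∀ s ω, P'.strat A s ω = P.strat A s (π ω)) (hπ : P'.coins.map π = P.coins)
    (hside : ∀ j : Fin n, ∃ (Y : Type) (ν : PMF Y) (side : S → P'.Coins → Y)
      (mk : P.Share → Y → P'.Share),
      (∀ s ω, P'.deal s ω j = mk (P.deal s (π ω) j) (side s ω)) ∧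
        ∀ s, P'.coins.map (fun ω => (π ω, side s ω)) = prodLaw P.coins ν) :
    P'.Handles A U C thr where
  nash hA u hu hU := by
    intro j hj ρ
    have h0 := h.nash hA u hu hU j hj
    have hout : P'.outcome A Set.univ P'.exists_mem_univ
        = P.outcome A Set.univ P.exists_mem_univ := by
      unfold outcome
      simp_rw [condCoins_univ, hstrat]
      congr 1
      funext s
      rw [← hπ, PMF.map_comp]
      rfl
    obtain ⟨Y, ν, side, mk, hdeal, hlaw⟩ := hside j
    have hdev : P'.outcomeDev A Set.univ P'.exists_mem_univ j ρ
        = ν.bind fun y => P.outcomeDev A Set.univ P.exists_mem_univ j fun x => ρ (mk x y) := by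
      unfold outcomeDev
      simp_rw [condCoins_univ, hstrat, hdeal]
      rw [PMF.bind_comm]
      congr 1
      funext s
      have h1 : (fun ω => learnersDev A (P.strat A s (π ω)) j
            (ρ (mk (P.deal s (π ω) j) (side s ω))) s)
          = (fun x : P.Coins × Y => learnersDev A (P.strat A s x.1) j
            (ρ (mk (P.deal s x.1 j) x.2)) s) ∘ fun ω => (π ω, side s ω) := rfl
      rw [h1, ← PMF.map_comp, hlaw, prodLaw_comm, PMF.map_bind]
      simp_rw [PMF.map_comp]
      rfl
    rw [hout, hdev]
    exact expUtility_bind_le _ _ _ _ fun y => h0 _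
  learn hA s ω _ hω := by
    rw [hstrat]
    refine h.learn hA s (π ω) trivial ?_
    rw [← hπ, PMF.mem_support_map_iff]
    exact ⟨ω, hω, rfl⟩
  bits s i hi := by
    refine le_trans (le_of_eq ?_) (h.bits s i hi)
    unfold expBits
    simp_rw [condCoins_univ, hstrat]
    rw [← hπ, tsum_map_mul]
  latency s := by
    refine le_trans (le_of_eq ?_) (h.latency s)
    unfold expLatency
    simp_rw [condCoins_univ, hstrat]
    rw [← hπ, tsum_map_mul]

theorem Handles.either_left {𝒜 : Finset (Fin n) → Prop} {P₁ P₂ : Protocol n S}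
    {A : Finset (Fin n)} {U C thr : ℝ} (h : P₁.Handles A U C thr) (hA : 𝒜 A)
    (hid : ∀ j, P₂.HiddenFrom {j}) : (either 𝒜 P₁ P₂).Handles A U C thr := by
  refine h.transfer (P' := Protocol.either 𝒜 P₁ P₂) Prod.fst ?_ (map_fst_prodLaw _ _) ?_
  · intro s ω
    funext i
    simp only [strat, Protocol.either, if_pos hA]
  · intro j
    obtain ⟨s₀⟩ := ‹Nonempty S›
    refine ⟨P₂.Share, P₂.coins.map fun ω => P₂.deal s₀ ω j, fun s ω => P₂.deal s ω.2 j,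
      Prod.mk, fun s ω => rfl, fun s => ?_⟩
    rw [← (hid j).map_deal s s₀]
    have := map_prodLaw P₁.coins P₂.coins id fun ω => P₂.deal s ω j
    rw [PMF.map_id] at this
    exact this

theorem Handles.either_right {𝒜 : Finset (Fin n) → Prop} {P₁ P₂ : Protocol n S}
    {A : Finset (Fin n)} {U C thr : ℝ} (h : P₂.Handles A U C thr) (hA : ¬ 𝒜 A)
    (hid : ∀ j, P₁.HiddenFrom {j}) : (either 𝒜 P₁ P₂).Handles A U C thr := by
  refine h.transfer (P' := Protocol.either 𝒜 P₁ P₂) Prod.snd ?_ (map_snd_prodLaw _ _) ?_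
  · intro s ω
    funext i
    simp only [strat, Protocol.either, if_neg hA]
  · intro j
    obtain ⟨s₀⟩ := ‹Nonempty S›
    refine ⟨P₁.Share, P₁.coins.map fun ω => P₁.deal s₀ ω j, fun s ω => P₁.deal s ω.1 j,
      fun x y => (y, x), fun s ω => rfl, fun s => ?_⟩
    rw [← (hid j).map_deal s s₀]
    have h1 := map_prodLaw P₁.coins P₂.coins (fun ω => P₁.deal s ω j) id
    rw [PMF.map_id] at h1
    have h2 := congrArg (PMF.map Prod.swap) h1
    rw [PMF.map_comp] at h2
    refine h2.trans ?_
    rw [prodLaw_comm, PMF.map_bind]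
    unfold prodLaw
    simp_rw [PMF.map_comp]
    rfl

/-- Protocols for the individual active sets, each of which hides the secret from all sets in
`small`, can be combined into a single protocol: the dealer runs all of them independently. -/
theorem exists_handles_all {small : Finset (Fin n) → Prop} (hsmall : ∀ j, small {j})
    {U C thr : ℝ} (I : Finset (Fin n) → Protocol n S)
    (hI : ∀ A, (I A).Handles A U C thr) (hid : ∀ A B, small B → (I A).HiddenFrom B) :
    ∃ P : Protocol n S, (∀ A, P.Handles A U C thr) ∧ ∀ B, small B → P.HiddenFrom B := by
  classical
  have key : ∀ 𝒜 : Finset (Finset (Fin n)), ∃ P : Protocol n S,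
      (∀ A ∈ 𝒜, P.Handles A U C thr) ∧ ∀ B, small B → P.HiddenFrom B := by
    intro 𝒜
    induction 𝒜 using Finset.induction_on with
    | empty => exact ⟨I ∅, by simp, hid ∅⟩
    | insert A₀ 𝒜 _ ih =>
      obtain ⟨P, hP, hPid⟩ := ih
      refine ⟨either (fun A => A = A₀) (I A₀) P, ?_, fun B hB =>
        (hid A₀ B hB).either (hPid B hB)⟩
      intro A hA
      by_cases h : A = A₀
      · subst h
        exact (hI A).either_left rfl fun j => hPid _ (hsmall j)
      · have hA' : A ∈ 𝒜 := by simpa [h] using hA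
        exact (hP A hA').either_right h fun j => hid _ _ (hsmall j)
  obtain ⟨P, h1, h2⟩ := key Finset.univ
  exact ⟨P, fun A => h1 A (Finset.mem_univ A), h2⟩

end Protocol

/-! ### Runs of a protocol -/

section Learners

variable {n : ℕ} {S : Type}

theorem viewsDev_succ (A : Finset (Fin n)) (σ : Fin n → Strategy n S) (j : Fin n)
    (ρ : Strategy n S) (r : ℕ) (i : Fin n) :
    viewsDev A σ j ρ (r + 1) i = viewsDev A σ j ρ r i ++
      [deliver (sentDev A σ j ρ (viewsDev A σ j ρ r)) i] := rfl

theorem Learns.unique {ρ : Strategy n S} {v : ℕ → List (Inbox n)} {s s' : S}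
    (h : Learns ρ v s) (h' : Learns ρ v s') : s = s' := by
  obtain ⟨r, h1, h2⟩ := h
  obtain ⟨r', h1', h2'⟩ := h'
  rcases lt_trichotomy r r' with hlt | heq | hgt
  · rw [h2' r hlt] at h1; exact absurd h1 (by simp)
  · subst heq
    rw [h1] at h1'
    exact Option.some.inj h1'
  · rw [h2 r' hgt] at h1'; exact absurd h1' (by simp)

theorem mem_learners {A : Finset (Fin n)} {σ : Fin n → Strategy n S} {s : S} {i : Fin n} :
    i ∈ learners A σ s ↔ i ∈ A ∧ Learns (σ i) (fun r => views A σ r i) s := by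
  simp [learners]

theorem mem_learnersDev {A : Finset (Fin n)} {σ : Fin n → Strategy n S} {j : Fin n}
    {ρ : Strategy n S} {s : S} {i : Fin n} :
    i ∈ learnersDev A σ j ρ s ↔
      i ∈ A ∧ Learns (Function.update σ j ρ i) (fun r => viewsDev A σ j ρ r i) s := by
  simp [learnersDev]

theorem learners_eq {A : Finset (Fin n)} {σ : Fin n → Strategy n S} {s : S}
    (h : ∀ i ∈ A, Learns (σ i) (fun r => views A σ r i) s) : learners A σ s = A := by
  ext i
  rw [mem_learners]
  exact ⟨fun hi => hi.1, fun hi => ⟨hi, h i hi⟩⟩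

theorem learnersDev_eq {A : Finset (Fin n)} {σ : Fin n → Strategy n S} {j : Fin n}
    {ρ : Strategy n S} {s : S}
    (h : ∀ i ∈ A, i ≠ j → Learns (σ i) (fun r => viewsDev A σ j ρ r i) s) :
    learnersDev A σ j ρ s = A ∨ learnersDev A σ j ρ s = A.erase j := by
  by_cases hj : j ∈ A → j ∈ learnersDev A σ j ρ s
  · left
    ext i
    refine ⟨fun hi => (mem_learnersDev.1 hi).1, fun hi => ?_⟩
    by_cases hij : i = j
    · rw [hij] at hi ⊢
      exact hj hi
    · rw [mem_learnersDev, Function.update_of_ne hij]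
      exact ⟨hi, h i hi hij⟩
  · right
    rw [Classical.not_imp] at hj
    ext i
    rw [Finset.mem_erase]
    refine ⟨fun hi => ⟨?_, (mem_learnersDev.1 hi).1⟩, fun hi => ?_⟩
    · rintro rfl
      exact hj.2 hi
    · rw [mem_learnersDev, Function.update_of_ne hi.1]
      exact ⟨hi.2, h i hi.2 hi.1⟩

theorem latency_le {A : Finset (Fin n)} {σ : Fin n → Strategy n S} {r : ℕ}
    (h : ∀ i ∈ A, ∃ r' ≤ r, ((σ i).out (views A σ r' i)).isSome) : latency A σ ≤ r :=
  iInf₂_le r h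

/-! The following lemmas apply to honest runs and to runs with a deviating player: `o r` are the
messages of step `r`, and `h r` lists what has been received in the first `r` steps. -/

theorem run_eq_map {h : ℕ → Fin n → List (Inbox n)} {o : ℕ → Fin n → Fin n → List Bool}
    (h0 : ∀ i, h 0 i = []) (hs : ∀ r i, h (r + 1) i = h r i ++ [deliver (o r) i])
    (r : ℕ) (i : Fin n) : h r i = (List.range r).map fun t => deliver (o t) i := by
  induction r with
  | zero => simp [h0]
  | succ r ih => rw [hs, ih, List.range_succ, List.map_append, List.map_singleton]

theorem run_getD {h : ℕ → Fin n → List (Inbox n)} {o : ℕ → Fin n → Fin n → List Bool}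
    (h0 : ∀ i, h 0 i = []) (hs : ∀ r i, h (r + 1) i = h r i ++ [deliver (o r) i])
    {r t : ℕ} (ht : t < r) (i : Fin n) :
    (h r i).getD t (fun _ => []) = deliver (o t) i := by
  rw [run_eq_map h0 hs, List.getD_eq_getElem _ _ (by simpa using ht)]
  simp

theorem run_length {h : ℕ → Fin n → List (Inbox n)} {o : ℕ → Fin n → Fin n → List Bool}
    (h0 : ∀ i, h 0 i = []) (hs : ∀ r i, h (r + 1) i = h r i ++ [deliver (o r) i])
    (r : ℕ) (i : Fin n) : (h r i).length = r := by
  rw [run_eq_map h0 hs]; simp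

theorem length_views (A : Finset (Fin n)) (σ : Fin n → Strategy n S) (r : ℕ) (i : Fin n) :
    (views A σ r i).length = r :=
  run_length (o := fun r => sent A σ (views A σ r)) (fun _ => rfl) (fun _ _ => rfl) r i

end Learners

namespace Protocol

variable {n : ℕ} {S : Type} (P : Protocol n S)

theorem expBits_le {A : Finset (Fin n)} {s : S} {i : Fin n} {c : ℝ≥0∞}
    (h : ∀ ω, bitsSent A (P.strat A s ω) i ≤ c) :
    P.expBits A Set.univ P.exists_mem_univ s i ≤ c := by
  unfold expBits
  rw [condCoins_univ]
  calc ∑' ω, P.coins ω * bitsSent A (P.strat A s ω) i ≤ ∑' ω, P.coins ω * c :=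
        ENNReal.tsum_le_tsum fun ω => by gcongr; exact h ω
    _ = c := by rw [ENNReal.tsum_mul_right, P.coins.tsum_coe, one_mul]

theorem expLatency_le {A : Finset (Fin n)} {s : S} {c : ℝ≥0∞}
    (h : ∀ ω, latency A (P.strat A s ω) ≤ c) :
    P.expLatency A Set.univ P.exists_mem_univ s ≤ c := by
  unfold expLatency
  rw [condCoins_univ]
  calc ∑' ω, P.coins ω * latency A (P.strat A s ω) ≤ ∑' ω, P.coins ω * c :=
        ENNReal.tsum_le_tsum fun ω => by gcongr; exact h ω
    _ = c := by rw [ENNReal.tsum_mul_right, P.coins.tsum_coe, one_mul]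

variable [Fintype S] [Nonempty S]

theorem outcome_eq_map (A : Finset (Fin n)) :
    P.outcome A Set.univ P.exists_mem_univ =
      (prodLaw (PMF.uniformOfFintype S) P.coins).map fun x =>
        learners A (P.strat A x.1 x.2) x.1 := by
  unfold outcome prodLaw
  rw [condCoins_univ, PMF.map_bind]
  simp_rw [PMF.map_comp]
  rfl

theorem outcomeDev_eq_map (A : Finset (Fin n)) (j : Fin n) (ρ : P.Share → Strategy n S) :
    P.outcomeDev A Set.univ P.exists_mem_univ j ρ =
      (prodLaw (PMF.uniformOfFintype S) P.coins).map fun x =>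
        learnersDev A (P.strat A x.1 x.2) j (ρ (P.deal x.1 x.2 j)) x.1 := by
  unfold outcomeDev prodLaw
  rw [condCoins_univ, PMF.map_bind]
  simp_rw [PMF.map_comp]
  rfl

theorem expUtility_outcome {A : Finset (Fin n)} (h : P.AllLearn A Set.univ)
    (v : Finset (Fin n) → ℝ) :
    expUtility (P.outcome A Set.univ P.exists_mem_univ) v = v A := by
  have : P.outcome A Set.univ P.exists_mem_univ = PMF.pure A := by
    have h1 : ∀ s : S, P.coins.map (fun ω => learners A (P.strat A s ω) s) = PMF.pure A := by
      intro s
      rw [← PMF.map_const P.coins A, ← PMF.bind_pure_comp, ← PMF.bind_pure_comp]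
      ext R
      rw [PMF.bind_apply, PMF.bind_apply]
      refine tsum_congr fun ω => ?_
      by_cases hω : ω ∈ P.coins.support
      · simp only [Function.comp, Function.const, h s ω trivial hω]
      · rw [PMF.mem_support_iff, not_not] at hω
        simp [hω]
    unfold outcome
    rw [condCoins_univ]
    simp_rw [h1]
    exact PMF.bind_const _ _
  rw [this, expUtility_pure]

/-- If no single player can keep the others from learning the secret, then it cannot gain by a
deviation. -/
theorem isNash_of_learns {A : Finset (Fin n)} (h : P.AllLearn A Set.univ)
    (hdev : ∀ s ω, ∀ j ∈ A, ∀ ρ : Strategy n S, ∀ i ∈ A, i ≠ j →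
      Learns (P.strat A s ω i) (fun r => viewsDev A (P.strat A s ω) j ρ r i) s)
    {u : Fin n → Finset (Fin n) → ℝ} (hu : LearningPreferring u) :
    P.IsNash A Set.univ P.exists_mem_univ u := by
  intro j hj ρ
  rw [P.expUtility_outcome h, outcomeDev_eq_map]
  exact expUtility_map_le _ _ ∅ hj hu le_rfl
    (fun x _ => learnersDev_eq fun i hi hij => hdev x.1 x.2 j hj _ i hi hij) (by simp)

end Protocol

/-! ### Protocols without communication -/

section Silent

variable {n : ℕ} {S : Type}

/-- The strategy of a player who sends nothing and outputs the value `x` at once. -/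
def Strategy.announce (x : S) : Strategy n S where
  send _ _ := []
  out _ := some x

theorem bitsSent_announce (A : Finset (Fin n)) (x : Fin n → S) (i : Fin n) :
    bitsSent A (fun i => Strategy.announce (x i)) i = 0 := by
  simp [bitsSent, sent, Strategy.announce]

theorem latency_announce (A : Finset (Fin n)) (x : Fin n → S) :
    latency A (fun i => Strategy.announce (x i)) = 0 := by
  refine le_antisymm ?_ zero_le
  have := latency_le (A := A) (σ := fun i => Strategy.announce (x i)) (r := 0)
    fun i _ => ⟨0, le_rfl, rfl⟩
  simpa using this

theorem learns_announce {x s : S} {v : ℕ → List (Inbox n)} :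
    Learns (Strategy.announce x) v s ↔ x = s := by
  constructor
  · rintro ⟨r, h, _⟩
    simpa [Strategy.announce] using h
  · rintro rfl
    exact ⟨0, rfl, by simp⟩

/-- A player facing silent opponents only ever receives empty messages. -/
theorem viewsDev_announce (A : Finset (Fin n)) (x : Fin n → S) (j : Fin n) (ρ : Strategy n S)
    (r : ℕ) : viewsDev A (fun i => Strategy.announce (x i)) j ρ r j
      = List.replicate r fun _ => [] := by
  induction r with
  | zero => rfl
  | succ r ih =>
    rw [viewsDev_succ, ih, List.replicate_succ']
    congr 2
    funext k
    unfold deliver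
    split_ifs with h
    · rfl
    · rw [sentDev, Function.update_of_ne h]
      simp [sent, Strategy.announce]

/-- Every player is given the secret, and outputs it. -/
noncomputable def plainProtocol (n : ℕ) (S : Type) : Protocol n S where
  Coins := Unit
  coins := PMF.pure ()
  Share := S
  deal s _ _ := s
  player _ _ x := Strategy.announce x

theorem plainProtocol_handles [Fintype S] [Nonempty S] (A : Finset (Fin n)) (U C thr : ℝ) :
    (plainProtocol n S).Handles A U C thr := by
  have hall : (plainProtocol n S).AllLearn A Set.univ := fun s ω _ _ =>
    learners_eq fun i _ => learns_announce.2 rfl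
  refine ⟨fun _ u hu _ => (plainProtocol n S).isNash_of_learns hall
    (fun s ω j _ ρ i _ _ => learns_announce.2 rfl) hu, fun _ => hall, fun s i _ => ?_,
    fun s => ?_⟩
  · exact Protocol.expBits_le _ fun ω => (bitsSent_announce A _ i).le.trans zero_le
  · exact Protocol.expLatency_le _ fun ω => (latency_announce A _).le.trans zero_le

theorem plainProtocol_hiddenFrom_empty : (plainProtocol n S).HiddenFrom ∅ := by
  rw [Protocol.hiddenFrom_iff]
  intro s s'
  congr 1
  funext ω i
  exact absurd i.2 (Finset.notMem_empty _)

/-- Every player is given an independent uniformly distributed guess of the secret, and outputs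
it. -/
noncomputable def guessProtocol (n : ℕ) (S : Type) [Fintype S] [AddCommGroup S] :
    Protocol n S where
  Coins := Fin n → S
  coins := PMF.uniformOfFintype _
  Share := S
  deal s h i := s + h i
  player _ _ x := Strategy.announce x

variable [Fintype S] [AddCommGroup S]

theorem guessProtocol_hiddenFrom (A : Finset (Fin n)) : (guessProtocol n S).HiddenFrom A := by
  refine Protocol.hiddenFrom_of_equiv _ fun s s' =>
    ⟨(Equiv.addRight fun _ => s - s' : (Fin n → S) ≃ (Fin n → S)), fun h => ?_,
      fun h i _ => ?_⟩
  · exact (PMF.uniformOfFintype_apply (α := Fin n → S) _).trans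
      (PMF.uniformOfFintype_apply (α := Fin n → S) _).symm
  · change s' + (h i + (s - s')) = s + h i
    abel

/-- Summed over all secrets and all guesses, a player whose output is a function of its own guess
(the relation `L g s` says that the guess `g` makes it output `s`) is right once for every choice of
the guesses, at most. -/
theorem sum_guess [DecidableEq S] (j : Fin n) (L : S → S → Prop) [∀ g s, Decidable (L g s)]
    (Δ : (Fin n → S) → ℝ) (hΔ : ∀ h x, Δ (Function.update h j x) = Δ h) :
    ∑ x : S × (Fin n → S), (if L (x.1 + x.2 j) x.1 then Δ x.2 else 0)
      = ∑ h : Fin n → S, ((Finset.univ.filter fun s => L (h j) s).card : ℝ) * Δ h := by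
  classical
  rw [Fintype.sum_prod_type]
  have h1 : ∀ s : S, ∑ h : Fin n → S, (if L (s + h j) s then Δ h else 0)
      = ∑ h : Fin n → S, if L (h j) s then Δ h else 0 := by
    intro s
    rw [← Equiv.sum_comp (Equiv.addLeft (Pi.single j (-s) : Fin n → S))]
    refine Finset.sum_congr rfl fun h _ => ?_
    have e1 : (Equiv.addLeft (Pi.single j (-s) : Fin n → S)) h
        = Function.update h j (-s + h j) := by
      funext i
      by_cases hi : i = j
      · subst hi; simp
      · simp [hi]
    rw [e1, hΔ]
    simp
  simp_rw [h1]
  rw [Finset.sum_comm]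
  refine Finset.sum_congr rfl fun h _ => ?_
  rw [← Finset.sum_filter, Finset.sum_const, nsmul_eq_mul]

theorem guessProtocol_isNash (A : Finset (Fin n)) {u : Fin n → Finset (Fin n) → ℝ}
    (hu : LearningPreferring u) :
    (guessProtocol n S).IsNash A Set.univ (guessProtocol n S).exists_mem_univ u := by
  classical
  intro j hj ρ₀
  rw [Protocol.outcome_eq_map, Protocol.outcomeDev_eq_map]
  let ρ : S → Strategy n S := ρ₀
  set p : PMF (S × (Fin n → S)) :=
    prodLaw (PMF.uniformOfFintype S) (PMF.uniformOfFintype (Fin n → S)) with hp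
  change Protocol.expUtility (p.map fun x : S × (Fin n → S) =>
      learnersDev A (fun i => Strategy.announce (x.1 + x.2 i)) j (ρ (x.1 + x.2 j)) x.1) _ ≤
    Protocol.expUtility (p.map fun x : S × (Fin n → S) =>
      learners A (fun i => Strategy.announce (x.1 + x.2 i)) x.1) _
  rw [expUtility_map_fintype, expUtility_map_fintype]
  set c : ℝ := ((PMF.uniformOfFintype S) 0 * (PMF.uniformOfFintype (Fin n → S)) 0).toReal with hc
  have hconst : ∀ x : S × (Fin n → S),
      (p x).toReal = c := by
    rintro ⟨s, h⟩
    rw [hp, prodLaw_apply, hc]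
    simp
  simp_rw [hconst]
  rw [← Finset.mul_sum, ← Finset.mul_sum]
  refine mul_le_mul_of_nonneg_left ?_ ENNReal.toReal_nonneg
  -- `Z h` is the set of the other players who learn the secret; it does not depend on `h j`.
  set Z : (Fin n → S) → Finset (Fin n) := fun h => (A.erase j).filter fun i => h i = 0 with hZ
  set v₀ : ℕ → List (Inbox n) := fun r => List.replicate r fun _ => [] with hv₀
  have hdev : ∀ x : S × (Fin n → S),
      learnersDev A (fun i => Strategy.announce (x.1 + x.2 i)) j (ρ (x.1 + x.2 j)) x.1
        = if Learns (ρ (x.1 + x.2 j)) v₀ x.1 then insert j (Z x.2) else Z x.2 := by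
    intro x
    ext i
    rw [mem_learnersDev]
    by_cases hij : i = j
    · subst hij
      simp only [Function.update_self, viewsDev_announce, hj, true_and]
      by_cases hL : Learns (ρ (x.1 + x.2 i)) v₀ x.1
      · simp [hL, hv₀.symm]
      · rw [if_neg hL]
        simp [hL, hv₀.symm, hZ]
    · rw [Function.update_of_ne hij, learns_announce, add_eq_left]
      split_ifs <;> simp [hZ, hij]
  have hhon : ∀ x : S × (Fin n → S),
      learners A (fun i => Strategy.announce (x.1 + x.2 i)) x.1
        = if x.1 + x.2 j = x.1 then insert j (Z x.2) else Z x.2 := by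
    intro x
    ext i
    rw [mem_learners, learns_announce, add_eq_left, add_eq_left]
    by_cases hij : i = j
    · subst hij
      split_ifs with h <;> simp [hZ, hj, h]
    · split_ifs <;> simp [hZ, hij]
  simp_rw [hdev, hhon]
  set Δ : (Fin n → S) → ℝ := fun h => u j (insert j (Z h)) - u j (Z h) with hΔdef
  have hΔ0 : ∀ h, 0 ≤ Δ h := fun h =>
    sub_nonneg.2 (hu j _ _ (Finset.mem_insert_self _ _) (by simp [hZ])).le
  have hΔ : ∀ h x, Δ (Function.update h j x) = Δ h := by
    intro h x
    have : Z (Function.update h j x) = Z h := by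
      refine Finset.filter_congr fun i hi => ?_
      rw [Function.update_of_ne (Finset.ne_of_mem_erase hi)]
    simp only [hΔdef, this]
  have hsplit : ∀ (b : Prop) [Decidable b] (h : Fin n → S),
      u j (if b then insert j (Z h) else Z h) = u j (Z h) + if b then Δ h else 0 := by
    intro b _ h
    split_ifs <;> simp [hΔdef]
  simp_rw [hsplit, Finset.sum_add_distrib]
  have h1 := sum_guess j (fun g s => Learns (ρ g) v₀ s) Δ hΔ
  have h2 := sum_guess j (fun g s => g = s) Δ hΔ
  rw [h1, h2]
  refine add_le_add le_rfl (Finset.sum_le_sum fun h _ => ?_)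
  refine mul_le_mul_of_nonneg_right ?_ (hΔ0 h)
  have hone : (Finset.univ.filter fun s => h j = s).card = 1 := by
    rw [Finset.filter_eq]; simp
  rw [hone]
  refine Nat.cast_le.2 (Finset.card_le_one.2 fun s hs s' hs' => ?_)
  exact Learns.unique (Finset.mem_filter.1 hs).2 (Finset.mem_filter.1 hs').2

theorem guessProtocol_handles {A : Finset (Fin n)} {U C thr : ℝ}
    (hA : (A.card : ℝ) / n < thr) : (guessProtocol n S).Handles A U C thr where
  nash _ _ hu _ := guessProtocol_isNash A hu
  learn h := absurd hA (not_lt.2 h)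
  bits _ i _ := Protocol.expBits_le _ fun _ => (bitsSent_announce A _ i).le.trans zero_le
  latency _ := Protocol.expLatency_le _ fun _ => (latency_announce A _).le.trans zero_le

end Silent

/-! ### Bit strings as messages -/

section Encoding

/-- An injective encoding of the elements of a finite type by non-empty bit strings: the binary
expansion of the (positive) number of the element. -/
noncomputable def encode {X : Type} [Fintype X] (x : X) : List Bool :=
  Nat.bits (Fintype.equivFin X x + 1)

variable {X : Type} [Fintype X]

theorem encode_injective : Function.Injective (encode : X → List Bool) := by
  intro x y h
  have h1 : (Fintype.equivFin X x : ℕ) + 1 = Fintype.equivFin X y + 1 := by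
    apply Nat.digits.injective 2
    rw [Nat.digits_two_eq_bits, Nat.digits_two_eq_bits]
    exact congrArg _ h
  have h2 : (Fintype.equivFin X x : ℕ) = Fintype.equivFin X y := by omega
  exact (Fintype.equivFin X).injective (Fin.ext h2)

theorem length_encode_le (x : X) : (encode x).length ≤ Nat.log 2 (Fintype.card X) + 1 := by
  unfold encode
  rw [Nat.size_eq_bits_len, Nat.size_le]
  exact lt_of_le_of_lt (Fintype.equivFin X x).2 (Nat.lt_pow_succ_log_self (by norm_num) _)

theorem encode_ne_nil (x : X) : encode x ≠ [] := by
  intro h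
  have h1 := congrArg List.length h
  unfold encode at h1
  rw [Nat.size_eq_bits_len] at h1
  have := Nat.size_eq_zero.1 (by simpa using h1)
  omega

/-- A left inverse of `encode`. -/
noncomputable def decode (X : Type) [Fintype X] [Nonempty X] : List Bool → X :=
  Function.invFun encode

@[simp] theorem decode_encode [Nonempty X] (x : X) : decode X (encode x) = x :=
  Function.leftInverse_invFun encode_injective x

end Encoding

/-! ### A deterministic protocol that tolerates one liar -/

section Consensus

variable {n : ℕ} {S : Type}

open Classical in
/-- The value claimed by all members of `H`, with at most one exception. -/
noncomputable def consensus [Zero S] (H : Finset (Fin n)) (f : Fin n → S) : S :=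
  if h : ∃ v, (H.filter fun k => f k ≠ v).card ≤ 1 then h.choose else 0

theorem consensus_eq [Zero S] {H : Finset (Fin n)} {f : Fin n → S} (hH : 3 ≤ H.card) (j : Fin n)
    (v : S) (hv : ∀ k ∈ H, k ≠ j → f k = v) : consensus H f = v := by
  classical
  have hex : ∃ v, (H.filter fun k => f k ≠ v).card ≤ 1 := by
    refine ⟨v, (Finset.card_le_card (t := {j}) fun k hk => ?_).trans (by simp)⟩
    rw [Finset.mem_filter] at hk
    by_contra hne
    exact hk.2 (hv k hk.1 (by simpa using hne))
  unfold consensus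
  rw [dif_pos hex]
  by_contra hne
  have h1 := hex.choose_spec
  have h2 : H.erase j ⊆ H.filter fun k => f k ≠ hex.choose := by
    intro k hk
    rw [Finset.mem_erase] at hk
    rw [Finset.mem_filter]
    refine ⟨hk.2, ?_⟩
    rw [hv k hk.2 hk.1]
    exact fun h => hne h.symm
  have h3 := Finset.card_le_card h2
  have h4 := Finset.pred_card_le_card_erase (s := H) (a := j)
  omega

end Consensus

/-- The blocks of a set `A` of players: the player `i` has position `col i` in the block `blk i`.
The blocks are the elements of a cyclic group whose order is a power of `2`. -/
structure Blocks {n : ℕ} (A : Finset (Fin n)) (L K : ℕ) where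
  blk : Fin n → ZMod (2 ^ L)
  col : Fin n → Fin K
  inj : ∀ i ∈ A, ∀ k ∈ A, blk i = blk k → col i = col k → i = k
  three_le : ∀ b, 3 ≤ (A.filter fun i => blk i = b).card

namespace Blocks

theorem two_pow_ne_zero {L t : ℕ} (ht : t < L) : (2 : ZMod (2 ^ L)) ^ t ≠ 0 := by
  have h : ((2 ^ t : ℕ) : ZMod (2 ^ L)) ≠ 0 := by
    rw [Ne, ZMod.natCast_eq_zero_iff]
    exact fun h => absurd (Nat.le_of_dvd (by positivity) h)
      (not_le.2 (Nat.pow_lt_pow_right (by norm_num) ht))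
  simpa using h

variable {n : ℕ} {A : Finset (Fin n)} {L K : ℕ} (β : Blocks A L K) {S : Type}

/-- The members of the block `b`. -/
def members (b : ZMod (2 ^ L)) : Finset (Fin n) :=
  A.filter fun i => β.blk i = b

/-- The members of the block `b` with a position in `c`. -/
def holders (b : ZMod (2 ^ L)) (c : Finset (Fin K)) : Finset (Fin n) :=
  A.filter fun i => β.blk i = b ∧ β.col i ∈ c

theorem card_members_le (b : ZMod (2 ^ L)) : (β.members b).card ≤ K := by
  have h : Set.InjOn β.col (β.members b) := by
    intro i hi k hk h
    simp only [members, Finset.coe_filter, Set.mem_ofPred_eq] at hi hk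
    exact β.inj i hi.1 k hk.1 (hi.2.trans hk.2.symm) h
  simpa using Finset.card_le_card_of_injOn β.col (fun i _ => Finset.mem_univ _) h

/-- The sets of positions that belong to at least three players of the block `b`. -/
def effective (b : ZMod (2 ^ L)) : Finset (Finset (Fin K)) :=
  Finset.univ.filter fun c => 3 ≤ (β.holders b c).card

variable [AddCommGroup S]

/-- The sum of the pieces of the block `b`; the piece `x b c` is known to the holders of `c`. -/
def blockSum (x : ZMod (2 ^ L) → Finset (Fin K) → S) (b : ZMod (2 ^ L)) : S :=
  ∑ c ∈ β.effective b, x b c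

/-- The sum of the pieces of the `2 ^ t` blocks that start with `b`. -/
def partialSum (x : ZMod (2 ^ L) → Finset (Fin K) → S) (t : ℕ) (b : ZMod (2 ^ L)) : S :=
  ∑ c ∈ Finset.range (2 ^ t), β.blockSum x (b + c)

theorem partialSum_succ (x : ZMod (2 ^ L) → Finset (Fin K) → S) (t : ℕ) (b : ZMod (2 ^ L)) :
    β.partialSum x (t + 1) b = β.partialSum x t b + β.partialSum x t (b + 2 ^ t) := by
  unfold partialSum
  rw [pow_succ, mul_two, Finset.sum_range_add]
  congr 1
  refine Finset.sum_congr rfl fun c _ => ?_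
  push_cast
  rw [add_assoc]

theorem partialSum_last (x : ZMod (2 ^ L) → Finset (Fin K) → S) (b : ZMod (2 ^ L)) :
    β.partialSum x L b = ∑ z, β.blockSum x z := by
  unfold partialSum
  refine Finset.sum_bij (fun c _ => b + (c : ZMod (2 ^ L))) (fun _ _ => Finset.mem_univ _) ?_ ?_
    (fun _ _ => rfl)
  · intro c hc c' hc' h
    have h1 := add_left_cancel h
    rw [ZMod.natCast_eq_natCast_iff'] at h1
    rwa [Nat.mod_eq_of_lt (Finset.mem_range.1 hc), Nat.mod_eq_of_lt (Finset.mem_range.1 hc')] at h1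
  · intro z _
    exact ⟨(z - b).val, Finset.mem_range.2 (ZMod.val_lt _), by simp⟩

variable [Fintype S]

open Classical in
/-- The estimate, by a player of the block `b` with position `p` and pieces `z`, of the partial sum
for its block, after the messages `h`. -/
noncomputable def estimate (b : ZMod (2 ^ L)) (p : Fin K) (z : Finset (Fin K) → S)
    (h : List (Inbox n)) : S :=
  ∑ c ∈ β.effective b, (if p ∈ c then z c else
    consensus (β.holders b c) fun k =>
      decode (Finset (Fin K) → S) (h.getD 0 (fun _ => []) k) c) +
  ∑ t ∈ Finset.range (h.length - 1), consensus (β.members (b + 2 ^ t)) fun k =>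
    decode (Finset (Fin K) → S) (h.getD (t + 1) (fun _ => []) k) ∅

open Classical in
/-- The messages of player `i`: its pieces, sent to its own block, and later its estimates of the
partial sums, sent to the block `2 ^ t` places back. -/
noncomputable def message (i : Fin n) (z : Finset (Fin K) → S) (h : List (Inbox n)) (k : Fin n) :
    List Bool :=
  if k ∈ A then
    if h.length = 0 then
      if β.blk k = β.blk i then encode z else []
    else if h.length ≤ L ∧ β.blk i = β.blk k + 2 ^ (h.length - 1) then
      encode fun _ : Finset (Fin K) => β.estimate (β.blk i) (β.col i) z h
    else []
  else []

open Classical in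
/-- The secret is the sum of a publicly known element and of the pieces of all blocks. -/
noncomputable def protocol (S : Type) [AddCommGroup S] [Fintype S] : Protocol n S where
  Coins := ZMod (2 ^ L) → Finset (Fin K) → S
  coins := PMF.uniformOfFintype _
  Share := S × (Finset (Fin K) → S)
  deal s x i := (s - ∑ b, β.blockSum x b,
    fun c => if i ∈ A ∧ β.col i ∈ c then x (β.blk i) c else 0)
  player _ i y :=
    { send := β.message i y.2
      out := fun h =>
        if h.length = L + 1 then some (y.1 + β.estimate (β.blk i) (β.col i) y.2 h) else none }

/-- As long as all players other than `j` send what they should, all players other than `j` compute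
the correct partial sums, whatever `j` sends: every value is sent by at least three players. -/
theorem estimate_eq (x : ZMod (2 ^ L) → Finset (Fin K) → S) (s : S) (j : Fin n)
    (h : ℕ → Fin n → List (Inbox n)) (o : ℕ → Fin n → Fin n → List Bool)
    (h0 : ∀ i, h 0 i = []) (hs : ∀ r i, h (r + 1) i = h r i ++ [deliver (o r) i])
    (ho : ∀ r, ∀ i ∈ A, i ≠ j →
      o r i = (((β.protocol S).strat A s x) i).send (h r i))
    {t : ℕ} (ht : t ≤ L) {i : Fin n} (hi : i ∈ A) (hij : i ≠ j) :
    β.estimate (β.blk i) (β.col i)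
      (fun c => if i ∈ A ∧ β.col i ∈ c then x (β.blk i) c else 0) (h (t + 1) i)
      = β.partialSum x t (β.blk i) := by
  classical
  have hlen := run_length h0 hs
  have hsend : ∀ r, ∀ k ∈ A, k ≠ j → o r k = β.message k
      (fun c => if k ∈ A ∧ β.col k ∈ c then x (β.blk k) c else 0) (h r k) := by
    intro r k hk hkj
    rw [ho r k hk hkj]
    simp only [Protocol.strat, protocol]
  induction t generalizing i with
  | zero =>
    unfold estimate
    rw [hlen]
    simp only [zero_add, Nat.sub_self, Finset.range_zero, Finset.sum_empty, add_zero, partialSum,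
      pow_zero, Finset.sum_range_one, Nat.cast_zero, blockSum]
    refine Finset.sum_congr rfl fun c hc => ?_
    by_cases hp : β.col i ∈ c
    · simp [hp, hi]
    · rw [if_neg hp]
      refine consensus_eq (by simpa [effective] using hc) j _ fun k hk hkj => ?_
      obtain ⟨hkA, hkb, hkc⟩ := Finset.mem_filter.1 hk
      have hki : k ≠ i := fun e => hp (e ▸ hkc)
      have h1 : (h 1 i).getD 0 (fun _ => []) k = o 0 k i := by
        rw [show (1 : ℕ) = 0 + 1 from rfl, hs, h0]
        simp [deliver, hki]
      rw [h1, hsend 0 k hkA hkj, message, if_pos hi, if_pos (hlen 0 k), if_pos hkb.symm,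
        decode_encode, if_pos ⟨hkA, hkc⟩, hkb]
  | succ t ih =>
    have hstep : ∀ z, β.estimate (β.blk i) (β.col i) z (h (t + 1 + 1) i)
        = β.estimate (β.blk i) (β.col i) z (h (t + 1) i) +
          consensus (β.members (β.blk i + 2 ^ t)) fun k =>
            decode (Finset (Fin K) → S) (deliver (o (t + 1)) i k) ∅ := by
      intro z
      unfold estimate
      rw [hlen, hlen, hs (t + 1) i]
      simp only [Nat.add_sub_cancel]
      rw [Finset.sum_range_succ, add_assoc]
      have hl := hlen (t + 1) i
      congr 1
      · refine Finset.sum_congr rfl fun c _ => ?_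
        rw [List.getD_append _ _ _ _ (by omega)]
      · congr 1
        · refine Finset.sum_congr rfl fun r hr => ?_
          rw [List.getD_append _ _ _ _ (by have := Finset.mem_range.1 hr; omega)]
        · rw [List.getD_append_right _ _ _ _ hl.le, hl]
          simp
    rw [hstep, ih (by omega) hi hij, partialSum_succ]
    congr 1
    refine consensus_eq (β.three_le _) j _ fun k hk hkj => ?_
    obtain ⟨hkA, hkb⟩ := Finset.mem_filter.1 hk
    have hki : k ≠ i := by
      rintro rfl
      exact two_pow_ne_zero (L := L) ht (by simpa using hkb)
    have h1 : deliver (o (t + 1)) i k = o (t + 1) k i := by simp [deliver, hki]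
    rw [h1, hsend (t + 1) k hkA hkj, message, if_pos hi, if_neg (by rw [hlen]; omega), hlen,
      Nat.add_sub_cancel, if_pos ⟨ht, hkb⟩, decode_encode, ih (by omega) hkA hkj, hkb]

/-- Whatever `j` sends, the other players learn the secret. -/
theorem learns (x : ZMod (2 ^ L) → Finset (Fin K) → S) (s : S) (j : Fin n)
    (h : ℕ → Fin n → List (Inbox n)) (o : ℕ → Fin n → Fin n → List Bool)
    (h0 : ∀ i, h 0 i = []) (hs : ∀ r i, h (r + 1) i = h r i ++ [deliver (o r) i])
    (ho : ∀ r, ∀ i ∈ A, i ≠ j →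
      o r i = (((β.protocol S).strat A s x) i).send (h r i))
    {i : Fin n} (hi : i ∈ A) (hij : i ≠ j) :
    Learns ((β.protocol S).strat A s x i) (fun r => h r i) s := by
  have hlen := run_length h0 hs
  refine ⟨L + 1, ?_, fun r hr => ?_⟩
  · have h1 := β.estimate_eq x s j h o h0 hs ho le_rfl hi hij
    rw [partialSum_last] at h1
    simp only [Protocol.strat, protocol, hlen, if_true]
    rw [Option.some.injEq]
    refine Eq.trans ?_ (sub_add_cancel s (∑ b, β.blockSum x b))
    rw [← h1]
  · simp only [Protocol.strat, protocol, hlen, if_neg hr.ne]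

theorem allLearn (hA : 2 ≤ A.card) : (β.protocol S).AllLearn A Set.univ := by
  intro s x _ _
  refine learners_eq fun i hi => ?_
  obtain ⟨j, hj, hji⟩ := Finset.exists_mem_ne (by omega : 1 < A.card) i
  refine β.learns x s j _ (fun r => sent A _ (views A _ r)) (fun _ => rfl) (fun _ _ => rfl)
    (fun r k hk _ => ?_) hi hji.symm
  simp [sent, hk]

theorem isNash (hA : 2 ≤ A.card) {u : Fin n → Finset (Fin n) → ℝ} (hu : LearningPreferring u)
    [Nonempty S] :
    (β.protocol S).IsNash A Set.univ (β.protocol S).exists_mem_univ u := by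
  refine Protocol.isNash_of_learns _ (β.allLearn hA) (fun s x j _ ρ i hi hij => ?_) hu
  refine β.learns x s j _ (fun r => sentDev A _ j ρ (viewsDev A _ j ρ r)) (fun _ => rfl)
    (fun _ _ => rfl) (fun r k hk hkj => ?_) hi hij
  rw [sentDev, Function.update_of_ne hkj]
  simp [sent, hk]

theorem bitsSent_le (x : ZMod (2 ^ L) → Finset (Fin K) → S) (s : S) {i : Fin n} (hi : i ∈ A) :
    bitsSent A ((β.protocol S).strat A s x) i ≤
      (((L + 1) * (K * (Nat.log 2 (Fintype.card (Finset (Fin K) → S)) + 1)) : ℕ) : ℝ≥0∞) := by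
  classical
  set M := Nat.log 2 (Fintype.card (Finset (Fin K) → S)) + 1 with hM
  set σ := (β.protocol S).strat A s x with hσ
  set z : Finset (Fin K) → S := fun c => if i ∈ A ∧ β.col i ∈ c then x (β.blk i) c else 0 with hz
  have hmsg : ∀ r k, sent A σ (views A σ r) i k = β.message i z (views A σ r i) k := by
    intro r k
    simp only [sent, hi, if_true, hσ, Protocol.strat, protocol]
    congr 1
    funext c
    simp [hz, hi]
  -- In each step, the messages go to the members of a single block.
  have hstep : ∀ r, ∃ b, ∀ k, (sent A σ (views A σ r) i k).length
      ≤ if k ∈ β.members b then M else 0 := by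
    intro r
    rcases Nat.eq_zero_or_pos r with hr | hr
    · refine ⟨β.blk i, fun k => ?_⟩
      rw [hmsg, message, length_views]
      simp only [members, Finset.mem_filter]
      by_cases hk : k ∈ A
      · by_cases hb : β.blk k = β.blk i
        · simp only [hk, hr, hb, if_true, and_self]
          exact length_encode_le _
        · simp [hk, hr, hb]
      · simp [hk]
    · refine ⟨β.blk i - 2 ^ (r - 1), fun k => ?_⟩
      rw [hmsg, message, length_views, if_neg hr.ne']
      simp only [members, Finset.mem_filter]
      by_cases hk : k ∈ A
      · by_cases hb : r ≤ L ∧ β.blk i = β.blk k + 2 ^ (r - 1)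
        · have hb' : β.blk k = β.blk i - 2 ^ (r - 1) := by rw [hb.2]; ring
          rw [if_pos hk, if_pos hb, if_pos ⟨hk, hb'⟩]
          exact length_encode_le _
        · rw [if_pos hk, if_neg hb]; simp
      · simp [hk]
  have hsum : ∀ r, ∑ k, ((sent A σ (views A σ r) i k).length : ℝ≥0∞) ≤ ((K * M : ℕ) : ℝ≥0∞) := by
    intro r
    obtain ⟨b, hb⟩ := hstep r
    rw [← Nat.cast_sum]
    refine Nat.cast_le.2 ((Finset.sum_le_sum fun k _ => hb k).trans ?_)
    rw [← Finset.sum_filter, Finset.sum_const, smul_eq_mul]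
    refine Nat.mul_le_mul_right _ ?_
    rw [Finset.filter_mem_eq_inter, Finset.univ_inter]
    exact β.card_members_le b
  have hlate : ∀ r, r ∉ Finset.range (L + 1) →
      ∑ k, ((sent A σ (views A σ r) i k).length : ℝ≥0∞) = 0 := by
    intro r hr
    rw [Finset.mem_range, not_lt] at hr
    refine Finset.sum_eq_zero fun k _ => ?_
    rw [hmsg, message, length_views, if_neg (by omega : r ≠ 0),
      if_neg (c := r ≤ L ∧ _) fun h => by have := h.1; omega]
    simp
  unfold bitsSent
  rw [tsum_eq_sum hlate]
  calc _ ≤ ∑ _r ∈ Finset.range (L + 1), ((K * M : ℕ) : ℝ≥0∞) := Finset.sum_le_sum fun r _ => hsum r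
    _ = _ := by rw [Finset.sum_const, Finset.card_range, nsmul_eq_mul]; push_cast; ring

theorem latency_protocol_le (x : ZMod (2 ^ L) → Finset (Fin K) → S) (s : S) :
    latency A ((β.protocol S).strat A s x) ≤ ((L + 1 : ℕ) : ℝ≥0∞) := by
  refine latency_le fun i _ => ⟨L + 1, le_rfl, ?_⟩
  simp [Protocol.strat, protocol, length_views]

theorem protocol_handles [Nonempty S] (hA : 2 ≤ A.card) {U C thr : ℝ}
    (hbits : (((L + 1) * (K * (Nat.log 2 (Fintype.card (Finset (Fin K) → S)) + 1)) : ℕ) : ℝ)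
      ≤ C * Real.log n ^ 2)
    (hlat : ((L + 1 : ℕ) : ℝ) ≤ C * Real.log n) : (β.protocol S).Handles A U C thr where
  nash _ _ hu _ := β.isNash hA hu
  learn _ := β.allLearn hA
  bits s i hi := Protocol.expBits_le _ fun x => (β.bitsSent_le x s hi).trans (by
    rw [← ENNReal.ofReal_natCast]; exact ENNReal.ofReal_le_ofReal hbits)
  latency s := Protocol.expLatency_le _ fun x => (β.latency_protocol_le x s).trans (by
    rw [← ENNReal.ofReal_natCast]; exact ENNReal.ofReal_le_ofReal hlat)

/-- Players who miss more than two members of `A` per block, on average, know nothing about the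
secret: three absent members of the same block are the only holders of some piece. -/
theorem protocol_hiddenFrom {B : Finset (Fin n)} (hB : 2 * 2 ^ L < (A \ B).card) :
    (β.protocol S).HiddenFrom B := by
  classical
  obtain ⟨b, _, hb⟩ := Finset.exists_lt_card_fiber_of_mul_lt_card_of_maps_to
    (s := A \ B) (t := (Finset.univ : Finset (ZMod (2 ^ L)))) (f := β.blk) (n := 2)
    (fun _ _ => Finset.mem_univ _) (by rw [Finset.card_univ, ZMod.card]; omega)
  set M := (A \ B).filter fun i => β.blk i = b with hM
  set c := M.image β.col with hc
  have hhold : β.holders b c = M := by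
    ext i
    simp only [holders, Finset.mem_filter, hM, hc, Finset.mem_image, Finset.mem_sdiff]
    constructor
    · rintro ⟨hi, hib, k, ⟨⟨hk, hkB⟩, hkb⟩, hik⟩
      have := β.inj k hk i hi (hkb.trans hib.symm) hik
      subst this
      exact ⟨⟨hk, hkB⟩, hkb⟩
    · rintro ⟨⟨hi, hiB⟩, hib⟩
      exact ⟨hi, hib, i, ⟨⟨hi, hiB⟩, hib⟩, rfl⟩
  have heff : c ∈ β.effective b := by
    simp only [effective, Finset.mem_filter, Finset.mem_univ, true_and, hhold]
    exact hb
  refine Protocol.hiddenFrom_of_equiv _ fun s s' =>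
    ⟨(Equiv.addRight (Pi.single b (Pi.single c (s' - s))) :
      (ZMod (2 ^ L) → Finset (Fin K) → S) ≃ (ZMod (2 ^ L) → Finset (Fin K) → S)),
      fun x => ?_, fun (x : ZMod (2 ^ L) → Finset (Fin K) → S) i hi => ?_⟩
  · exact (PMF.uniformOfFintype_apply (α := ZMod (2 ^ L) → Finset (Fin K) → S) _).trans
      (PMF.uniformOfFintype_apply (α := ZMod (2 ^ L) → Finset (Fin K) → S) _).symm
  · have hsum : ∑ z, β.blockSum (x + Pi.single b (Pi.single c (s' - s))) z
        = ∑ z, β.blockSum x z + (s' - s) := by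
      have h1 : ∀ z, β.blockSum (x + Pi.single b (Pi.single c (s' - s))) z
          = β.blockSum x z + if z = b then s' - s else 0 := by
        intro z
        simp only [blockSum, Pi.add_apply, Finset.sum_add_distrib]
        congr 1
        by_cases hz : z = b
        · subst hz
          simp [Pi.single_apply, heff]
        · simp [hz]
      simp [h1, Finset.sum_add_distrib]
    refine Prod.ext ?_ ?_
    · change s' - ∑ z, β.blockSum (x + Pi.single b (Pi.single c (s' - s))) z
        = s - ∑ z, β.blockSum x z
      rw [hsum]
      abel
    · funext c'
      change (if i ∈ A ∧ β.col i ∈ c' then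
          (x + (Pi.single b (Pi.single c (s' - s)) : ZMod (2 ^ L) → Finset (Fin K) → S))
            (β.blk i) c' else 0)
        = if i ∈ A ∧ β.col i ∈ c' then x (β.blk i) c' else 0
      split_ifs with h
      · by_cases hbc : β.blk i = b ∧ c' = c
        · -- such a player would be a holder of the piece, hence absent
          exfalso
          have : i ∈ β.holders b c := Finset.mem_filter.2 ⟨h.1, hbc.1, hbc.2 ▸ h.2⟩
          rw [hhold] at this
          exact (Finset.mem_sdiff.1 (Finset.mem_filter.1 this).1).2 hi
        · by_cases h1 : β.blk i = b
          · have h2 : c' ≠ c := fun e => hbc ⟨h1, e⟩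
            simp [h1, h2]
          · simp [h1]
      · rfl

end Blocks

/-- A set of at least `3 * 2 ^ L` and at most `K * 2 ^ L` players can be divided into blocks. -/
theorem Blocks.exists_of_card {n : ℕ} {A : Finset (Fin n)} {L K : ℕ} (h₁ : 3 * 2 ^ L ≤ A.card)
    (h₂ : A.card ≤ K * 2 ^ L) : Nonempty (Blocks A L K) := by
  classical
  have hQ : 0 < 2 ^ L := by positivity
  have hK : 0 < K := by
    by_contra h
    have : K = 0 := by omega
    subst this
    omega
  let idx : Fin n → ℕ := fun i => if h : i ∈ A then A.equivFin ⟨i, h⟩ else 0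
  have hidx : ∀ i (h : i ∈ A), idx i = A.equivFin ⟨i, h⟩ := fun i h => dif_pos h
  have hlt : ∀ i ∈ A, idx i < A.card := fun i h => by rw [hidx i h]; exact (A.equivFin ⟨i, h⟩).2
  have hdiv : ∀ i ∈ A, idx i / 2 ^ L < K := fun i h =>
    (Nat.div_lt_iff_lt_mul hQ).2 ((hlt i h).trans_le h₂)
  refine ⟨⟨fun i => (idx i : ZMod (2 ^ L)), fun i => ⟨idx i / 2 ^ L % K, Nat.mod_lt _ hK⟩,
    ?_, ?_⟩⟩
  · intro i hi k hk hb hc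
    rw [ZMod.natCast_eq_natCast_iff'] at hb
    have hc' : idx i / 2 ^ L = idx k / 2 ^ L := by
      have := congrArg Fin.val hc
      simpa [Nat.mod_eq_of_lt (hdiv i hi), Nat.mod_eq_of_lt (hdiv k hk)] using this
    have he : idx i = idx k := by
      rw [← Nat.div_add_mod (idx i) (2 ^ L), hb, hc', Nat.div_add_mod]
    rw [hidx i hi, hidx k hk] at he
    have := A.equivFin.injective (Fin.ext he)
    exact congrArg Subtype.val this
  · intro b
    have hv : b.val < 2 ^ L := ZMod.val_lt b
    -- the players with the numbers `b`, `b + 2 ^ L` and `b + 2 * 2 ^ L`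
    let f : Fin 3 → Fin n := fun r =>
      A.equivFin.symm ⟨b.val + r * 2 ^ L, by have := r.2; nlinarith⟩
    have hf : ∀ r, f r ∈ A := fun r => (A.equivFin.symm _).2
    have hfi : ∀ r, idx (f r) = b.val + r * 2 ^ L := by
      intro r
      rw [hidx _ (hf r)]
      simp [f]
    have hinj : Function.Injective f := by
      intro r r' h
      have h1 := congrArg idx h
      rw [hfi, hfi] at h1
      have h2 : (r : ℕ) * 2 ^ L = r' * 2 ^ L := by omega
      exact Fin.ext (Nat.eq_of_mul_eq_mul_right hQ h2)
    calc 3 = (Finset.univ : Finset (Fin 3)).card := by simp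
      _ ≤ _ := Finset.card_le_card_of_injOn f (fun r _ => ?_) hinj.injOn
    simp only [Finset.coe_filter, Set.mem_ofPred_eq]
    refine ⟨hf r, ?_⟩
    rw [hfi]
    push_cast
    have : ((2 : ZMod (2 ^ L)) ^ L) = 0 := by
      have h := ZMod.natCast_self (2 ^ L)
      push_cast at h
      exact h
    rw [this]
    simp

/-! ### Independent geometric random variables -/

section Geometric

variable (d : ℕ)

theorem inv_one_sub_one_sub_inv (hd : d ≠ 0) : (1 - (1 - (d : ℝ≥0∞)⁻¹))⁻¹ = d := by
  rw [ENNReal.sub_sub_cancel ENNReal.one_ne_top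
    (ENNReal.inv_le_one.2 (by exact_mod_cast Nat.one_le_iff_ne_zero.2 hd)), inv_inv]

/-- The number of failures before the first success, in independent trials each of which succeeds
with probability `1 / d`. -/
noncomputable def geomLaw (d : ℕ) [NeZero d] : PMF ℕ :=
  ⟨fun b => (d : ℝ≥0∞)⁻¹ * (1 - (d : ℝ≥0∞)⁻¹) ^ b, by
    rw [Summable.hasSum_iff ENNReal.summable, ENNReal.tsum_mul_left, ENNReal.tsum_geometric,
      inv_one_sub_one_sub_inv d (NeZero.ne d)]
    exact ENNReal.inv_mul_cancel (by simpa using NeZero.ne d) (ENNReal.natCast_ne_top d)⟩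

variable [NeZero d]

theorem geomLaw_apply (b : ℕ) :
    geomLaw d b = (d : ℝ≥0∞)⁻¹ * (1 - (d : ℝ≥0∞)⁻¹) ^ b := rfl

theorem geomLaw_tail (b : ℕ) :
    ∑' x, (if b ≤ x then geomLaw d x else 0) = (1 - (d : ℝ≥0∞)⁻¹) ^ b := by
  rw [← Summable.sum_add_tsum_nat_add' (k := b) ENNReal.summable,
    Finset.sum_eq_zero fun i hi => if_neg (not_le.2 (Finset.mem_range.1 hi)), zero_add]
  simp only [Nat.le_add_left, if_true, geomLaw_apply, pow_add]
  simp_rw [← mul_assoc]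
  rw [ENNReal.tsum_mul_right, ENNReal.tsum_mul_left, ENNReal.tsum_geometric,
    inv_one_sub_one_sub_inv d (NeZero.ne d),
    ENNReal.inv_mul_cancel (by simpa using NeZero.ne d) (ENNReal.natCast_ne_top d), one_mul]

/-- The hazard rate is constantly `1 / d`. -/
theorem geomLaw_hazard (b : ℕ) :
    (d : ℝ≥0∞) * geomLaw d b = ∑' x, if b ≤ x then geomLaw d x else 0 := by
  rw [geomLaw_tail, geomLaw_apply, ← mul_assoc,
    ENNReal.mul_inv_cancel (by simpa using NeZero.ne d) (ENNReal.natCast_ne_top d), one_mul]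

theorem geomLaw_mean_le : ∑' b : ℕ, geomLaw d b * b ≤ d := by
  have h1 : ∀ b : ℕ, geomLaw d b * b = ∑' c : ℕ, if c + 1 ≤ b then geomLaw d b else 0 := by
    intro b
    rw [tsum_eq_sum (s := Finset.range b) fun c hc => if_neg (by simpa using hc),
      Finset.sum_congr rfl fun c hc => if_pos (by simpa using hc)]
    simp [mul_comm]
  simp_rw [h1]
  rw [ENNReal.tsum_comm]
  simp_rw [geomLaw_tail]
  calc ∑' c : ℕ, (1 - (d : ℝ≥0∞)⁻¹) ^ (c + 1) ≤ ∑' c : ℕ, (1 - (d : ℝ≥0∞)⁻¹) ^ c :=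
        ENNReal.tsum_le_tsum fun c => pow_le_pow_right_of_le_one' tsub_le_self (Nat.le_succ c)
    _ = d := by rw [ENNReal.tsum_geometric, inv_one_sub_one_sub_inv d (NeZero.ne d)]

end Geometric

section Iid

theorem tsum_prod_law {α : Type} (p : PMF α) (n : ℕ) :
    ∑' G : Fin n → α, ∏ k, p (G k) = 1 := by
  induction n with
  | zero =>
    rw [tsum_fintype]
    simp
  | succ n ih =>
    rw [← (Fin.consEquiv fun _ : Fin (n + 1) => α).tsum_eq, ENNReal.tsum_prod']
    simp only [Fin.consEquiv, Equiv.coe_fn_mk, Fin.prod_univ_succ, Fin.cons_zero, Fin.cons_succ]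
    simp_rw [ENNReal.tsum_mul_left, ih, mul_one]
    exact p.tsum_coe

/-- The law of `n` independent random variables with the law `p`. -/
noncomputable def iidLaw {α : Type} (p : PMF α) (n : ℕ) : PMF (Fin n → α) :=
  ⟨fun G => ∏ k, p (G k), by
    rw [Summable.hasSum_iff ENNReal.summable]
    exact tsum_prod_law p n⟩

theorem iidLaw_apply {α : Type} (p : PMF α) {n : ℕ} (G : Fin n → α) :
    iidLaw p n G = ∏ k, p (G k) := rfl

/-- The expectation of a product of a function of one of the variables and of a function of the
others. -/
theorem tsum_iidLaw_split {α : Type} [Inhabited α] (p : PMF α) {n : ℕ} (k : Fin n)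
    (f : α → ℝ≥0∞) (F : (Fin n → α) → ℝ≥0∞) (hF : ∀ G x, F (Function.update G k x) = F G) :
    ∑' G, iidLaw p n G * (f (G k) * F G) = (∑' x, p x * f x) * ∑' G, iidLaw p n G * F G := by
  classical
  set e := Equiv.funSplitAt k α with he
  have hk : ∀ x g, e.symm (x, g) k = x := fun x g => by simp [he]
  have hup : ∀ x g, e.symm (x, g) = Function.update (e.symm (default, g)) k x := by
    intro x g
    funext i
    by_cases hi : i = k
    · subst hi; simp [hk]
    · rw [Function.update_of_ne hi]
      simp [he, Equiv.funSplitAt, Equiv.piSplitAt, hi]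
  have hprod : ∀ x g, iidLaw p n (e.symm (x, g))
      = p x * ∏ i : {i // i ≠ k}, p (g i) := by
    intro x g
    rw [iidLaw_apply, Fintype.prod_eq_mul_prod_compl k, hk]
    congr 1
    rw [Finset.prod_subtype ({k}ᶜ) (p := fun i => i ≠ k) (by simp)]
    refine Finset.prod_congr rfl fun i _ => ?_
    congr 1
    simp [he, Equiv.funSplitAt, Equiv.piSplitAt, i.2]
  have h1 : ∀ f' : α → ℝ≥0∞, ∑' G, iidLaw p n G * (f' (G k) * F G)
      = (∑' x, p x * f' x) *
        ∑' g : {i // i ≠ k} → α, (∏ i, p (g i)) * F (e.symm (default, g)) := by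
    intro f'
    rw [← e.symm.tsum_eq, ENNReal.tsum_prod']
    simp_rw [hprod, hk]
    rw [← ENNReal.tsum_mul_right]
    refine tsum_congr fun x => ?_
    rw [← ENNReal.tsum_mul_left]
    refine tsum_congr fun g => ?_
    rw [hup x g, hF]
    ring
  have h2 := h1 fun _ => 1
  simp only [one_mul, mul_one, p.tsum_coe] at h2
  rw [h1, h2]

end Iid

/-! ### The iterated protocol -/

namespace Iterated

/-- The dealer's randomness for one step: the piece of each player, and, for each ordered pair of
players `k` and `i`, the function that computes the tag with which a message from `k` to `i` has to
be authenticated. -/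
abbrev StepData (n d : ℕ) (S : Type) : Type :=
  (Fin n → S) × (Fin n → Fin n → S → ZMod d)

/-- The share of a player: a public element, the last iteration that can be reached from the
player's point of view, and, for each step up to the end of that iteration, the player's piece, the
tags that it has to send along, and the functions by which it checks the tags that it receives. -/
@[ext]
structure Share (n d : ℕ) (S : Type) where
  pub : S
  last : ℕ
  piece : ℕ → S
  tag : ℕ → Fin n → ZMod d
  key : ℕ → Fin n → S → ZMod d

/-- In the second step of iteration `r`, the player with the number `r % n` is idle. -/
def Idle {n : ℕ} (t : ℕ) (k : Fin n) : Prop := t % 2 = 1 ∧ t / 2 % n = k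

instance {n : ℕ} (t : ℕ) (k : Fin n) : Decidable (Idle t k) :=
  inferInstanceAs (Decidable (_ ∧ _))

variable {n d : ℕ} {S : Type} [AddCommGroup S]

open Classical in
/-- The share of player `i`, for the public element `e`, the definitive iteration `X` and the
step data `D`.  After the definitive iteration, the tags are off by one. -/
noncomputable def mkShare (e : S) (l X : ℕ) (D : ℕ → StepData n d S) (i : Fin n) : Share n d S where
  pub := e
  last := l
  piece t := if t ≤ 2 * l + 1 then (D t).1 i else 0
  tag t k := if t ≤ 2 * l + 1 ∧ k ≠ i then
    (D t).2 i k ((D t).1 i) + (if 2 * X + 1 < t then 1 else 0) else 0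
  key t k := if t ≤ 2 * l + 1 then (D t).2 k i else 0

/-- The sum of all pieces of step `t`. -/
noncomputable def stepSum (A : Finset (Fin n)) (D : ℕ → StepData n d S) (t : ℕ) : S :=
  ∑ k ∈ A with ¬ Idle t k, (D t).1 k

/-- The value of iteration `r`. -/
noncomputable def iterVal (A : Finset (Fin n)) (D : ℕ → StepData n d S) (r : ℕ) : S :=
  stepSum A D (2 * r) + stepSum A D (2 * r + 1)

variable [Fintype S] [NeZero d] (A : Finset (Fin n))

/-- All messages that player `i` has received in step `t` are properly authenticated. -/
def Valid (x : Share n d S) (i : Fin n) (t : ℕ) (m : Inbox n) : Prop :=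
  ∀ k ∈ A, k ≠ i → ¬ Idle t k → ∃ y, m k = encode (y, x.key t k y)

/-- Player `i` goes on after the messages `h`: it has not reached its last iteration, and there was
no invalid message. -/
def Active (x : Share n d S) (i : Fin n) (h : List (Inbox n)) : Prop :=
  h.length ≤ 2 * x.last + 1 ∧ ∀ t < h.length, Valid A x i t (h.getD t fun _ => [])

/-- The sum of the pieces of step `t`, as computed by player `i` from the messages `h`. -/
noncomputable def received (x : Share n d S) (i : Fin n) (h : List (Inbox n)) (t : ℕ) : S :=
  ∑ k ∈ A with ¬ Idle t k, if k = i then x.piece t else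
    (decode (S × ZMod d) (h.getD t (fun _ => []) k)).1

open Classical in
/-- The prescribed strategy.  A player who stops after `l` steps bases its output on the last
iteration that was complete before the final message, which is the iteration `(l - 2) / 2`. -/
noncomputable def strategy (i : Fin n) (x : Share n d S) : Strategy n S where
  send h k := if Active A x i h ∧ ¬ Idle h.length i ∧ k ∈ A then
    encode (x.piece h.length, x.tag h.length k) else []
  out h := if Active A x i h then none else
    some (x.pub + (received A x i h (2 * ((h.length - 2) / 2)) +
      received A x i h (2 * ((h.length - 2) / 2) + 1)))

/-- The message from `k` to `i` in step `t`, up to the end of the definitive iteration. -/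
noncomputable def message (D : ℕ → StepData n d S) (t : ℕ) (k i : Fin n) : List Bool :=
  if k ∈ A ∧ i ∈ A ∧ ¬ Idle t k then encode ((D t).1 k, (D t).2 k i ((D t).1 k)) else []

theorem strategy_send_of_not_active {x : Share n d S} {i : Fin n} {h : List (Inbox n)}
    (hx : ¬ Active A x i h) (k : Fin n) : (strategy A i x).send h k = [] := by
  simp [strategy, hx]

section Dynamics

variable (e : S) (l : Fin n → ℕ) (X : ℕ) (D : ℕ → StepData n d S)

/-- The strategies for given randomness of the dealer; `l` lists the last iterations. -/
noncomputable def profile (i : Fin n) : Strategy n S :=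
  strategy A i (mkShare e (l i) X D i)

variable {h : ℕ → Fin n → List (Inbox n)} {o : ℕ → Fin n → Fin n → List Bool}

/-- In the run `o`, the messages of step `t` are those that should be sent up to the end of the
definitive iteration. -/
def Proper (D : ℕ → StepData n d S) (o : ℕ → Fin n → Fin n → List Bool) (t : ℕ) : Prop :=
  ∀ k ∈ A, ∀ i ∈ A, i ≠ k → ¬ Idle t k → o t k i = message A D t k i

variable {A l X D}

theorem active_of_proper (h0 : ∀ i, h 0 i = [])
    (hs : ∀ r i, h (r + 1) i = h r i ++ [deliver (o r) i]) {r : ℕ} {i : Fin n}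
    (hi : i ∈ A) (hr : r ≤ 2 * l i + 1) (ho : ∀ t < r, Proper A D o t) :
    Active A (mkShare e (l i) X D i) i (h r i) := by
  refine ⟨by rw [run_length h0 hs]; exact hr, fun t ht k hk hki hidle => ?_⟩
  rw [run_length h0 hs] at ht
  refine ⟨(D t).1 k, ?_⟩
  rw [run_getD h0 hs ht, deliver, if_neg hki, ho t ht k hk i hi (Ne.symm hki) hidle]
  have h1 : t ≤ 2 * l i + 1 := by omega
  simp [message, hk, hi, hidle, mkShare, h1]

theorem send_of_active {r : ℕ} {k i : Fin n} (hk : k ∈ A) (hki : i ≠ k) {v : List (Inbox n)}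
    (hv : v.length = r) (hr : r ≤ 2 * X + 1) (hX : X ≤ l k)
    (hact : Active A (mkShare e (l k) X D k) k v) :
    (profile A e l X D k).send v i = message A D r k i := by
  have h1 : r ≤ 2 * l k + 1 := by omega
  have h2 : ¬ 2 * X + 1 < r := by omega
  subst hv
  simp only [profile, strategy, message, hact, true_and, hk]
  by_cases hc : ¬ Idle v.length k ∧ i ∈ A
  · rw [if_pos hc, if_pos ⟨hc.2, hc.1⟩]
    simp [mkShare, h1, h2, hki]
  · rw [if_neg hc, if_neg fun h => hc ⟨h.2, h.1⟩]

/-- If in each of the first `T` steps every player either follows the protocol or sends proper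
messages, then all messages of these steps are proper. -/
theorem proper_of_follow (h0 : ∀ i, h 0 i = [])
    (hs : ∀ r i, h (r + 1) i = h r i ++ [deliver (o r) i]) (hX : ∀ i, X ≤ l i) {T : ℕ}
    (hT : T ≤ 2 * X + 2)
    (ho : ∀ t < T, ∀ k ∈ A, o t k = (profile A e l X D k).send (h t k) ∨
      ∀ i ∈ A, i ≠ k → ¬ Idle t k → o t k i = message A D t k i) :
    ∀ t < T, Proper A D o t := by
  intro t
  induction t using Nat.strong_induction_on with
  | _ t ih =>
    intro ht k hk i hi hik hidle
    rcases ho t ht k hk with h1 | h1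
    · rw [h1]
      have h2 := hX k
      exact send_of_active e hk hik (run_length h0 hs t k) (by omega) (hX k)
        (active_of_proper e h0 hs hk (by omega) fun t' ht' => ih t' ht' (by omega))
    · exact h1 i hi hik hidle

theorem received_of_proper (h0 : ∀ i, h 0 i = [])
    (hs : ∀ r i, h (r + 1) i = h r i ++ [deliver (o r) i]) {r t : ℕ} {i : Fin n}
    (hi : i ∈ A) (ht : t < r) (htl : t ≤ 2 * l i + 1) (ho : Proper A D o t) :
    received A (mkShare e (l i) X D i) i (h r i) t = stepSum A D t := by
  unfold received stepSum
  refine Finset.sum_congr rfl fun k hk => ?_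
  obtain ⟨hkA, hidle⟩ := Finset.mem_filter.1 hk
  by_cases hki : k = i
  · subst hki
    simp [mkShare, htl]
  · rw [if_neg hki, run_getD h0 hs ht, deliver, if_neg hki, ho k hkA i hi (Ne.symm hki) hidle]
    simp [message, hkA, hi, hidle]

/-- If all messages are proper up to the end of the definitive iteration, then player `i` outputs
the secret one step later at the latest, provided that at least one other player still follows the
protocol then: its message is invalid. -/
theorem learns_of_proper [Fact (1 < d)] (h0 : ∀ i, h 0 i = [])
    (hs : ∀ r i, h (r + 1) i = h r i ++ [deliver (o r) i]) (hX : ∀ i, X ≤ l i)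
    (ho : ∀ t < 2 * X + 2, Proper A D o t) {i k : Fin n} (hi : i ∈ A) (hk : k ∈ A) (hki : k ≠ i)
    (hfol : o (2 * X + 2) k = (profile A e l X D k).send (h (2 * X + 2) k)) :
    ∃ r ≤ 2 * X + 3, (profile A e l X D i).out (h r i) = some (e + iterVal A D X) ∧
      ∀ r' < r, (profile A e l X D i).out (h r' i) = none := by
  have hXi := hX i
  have hXk := hX k
  have hout : ∀ r, 2 * X + 2 ≤ r → (r - 2) / 2 = X →
      ¬ Active A (mkShare e (l i) X D i) i (h r i) →
      (profile A e l X D i).out (h r i) = some (e + iterVal A D X) := by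
    intro r hr hr2 hact
    simp only [profile, strategy, if_neg hact, run_length h0 hs, hr2]
    rw [received_of_proper e h0 hs hi (by omega) (by omega) (ho _ (by omega)),
      received_of_proper e h0 hs hi (by omega) (by omega) (ho _ (by omega))]
    rfl
  have hnone : ∀ r, r ≤ 2 * X + 2 → r ≤ 2 * l i + 1 →
      (profile A e l X D i).out (h r i) = none := by
    intro r hr hr2
    have := active_of_proper (X := X) e h0 hs hi hr2 fun t ht => ho t (by omega)
    simp only [profile, strategy, if_pos this]
  by_cases hl : l i = X
  · refine ⟨2 * X + 2, by omega, hout _ le_rfl (by omega) fun hact => ?_, fun r' hr' =>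
      hnone r' (by omega) (by omega)⟩
    have h1 := hact.1
    rw [run_length h0 hs] at h1
    simp only [mkShare] at h1
    omega
  · refine ⟨2 * X + 3, le_rfl, hout _ (by omega) (by omega) fun hact => ?_, fun r' hr' =>
      hnone r' (by omega) (by omega)⟩
    have hidle : ¬ Idle (2 * X + 2) k := fun h => by have := h.1; omega
    have h1 := hact.2 (2 * X + 2) (by rw [run_length h0 hs]; omega) k hk hki hidle
    rw [run_getD h0 hs (by omega), deliver, if_neg hki, hfol] at h1
    obtain ⟨y, hy⟩ := h1
    by_cases hkact : Active A (mkShare e (l k) X D k) k (h (2 * X + 2) k)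
    · have hlk := hkact.1
      rw [run_length h0 hs] at hlk
      simp only [mkShare] at hlk
      have hik : i ≠ k := Ne.symm hki
      simp only [profile, strategy, run_length h0 hs, hkact, hidle, hi, not_false_eq_true,
        and_self, if_true] at hy
      have h2 := encode_injective hy
      have hli : 2 * X + 2 ≤ 2 * l i + 1 := by omega
      have hX2 : 2 * X + 1 < 2 * X + 2 := by omega
      simp only [mkShare, hlk, hli, hX2, if_true, Prod.mk.injEq, hik, ne_eq,
        not_false_eq_true, and_self] at h2
      obtain ⟨h3, h4⟩ := h2
      rw [← h3] at h4
      exact one_ne_zero (add_eq_left.1 h4)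
    · rw [profile, strategy_send_of_not_active A hkact] at hy
      exact encode_ne_nil _ hy.symm

end Dynamics

end Iterated

/-! ### Dealing and honest runs of the iterated protocol -/

namespace Iterated

variable {n d : ℕ} {S : Type}

/-- The last iteration that can be reached from the point of view of player `k`, namely the one in
which `k` is idle for the `G k + 1`-st time. -/
def lastIter (G : Fin n → ℕ) (k : Fin n) : ℕ := G k * n + k

/-- The definitive iteration. -/
noncomputable def stopIter (G : Fin n → ℕ) : ℕ := ⨅ k, lastIter G k

/-- The number of steps for which the dealer provides data. -/
def numSteps (G : Fin n → ℕ) : ℕ := 2 * n * (∑ k, G k + 1)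

theorem stopIter_le (G : Fin n → ℕ) (k : Fin n) : stopIter G ≤ lastIter G k :=
  ciInf_le (OrderBot.bddBelow _) k

theorem exists_stopIter_eq [NeZero n] (G : Fin n → ℕ) : ∃ k, lastIter G k = stopIter G :=
  Nat.sInf_mem (Set.range_nonempty (lastIter G))

theorem le_stopIter_iff [NeZero n] (G : Fin n → ℕ) (r : ℕ) :
    r ≤ stopIter G ↔ ∀ k, r ≤ lastIter G k :=
  ⟨fun h k => h.trans (stopIter_le G k), fun h => by
    obtain ⟨k, hk⟩ := exists_stopIter_eq G
    exact hk ▸ h k⟩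

theorem lastIter_lt_numSteps (G : Fin n → ℕ) (k : Fin n) : 2 * lastIter G k + 1 < numSteps G := by
  have h1 : G k ≤ ∑ k, G k := Finset.single_le_sum (fun _ _ => Nat.zero_le _) (Finset.mem_univ k)
  have h2 : G k * n ≤ (∑ k, G k) * n := Nat.mul_le_mul_right _ h1
  have h3 := k.2
  unfold lastIter numSteps
  nlinarith

theorem stopIter_lt_numSteps [NeZero n] (G : Fin n → ℕ) : 2 * stopIter G + 1 < numSteps G := by
  obtain ⟨k, hk⟩ := exists_stopIter_eq G
  exact hk ▸ lastIter_lt_numSteps G k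

/-- The dealer's coins: the numbers that determine the last iterations, and the step data. -/
abbrev Coins (n d : ℕ) (S : Type) : Type :=
  Σ G : Fin n → ℕ, (Fin (numSteps G) → StepData n d S)

/-- Extend a finite sequence by zeros. -/
def zeroExtend {β : Type} [Zero β] {N : ℕ} (x : Fin N → β) (t : ℕ) : β :=
  if h : t < N then x ⟨t, h⟩ else 0

variable [AddCommGroup S]

/-- The step data as a function of the step. -/
def dat (ω : Coins n d S) : ℕ → StepData n d S :=
  zeroExtend ω.2

/-- Add the values of `a` to the step data. -/
def translate (a : ℕ → StepData n d S) (ω : Coins n d S) : Coins n d S :=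
  ⟨ω.1, fun t => ω.2 t + a t⟩

theorem dat_translate {a : ℕ → StepData n d S} {ω : Coins n d S}
    (ha : ∀ t, numSteps ω.1 ≤ t → a t = 0) (t : ℕ) : dat (translate a ω) t = dat ω t + a t := by
  unfold dat translate zeroExtend
  by_cases h : t < numSteps ω.1
  · simp [h]
  · simp [h, ha t (not_lt.1 h)]

theorem translate_zero (ω : Coins n d S) : translate (0 : ℕ → StepData n d S) ω = ω := by
  unfold translate
  simp

theorem translate_translate (a b : ℕ → StepData n d S) (ω : Coins n d S) :
    translate a (translate b ω) = translate (a + b) ω := by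
  unfold translate
  simp only [Pi.add_apply, add_assoc, add_comm (a _) (b _)]

/-- The step data that add `g` to the piece of player `c` in step `u`. -/
def pieceShift (u : ℕ) (c : Fin n) (g : S) (t : ℕ) : StepData n d S :=
  if t = u then (Pi.single c g, 0) else 0

theorem stepSum_add_pieceShift {A : Finset (Fin n)} (D : ℕ → StepData n d S) {u : ℕ} {c : Fin n}
    (hc : c ∈ A) (hu : ¬ Idle u c) (g : S) (t : ℕ) :
    stepSum A (fun t => D t + pieceShift u c g t) t = stepSum A D t + if t = u then g else 0 := by
  unfold stepSum
  simp only [Prod.fst_add, Pi.add_apply, Finset.sum_add_distrib]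
  congr 1
  by_cases ht : t = u
  · subst ht
    simp [pieceShift, Pi.single_apply, hc, hu]
  · simp [pieceShift, ht]

theorem iterVal_add_pieceShift {A : Finset (Fin n)} (D : ℕ → StepData n d S) {u : ℕ} {c : Fin n}
    (hc : c ∈ A) (hu : ¬ Idle u c) (g : S) :
    iterVal A (fun t => D t + pieceShift u c g t) (u / 2) = iterVal A D (u / 2) + g := by
  unfold iterVal
  rw [stepSum_add_pieceShift D hc hu, stepSum_add_pieceShift D hc hu]
  rcases Nat.even_or_odd' u with ⟨r, h | h⟩
  · rw [if_pos (by omega), if_neg (by omega)]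
    abel
  · rw [if_neg (by omega), if_pos (by omega)]
    abel

theorem mkShare_add_pieceShift (e : S) (l X : ℕ) (D : ℕ → StepData n d S) (u : ℕ) {c i : Fin n}
    (hi : i ≠ c) (g : S) :
    mkShare e l X (fun t => D t + pieceShift u c g t) i = mkShare e l X D i := by
  have h1 : ∀ t, (D t + pieceShift u c g t).1 i = (D t).1 i := by
    intro t
    unfold pieceShift
    split_ifs <;> simp [hi]
  have h2 : ∀ t, (D t + pieceShift u c g t).2 = (D t).2 := by
    intro t
    unfold pieceShift
    split_ifs <;> simp
  unfold mkShare
  simp only [h1, h2]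

theorem pieceShift_eq_zero {G : Fin n → ℕ} {u : ℕ} (hu : u < numSteps G) (c : Fin n) (g : S)
    (t : ℕ) (ht : numSteps G ≤ t) : (pieceShift u c g t : StepData n d S) = 0 :=
  if_neg (by omega)

variable [Fintype S] [DecidableEq S] [NeZero d]

/-- The law of the dealer's coins: independent geometric numbers, and uniform step data. -/
noncomputable def coinLaw (n d : ℕ) (S : Type) [AddCommGroup S] [Fintype S] [DecidableEq S]
    [NeZero d] : PMF (Coins n d S) :=
  ⟨fun ω => iidLaw (geomLaw d) n ω.1 *
      PMF.uniformOfFintype (Fin (numSteps ω.1) → StepData n d S) ω.2, by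
    rw [Summable.hasSum_iff ENNReal.summable, ENNReal.tsum_sigma']
    have h : ∀ G : Fin n → ℕ,
        ∑' x, PMF.uniformOfFintype (Fin (numSteps G) → StepData n d S) x = 1 :=
      fun G => PMF.tsum_coe _
    simp_rw [ENNReal.tsum_mul_left, h, mul_one]
    exact PMF.tsum_coe _⟩

theorem coinLaw_apply (ω : Coins n d S) : coinLaw n d S ω = iidLaw (geomLaw d) n ω.1 *
    PMF.uniformOfFintype (Fin (numSteps ω.1) → StepData n d S) ω.2 := rfl

theorem coinLaw_translate (a : ℕ → StepData n d S) (ω : Coins n d S) :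
    coinLaw n d S (translate a ω) = coinLaw n d S ω := by
  rw [coinLaw_apply, coinLaw_apply, PMF.uniformOfFintype_apply, PMF.uniformOfFintype_apply]
  rfl

theorem tsum_coinLaw_fst (F : (Fin n → ℕ) → ℝ≥0∞) :
    ∑' ω, coinLaw n d S ω * F ω.1 = ∑' G, iidLaw (geomLaw d) n G * F G := by
  rw [ENNReal.tsum_sigma']
  refine tsum_congr fun G => ?_
  have h : ∑' x, PMF.uniformOfFintype (Fin (numSteps G) → StepData n d S) x = 1 :=
    PMF.tsum_coe _
  simp_rw [coinLaw_apply, mul_assoc]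
  rw [ENNReal.tsum_mul_left, ENNReal.tsum_mul_right, h, one_mul]

theorem mean_stopIter_le [NeZero n] (a b : ℕ) :
    ∑' ω, coinLaw n d S ω * ((a * stopIter ω.1 + b : ℕ) : ℝ≥0∞) ≤
      ((a * (d * n) + b : ℕ) : ℝ≥0∞) := by
  rw [tsum_coinLaw_fst fun G => ((a * stopIter G + b : ℕ) : ℝ≥0∞)]
  have h1 : ∀ G : Fin n → ℕ, iidLaw (geomLaw d) n G * ((a * stopIter G + b : ℕ) : ℝ≥0∞)
      ≤ (a * n) * (iidLaw (geomLaw d) n G * ((G 0 : ℝ≥0∞) * 1)) +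
        iidLaw (geomLaw d) n G * b := by
    intro G
    have h2 : stopIter G ≤ G 0 * n := by
      have := stopIter_le G 0
      simpa [lastIter] using this
    have h3 : ((a * stopIter G + b : ℕ) : ℝ≥0∞) ≤ (a * n) * ((G 0 : ℝ≥0∞) * 1) + b := by
      have h4 : a * stopIter G + b ≤ a * n * G 0 + b := by nlinarith
      have h5 : ((a * stopIter G + b : ℕ) : ℝ≥0∞) ≤ ((a * n * G 0 + b : ℕ) : ℝ≥0∞) := by
        exact_mod_cast h4
      refine h5.trans (le_of_eq ?_)
      push_cast
      ring
    calc _ ≤ iidLaw (geomLaw d) n G * ((a * n) * ((G 0 : ℝ≥0∞) * 1) + b) := by gcongr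
      _ = _ := by ring
  refine (ENNReal.tsum_le_tsum h1).trans ?_
  rw [ENNReal.tsum_add, ENNReal.tsum_mul_left, ENNReal.tsum_mul_right, PMF.tsum_coe, one_mul,
    tsum_iidLaw_split (geomLaw d) (0 : Fin n) (fun x : ℕ => (x : ℝ≥0∞)) (fun _ => 1)
      fun _ _ => rfl]
  simp_rw [mul_one]
  rw [PMF.tsum_coe, mul_one]
  push_cast
  calc (a * n : ℝ≥0∞) * ∑' x : ℕ, geomLaw d x * x + b ≤ a * n * d + b := by
        gcongr
        exact geomLaw_mean_le d
    _ = _ := by ring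

/-- The iterated protocol for the active set `A`.  The secret is the sum of the public element and
of the value of the definitive iteration. -/
noncomputable def protocol (d : ℕ) [NeZero d] (A : Finset (Fin n)) : Protocol n S where
  Coins := Coins n d S
  coins := coinLaw n d S
  Share := Share n d S
  deal s ω i := mkShare (s - iterVal A (dat ω) (stopIter ω.1)) (lastIter ω.1 i) (stopIter ω.1)
    (dat ω) i
  player _ i x := strategy A i x

theorem strat_protocol (A : Finset (Fin n)) (s : S) (ω : Coins n d S) :
    (protocol d A).strat A s ω = profile A (s - iterVal A (dat ω) (stopIter ω.1)) (lastIter ω.1)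
      (stopIter ω.1) (dat ω) := rfl

/-- The honest run. -/
theorem learns_views [Fact (1 < d)] {A : Finset (Fin n)} (hA : 2 ≤ A.card) (s : S)
    (ω : Coins n d S) {i : Fin n} (hi : i ∈ A) :
    ∃ r ≤ 2 * stopIter ω.1 + 3, ((protocol d A).strat A s ω i).out
        (views A ((protocol d A).strat A s ω) r i) = some s ∧
      ∀ r' < r, ((protocol d A).strat A s ω i).out
        (views A ((protocol d A).strat A s ω) r' i) = none := by
  obtain ⟨k, hk, hki⟩ := Finset.exists_mem_ne (by omega : 1 < A.card) i
  set σ := (protocol d A).strat A s ω with hσ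
  have hfol : ∀ t, ∀ k ∈ A, sent A σ (views A σ t) k = (σ k).send (views A σ t k) :=
    fun t k hk => by simp [sent, hk]
  have h1 := learns_of_proper (A := A) (s - iterVal A (dat ω) (stopIter ω.1))
    (h := views A σ) (o := fun r => sent A σ (views A σ r)) (fun _ => rfl) (fun _ _ => rfl)
    (stopIter_le ω.1)
    (proper_of_follow _ (fun _ => rfl) (fun _ _ => rfl) (stopIter_le ω.1) le_rfl
      fun t _ k hk => Or.inl (hfol t k hk)) hi hk hki (hfol _ k hk)
  rw [sub_add_cancel] at h1
  exact h1

theorem allLearn [Fact (1 < d)] {A : Finset (Fin n)} (hA : 2 ≤ A.card) :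
    (protocol (S := S) d A).AllLearn A Set.univ := by
  intro s ω _ _
  refine learners_eq fun i hi => ?_
  obtain ⟨r, _, h1, h2⟩ := learns_views hA s ω hi
  exact ⟨r, h1, h2⟩

theorem expLatency_le [Fact (1 < d)] [NeZero n] {A : Finset (Fin n)} (hA : 2 ≤ A.card) (s : S) :
    (protocol d A).expLatency A Set.univ (protocol d A).exists_mem_univ s
      ≤ ((2 * (d * n) + 3 : ℕ) : ℝ≥0∞) := by
  unfold Protocol.expLatency
  rw [Protocol.condCoins_univ]
  refine le_trans (ENNReal.tsum_le_tsum fun ω => mul_le_mul_right ?_ _)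
    (mean_stopIter_le (n := n) (d := d) (S := S) 2 3)
  refine latency_le fun i hi => ?_
  obtain ⟨r, hr, h1, _⟩ := learns_views hA s ω hi
  exact ⟨r, hr, by rw [h1]; rfl⟩

theorem bitsSent_le [Fact (1 < d)] {A : Finset (Fin n)} (hA : 2 ≤ A.card) (s : S)
    (ω : Coins n d S) {i : Fin n} (hi : i ∈ A) :
    bitsSent A ((protocol d A).strat A s ω) i ≤
      (((n * (Nat.log 2 (Fintype.card (S × ZMod d)) + 1) * 2) * stopIter ω.1 +
        n * (Nat.log 2 (Fintype.card (S × ZMod d)) + 1) * 3 : ℕ) : ℝ≥0∞) := by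
  set M := Nat.log 2 (Fintype.card (S × ZMod d)) + 1 with hM
  set σ := (protocol d A).strat A s ω with hσ
  have hsend : ∀ r k, sent A σ (views A σ r) i k = (σ i).send (views A σ r i) k :=
    fun r k => by simp [sent, hi]
  have hlen : ∀ r k, (sent A σ (views A σ r) i k).length ≤ M := by
    intro r k
    rw [hsend]
    simp only [hσ, strat_protocol, profile, strategy]
    split_ifs
    · exact length_encode_le _
    · simp
  obtain ⟨r₀, hr₀, h1, _⟩ := learns_views hA s ω hi
  have hsilent : ∀ r, r₀ ≤ r → ∀ k, sent A σ (views A σ r) i k = [] := by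
    intro r hr k
    rw [hsend]
    refine strategy_send_of_not_active A (fun hact => ?_) k
    rw [strat_protocol] at h1
    simp only [profile, strategy] at h1
    rw [if_pos] at h1
    · exact absurd h1 (by simp)
    · have h0 := length_views A σ
      have hgetD : ∀ {r t : ℕ}, t < r → (views A σ r i).getD t (fun _ => [])
          = deliver (sent A σ (views A σ t)) i := fun ht =>
        run_getD (o := fun r => sent A σ (views A σ r)) (fun _ => rfl) (fun _ _ => rfl) ht i
      obtain ⟨h2, h3⟩ := hact
      rw [h0] at h2 h3
      refine ⟨?_, fun t ht => ?_⟩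
      · change (views A σ r₀ i).length ≤ _
        rw [h0]
        exact hr.trans h2
      · change Valid _ _ _ _ ((views A σ r₀ i).getD t _)
        change t < (views A σ r₀ i).length at ht
        rw [h0] at ht
        rw [hgetD ht, ← hgetD (ht.trans_le hr)]
        exact h3 t (ht.trans_le hr)
  unfold bitsSent
  rw [tsum_eq_sum (s := Finset.range (2 * stopIter ω.1 + 3))]
  · calc _ ≤ ∑ _r ∈ Finset.range (2 * stopIter ω.1 + 3), ((n * M : ℕ) : ℝ≥0∞) := by
          refine Finset.sum_le_sum fun r _ => ?_
          rw [← Nat.cast_sum]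
          refine Nat.cast_le.2 ((Finset.sum_le_sum fun k _ => hlen r k).trans ?_)
          simp
      _ = _ := by
          rw [Finset.sum_const, Finset.card_range, nsmul_eq_mul]
          push_cast
          ring
  · intro r hr
    rw [Finset.mem_range, not_lt] at hr
    refine Finset.sum_eq_zero fun k _ => ?_
    rw [hsilent r (hr₀.trans hr)]
    simp

theorem expBits_le [Fact (1 < d)] [NeZero n] {A : Finset (Fin n)} (hA : 2 ≤ A.card) (s : S)
    {i : Fin n} (hi : i ∈ A) :
    (protocol d A).expBits A Set.univ (protocol d A).exists_mem_univ s i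
      ≤ (((n * (Nat.log 2 (Fintype.card (S × ZMod d)) + 1) * 2) * (d * n) +
        n * (Nat.log 2 (Fintype.card (S × ZMod d)) + 1) * 3 : ℕ) : ℝ≥0∞) := by
  unfold Protocol.expBits
  rw [Protocol.condCoins_univ]
  exact le_trans (ENNReal.tsum_le_tsum fun ω => mul_le_mul_right (bitsSent_le hA s ω hi) _)
    (mean_stopIter_le (n := n) (d := d) (S := S) _ _)

/-- The piece that an absent active player contributes to the definitive iteration hides the
secret. -/
theorem hiddenFrom [NeZero n] {A B : Finset (Fin n)} (h : ¬ A ⊆ B) :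
    (protocol (S := S) d A).HiddenFrom B := by
  obtain ⟨c, hcA, hcB⟩ := Finset.not_subset.1 h
  refine Protocol.hiddenFrom_of_equiv _ fun s s' => ?_
  have hneg : ∀ (u : ℕ) (g g' : S), g + g' = 0 →
      (pieceShift u c g + pieceShift u c g' : ℕ → StepData n d S) = 0 := by
    intro u g g' hg
    funext t
    simp only [Pi.add_apply, pieceShift]
    split_ifs
    · rw [Prod.mk_add_mk, ← Pi.single_add, hg]; simp
    · simp
  let φ : Coins n d S ≃ Coins n d S :=
    { toFun := fun ω => translate (pieceShift (2 * stopIter ω.1) c (s' - s)) ω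
      invFun := fun ω => translate (pieceShift (2 * stopIter ω.1) c (s - s')) ω
      left_inv := fun ω => by
        change translate _ (translate _ ω) = ω
        rw [translate_translate]
        change translate (pieceShift (2 * stopIter ω.1) c (s - s') + _) ω = ω
        rw [hneg _ _ _ (by abel), translate_zero]
      right_inv := fun ω => by
        change translate _ (translate _ ω) = ω
        rw [translate_translate]
        change translate (pieceShift (2 * stopIter ω.1) c (s' - s) + _) ω = ω
        rw [hneg _ _ _ (by abel), translate_zero] }
  have hdeal : ∀ ω : Coins n d S, ∀ i ∈ B,
      mkShare (s' - iterVal A (dat (φ ω)) (stopIter ω.1)) (lastIter ω.1 i) (stopIter ω.1)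
        (dat (φ ω)) i = mkShare (s - iterVal A (dat ω) (stopIter ω.1)) (lastIter ω.1 i)
        (stopIter ω.1) (dat ω) i := by
    intro ω i hi
    have hidle : ¬ Idle (2 * stopIter ω.1) c := fun h => by have := h.1; omega
    have hlt := stopIter_lt_numSteps ω.1
    have hdat : dat (φ ω) = fun t => dat ω t + pieceShift (2 * stopIter ω.1) c (s' - s) t :=
      funext fun t => dat_translate (pieceShift_eq_zero (by omega) c _) t
    have hval : iterVal A (dat (φ ω)) (stopIter ω.1)
        = iterVal A (dat ω) (stopIter ω.1) + (s' - s) := by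
      have := iterVal_add_pieceShift (d := d) (dat ω) hcA hidle (s' - s)
      rw [Nat.mul_div_cancel_left _ (by norm_num)] at this
      rw [hdat, this]
    have hic : i ≠ c := fun h => hcB (h ▸ hi)
    rw [hval, hdat, mkShare_add_pieceShift _ _ _ _ _ hic]
    congr 1
    abel
  exact ⟨φ, fun ω => coinLaw_translate _ ω, fun ω i hi => hdeal ω i hi⟩

/-! ### Deviations from the iterated protocol -/

theorem viewsDev_congr {n : ℕ} {S : Type} {A : Finset (Fin n)} {j : Fin n}
    {σ σ' : Fin n → Strategy n S} {ρ' : Strategy n S}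
    (h : ∀ r, ∀ k, k ≠ j → (σ k).send (viewsDev A σ j ρ' r k) = (σ' k).send (viewsDev A σ j ρ' r k))
    (r : ℕ) : viewsDev A σ j ρ' r = viewsDev A σ' j ρ' r := by
  induction r with
  | zero => rfl
  | succ r ih =>
    have hsent : ∀ k, k ≠ j → sent A σ (viewsDev A σ j ρ' r) k
        = sent A σ' (viewsDev A σ j ρ' r) k := by
      intro k hk
      unfold sent
      split_ifs
      · exact h r k hk
      · rfl
    have hdel : deliver (sent A σ (viewsDev A σ j ρ' r)) j
        = deliver (sent A σ' (viewsDev A σ j ρ' r)) j := by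
      funext k
      unfold deliver
      split_ifs with hk
      · rfl
      · rw [hsent k hk]
    have hdev : sentDev A σ j ρ' (viewsDev A σ j ρ' r)
        = sentDev A σ' j ρ' (viewsDev A σ j ρ' r) := by
      unfold sentDev
      rw [hdel]
      funext k
      by_cases hk : k = j
      · subst hk; simp
      · rw [Function.update_of_ne hk, Function.update_of_ne hk, hsent k hk]
    funext i
    rw [viewsDev_succ, viewsDev_succ, ← ih, hdev]

section Deviation

variable {n d : ℕ} {S : Type} [Fintype S] [NeZero d]

/-- What player `j` receives in the first `T` steps if all messages are proper. -/
noncomputable def honestView (A : Finset (Fin n)) (j : Fin n) (D : ℕ → StepData n d S) (T : ℕ) :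
    List (Inbox n) :=
  (List.range T).map fun t => deliver (message A D t) j

/-- What the deviating player `j`, who uses the strategy `ρ` of its share, sends in step `t` if all
earlier messages are proper. -/
noncomputable def reply (A : Finset (Fin n)) (j : Fin n) (ρ : Share n d S → Strategy n S)
    (x : Share n d S) (D : ℕ → StepData n d S) (t : ℕ) : Fin n → List Bool :=
  (ρ x).send (honestView A j D (t + 1))

/-- Player `j` sends an improper message to player `i` in step `t`, provided that all earlier
messages are proper. -/
def Lie (A : Finset (Fin n)) (j : Fin n) (ρ : Share n d S → Strategy n S) (x : Share n d S)
    (D : ℕ → StepData n d S) (t : ℕ) (i : Fin n) : Prop :=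
  i ∈ A ∧ i ≠ j ∧ ¬ Idle t j ∧ reply A j ρ x D t i ≠ message A D t j i

/-- The first lie is the message to player `i` in step `t`; messages of the same step are ordered by
their recipients. -/
def FirstLie (A : Finset (Fin n)) (j : Fin n) (ρ : Share n d S → Strategy n S) (x : Share n d S)
    (D : ℕ → StepData n d S) (t : ℕ) (i : Fin n) : Prop :=
  Lie A j ρ x D t i ∧ (∀ t' < t, ∀ i', ¬ Lie A j ρ x D t' i') ∧ ∀ i' < i, ¬ Lie A j ρ x D t i'

variable {A : Finset (Fin n)} {j : Fin n} {ρ : Share n d S → Strategy n S} {x : Share n d S}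
  {D D' : ℕ → StepData n d S}

theorem FirstLie.unique {t t' : ℕ} {i i' : Fin n} (h : FirstLie A j ρ x D t i)
    (h' : FirstLie A j ρ x D t' i') : t = t' ∧ i = i' := by
  have ht : t = t' := by
    rcases lt_trichotomy t t' with hlt | heq | hgt
    · exact absurd h.1 (h'.2.1 t hlt i)
    · exact heq
    · exact absurd h'.1 (h.2.1 t' hgt i')
  subst ht
  refine ⟨rfl, ?_⟩
  rcases lt_trichotomy i i' with hlt | heq | hgt
  · exact absurd h.1 (h'.2.2 i hlt)
  · exact heq
  · exact absurd h'.1 (h.2.2 i' hgt)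

theorem exists_firstLie {T t : ℕ} {i : Fin n} (ht : t ≤ T) (h : Lie A j ρ x D t i) :
    ∃ t' ≤ T, ∃ i', FirstLie A j ρ x D t' i' := by
  classical
  have hex : ∃ t, ∃ i, Lie A j ρ x D t i := ⟨t, i, h⟩
  obtain ⟨i', hi', hmin⟩ := wellFounded_lt.has_min {i' | Lie A j ρ x D (Nat.find hex) i'}
    (Nat.find_spec hex)
  exact ⟨Nat.find hex, (Nat.find_min' hex ⟨i, h⟩).trans ht, i', hi',
    fun t' ht' i' hl => Nat.find_min hex ht' ⟨i', hl⟩, fun i' hi' hl => hmin i' hl hi'⟩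

theorem reply_congr {t : ℕ}
    (hto : ∀ t' ≤ t, ∀ k, k ≠ j → message A D t' k j = message A D' t' k j) :
    reply A j ρ x D t = reply A j ρ x D' t := by
  have hview : honestView A j D (t + 1) = honestView A j D' (t + 1) := by
    refine List.map_congr_left fun t' ht' => ?_
    rw [List.mem_range] at ht'
    funext k
    unfold deliver
    split_ifs with hk
    · rfl
    · exact hto t' (by omega) k hk
  unfold reply
  rw [hview]

/-- Whether the first lie is that to player `i` in step `t` depends only on the share of player `j`
and on the proper messages from and to player `j` up to step `t`. -/
theorem firstLie_congr {t : ℕ} {i : Fin n}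
    (hto : ∀ t' ≤ t, ∀ k, k ≠ j → message A D t' k j = message A D' t' k j)
    (hfrom : ∀ t' ≤ t, ∀ k, k ≠ j → message A D t' j k = message A D' t' j k) :
    FirstLie A j ρ x D t i ↔ FirstLie A j ρ x D' t i := by
  have hlie : ∀ t' ≤ t, ∀ k, Lie A j ρ x D t' k ↔ Lie A j ρ x D' t' k := by
    intro t' ht' k
    unfold Lie
    rw [reply_congr fun t'' ht'' => hto t'' (ht''.trans ht')]
    refine and_congr_right fun _ => and_congr_right fun hk => ?_
    rw [hfrom t' ht' k hk]
  unfold FirstLie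
  rw [hlie t le_rfl i]
  refine and_congr_right fun _ => and_congr ?_ ?_
  · exact forall_congr' fun t' => forall_congr' fun ht' => forall_congr' fun i' =>
      not_congr (hlie t' ht'.le i')
  · exact forall_congr' fun i' => forall_congr' fun _ => not_congr (hlie t le_rfl i')

theorem message_congr {t : ℕ} {k i : Fin n} (h1 : (D t).1 k = (D' t).1 k)
    (h2 : (D t).2 k i ((D t).1 k) = (D' t).2 k i ((D t).1 k)) :
    message A D t k i = message A D' t k i := by
  unfold message
  rw [h2, h1]

variable [AddCommGroup S] {e : S} {l : Fin n → ℕ} {X : ℕ}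

section Run

variable {ρ' : Strategy n S}

/-- As long as all messages are proper, the other players send proper messages in the next step, up
to the end of the definitive iteration. -/
theorem sentDev_of_proper (hX : ∀ i, X ≤ l i) {t : ℕ} (ht : t ≤ 2 * X + 1)
    (ho : ∀ t' < t, Proper A D
      (fun r => sentDev A (profile A e l X D) j ρ' (viewsDev A (profile A e l X D) j ρ' r)) t')
    {k i : Fin n} (hkj : k ≠ j) (hik : i ≠ k) :
    sentDev A (profile A e l X D) j ρ' (viewsDev A (profile A e l X D) j ρ' t) k i
      = message A D t k i := by
  unfold sentDev
  rw [Function.update_of_ne hkj, sent]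
  split_ifs with hk
  · have hXk := hX k
    set h := viewsDev A (profile A e l X D) j ρ' with hh
    set o := fun r => sentDev A (profile A e l X D) j ρ' (h r) with hdo
    have h0 : ∀ i, h 0 i = [] := fun _ => rfl
    have hs : ∀ r i, h (r + 1) i = h r i ++ [deliver (o r) i] := fun _ _ => rfl
    exact send_of_active e hk hik (run_length h0 hs t k) ht hXk
      (active_of_proper e h0 hs hk (by omega) ho)
  · simp [message, hk]

theorem sentDev_self_of_proper (hX : ∀ i, X ≤ l i) {t : ℕ} (ht : t ≤ 2 * X + 1)
    (ho : ∀ t' < t, Proper A D (fun r => sentDev A (profile A e l X D) j (ρ x)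
      (viewsDev A (profile A e l X D) j (ρ x) r)) t') :
    sentDev A (profile A e l X D) j (ρ x) (viewsDev A (profile A e l X D) j (ρ x) t) j
      = reply A j ρ x D t := by
  set h := viewsDev A (profile A e l X D) j (ρ x) with hh
  set o := fun r => sentDev A (profile A e l X D) j (ρ x) (h r) with hdo
  have hdel : ∀ t' ≤ t, deliver (o t') j = deliver (message A D t') j := by
    intro t' ht'
    funext k
    unfold deliver
    split_ifs with hk
    · rfl
    · exact sentDev_of_proper hX (ht'.trans ht) (fun t'' ht'' => ho t'' (ht''.trans_le ht')) hk
        (Ne.symm hk)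
  have hview : h t j ++ [deliver (sent A (profile A e l X D) (h t)) j]
      = honestView A j D (t + 1) := by
    have h1 : deliver (sent A (profile A e l X D) (h t)) j = deliver (o t) j := by
      funext k
      unfold deliver
      split_ifs with hk
      · rfl
      · simp [hdo, sentDev, Function.update_of_ne hk]
    rw [h1, run_eq_map (h := h) (o := o) (fun _ => rfl) (fun _ _ => rfl), honestView,
      List.range_succ, List.map_append, List.map_singleton, hdel t le_rfl]
    congr 1
    refine List.map_congr_left fun t' ht' => hdel t' (List.mem_range.1 ht').le
  unfold sentDev
  rw [Function.update_self, hview]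
  rfl

/-- Without lies, all messages are proper. -/
theorem proper_of_not_lie (hX : ∀ i, X ≤ l i) {T : ℕ} (hT : T ≤ 2 * X + 2)
    (hlie : ∀ t < T, ∀ i, ¬ Lie A j ρ x D t i) :
    ∀ t < T, Proper A D (fun r => sentDev A (profile A e l X D) j (ρ x)
      (viewsDev A (profile A e l X D) j (ρ x) r)) t := by
  intro t
  induction t using Nat.strong_induction_on with
  | _ t ih =>
    intro ht k hk i hi hik hidle
    have ho := fun t' (ht' : t' < t) => ih t' ht' (ht'.trans ht)
    by_cases hkj : k = j
    · subst hkj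
      have hself := sentDev_self_of_proper hX (by omega) ho
      by_contra hne
      refine hne (congrFun hself i |>.trans ?_)
      by_contra hne
      exact hlie t ht i ⟨hi, hik, hidle, hne⟩
    · exact sentDev_of_proper hX (by omega) ho hkj hik

/-- If there is no lie up to the end of the definitive iteration, then all other players learn the
secret. -/
theorem learnersDev_of_not_lie [Fact (1 < d)] (hX : ∀ i, X ≤ l i) (hA : 3 ≤ A.card)
    (hlie : ∀ t ≤ 2 * X + 1, ∀ i, ¬ Lie A j ρ x D t i) :
    learnersDev A (profile A e l X D) j (ρ x) (e + iterVal A D X) = A ∨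
      learnersDev A (profile A e l X D) j (ρ x) (e + iterVal A D X) = A.erase j := by
  refine learnersDev_eq fun i hi hij => ?_
  obtain ⟨k, hk, hkij⟩ : ∃ k ∈ A, k ∉ ({i, j} : Finset (Fin n)) := by
    by_contra! h
    have := Finset.card_le_card (s := A) (t := {i, j}) h
    have := Finset.card_le_two (a := i) (b := j)
    omega
  simp only [Finset.mem_insert, Finset.mem_singleton, not_or] at hkij
  obtain ⟨r, _, h1, h2⟩ := learns_of_proper e (h := viewsDev A (profile A e l X D) j (ρ x))
    (o := fun r => sentDev A (profile A e l X D) j (ρ x)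
      (viewsDev A (profile A e l X D) j (ρ x) r)) (fun _ => rfl) (fun _ _ => rfl) hX
    (proper_of_not_lie hX le_rfl fun t ht => hlie t (by omega)) hi hk hkij.1
    (by simp [sentDev, Function.update_of_ne hkij.2, sent, hk])
  exact ⟨r, h1, h2⟩

end Run

/-- The pieces of a player to whom `j` has lied, for steps after the lie, do not influence the
run, unless the tag of the lie has been guessed. -/
theorem viewsDev_pieceShift (hX : ∀ i, X ≤ l i) {t : ℕ} {i : Fin n} (ht : t ≤ 2 * X + 1)
    (hl : FirstLie A j ρ x D t i) (hj : j ∈ A)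
    (hforge : ∀ y, reply A j ρ x D t i ≠ encode (y, (D t).2 j i y)) {u : ℕ} (hu : t < u) (g : S)
    (r : ℕ) : viewsDev A (profile A e l X D) j (ρ x) r =
      viewsDev A (profile A e l X fun t => D t + pieceShift u i g t) j (ρ x) r := by
  refine viewsDev_congr (fun r k hkj => ?_) r
  by_cases hki : k = i
  · subst hki
    set h := viewsDev A (profile A e l X D) j (ρ x) with hh
    set o := fun r => sentDev A (profile A e l X D) j (ρ x) (h r) with hdo
    have hlen : (h r k).length = r :=
      run_length (h := h) (o := o) (fun _ => rfl) (fun _ _ => rfl) r k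
    set D' : ℕ → StepData n d S := fun t => D t + pieceShift u k g t with hD'
    have hkey : (mkShare e (l k) X D' k).key = (mkShare e (l k) X D k).key := by
      funext t' k'
      simp only [mkShare, hD']
      split_ifs
      · by_cases htu : t' = u <;> simp [pieceShift, htu]
      · rfl
    have hlast : (mkShare e (l k) X D' k).last = (mkShare e (l k) X D k).last := rfl
    have hact : Active A (mkShare e (l k) X D' k) k (h r k) ↔
        Active A (mkShare e (l k) X D k) k (h r k) := by
      unfold Active Valid
      rw [hkey, hlast]
    funext i'
    simp only [profile, strategy]
    rw [hlen]
    by_cases hc : Active A (mkShare e (l k) X D k) k (h r k) ∧ ¬ Idle r k ∧ i' ∈ A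
    · rw [if_pos hc, if_pos ⟨hact.2 hc.1, hc.2⟩]
      have hru : r ≤ t := by
        by_contra hlt
        rw [not_le] at hlt
        have h1 := hc.1.2 t (by rw [hlen]; exact hlt) j hj (Ne.symm hkj) hl.1.2.2.1
        rw [run_getD (h := h) (o := o) (fun _ => rfl) (fun _ _ => rfl) hlt, deliver,
          if_neg (Ne.symm hkj)] at h1
        have h2 : o t j = reply A j ρ x D t := sentDev_self_of_proper hX ht
          (proper_of_not_lie hX (by omega) hl.2.1)
        rw [h2] at h1
        obtain ⟨y, hy⟩ := h1
        have hXk := hX k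
        have htl : t ≤ 2 * l k + 1 := by omega
        simp only [mkShare, htl, if_true] at hy
        exact hforge y hy
      have hDr : D' r = D r := by
        have : r ≠ u := by omega
        simp [hD', pieceShift, this]
      simp only [mkShare, hDr]
    · rw [if_neg hc, if_neg fun h => hc ⟨hact.1 h.1, h.2⟩]
  · simp only [profile, mkShare_add_pieceShift _ _ _ _ _ hki]

end Deviation

/-! ### The success of a lie: guessed tags and withheld pieces -/

section Cheating

variable {n d : ℕ} {S : Type} [AddCommGroup S]

/-- The step data that add `g` to the tag of the message `y` from `j` to `i` in step `u`. -/
def keyShift [DecidableEq S] (u : ℕ) (j i : Fin n) (y : S) (g : ZMod d) (t : ℕ) :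
    StepData n d S :=
  if t = u then (0, Pi.single j (Pi.single i (Pi.single y g))) else 0

theorem dat_translate_eq {b : ℕ → StepData n d S} {ω : Coins n d S}
    (hb : ∀ t, numSteps ω.1 ≤ t → b t = 0) : dat (translate b ω) = fun t => dat ω t + b t :=
  funext (dat_translate hb)

/-- The share of player `j`, as a function of the public element and of the dealer's coins. -/
noncomputable def shareOf (j : Fin n) (a : S × Coins n d S) : Share n d S :=
  mkShare a.1 (lastIter a.2.1 j) (stopIter a.2.1) (dat a.2) j

/-- Translate the step data, with the same public element. -/
def translateSnd (b : ℕ → StepData n d S) (a : S × Coins n d S) : S × Coins n d S :=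
  (a.1, translate b a.2)

theorem translateSnd_zero {b : ℕ → StepData n d S} (hb : b = 0) (a : S × Coins n d S) :
    translateSnd b a = a := by
  subst hb
  unfold translateSnd
  rw [translate_zero]

theorem translateSnd_translateSnd {b b' c : ℕ → StepData n d S} (h : b + b' = c)
    (a : S × Coins n d S) : translateSnd b (translateSnd b' a) = translateSnd c a := by
  subst h
  unfold translateSnd
  rw [translate_translate]

theorem keyShift_zero [DecidableEq S] (u : ℕ) (j i : Fin n) (y : S) :
    (keyShift u j i y 0 : ℕ → StepData n d S) = 0 := by
  funext t
  unfold keyShift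
  split_ifs <;> simp

theorem keyShift_add [DecidableEq S] (u : ℕ) (j i : Fin n) (y : S) (g g' : ZMod d) :
    (keyShift u j i y g + keyShift u j i y g' : ℕ → StepData n d S)
      = keyShift u j i y (g + g') := by
  funext t
  simp only [Pi.add_apply, keyShift]
  split_ifs
  · rw [Prod.mk_add_mk, ← Pi.single_add, ← Pi.single_add, ← Pi.single_add, add_zero]
  · simp

theorem pieceShift_zero (u : ℕ) (i : Fin n) : (pieceShift u i 0 : ℕ → StepData n d S) = 0 := by
  funext t
  unfold pieceShift
  split_ifs <;> simp

theorem pieceShift_add (u : ℕ) (i : Fin n) (g g' : S) :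
    (pieceShift u i g + pieceShift u i g' : ℕ → StepData n d S) = pieceShift u i (g + g') := by
  funext t
  simp only [Pi.add_apply, pieceShift]
  split_ifs
  · rw [Prod.mk_add_mk, ← Pi.single_add, add_zero]
  · simp

variable [Fintype S] [DecidableEq S] [NeZero d]

/-- The joint law of the public element and of the dealer's coins. -/
noncomputable def pubLaw (n d : ℕ) (S : Type) [AddCommGroup S] [Fintype S] [DecidableEq S]
    [NeZero d] : PMF (S × Coins n d S) :=
  prodLaw (PMF.uniformOfFintype S) (coinLaw n d S)

theorem pubLaw_translateSnd (b : ℕ → StepData n d S) (a : S × Coins n d S) :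
    pubLaw n d S (translateSnd b a) = pubLaw n d S a := by
  obtain ⟨e, ω⟩ := a
  unfold pubLaw translateSnd
  rw [prodLaw_apply, prodLaw_apply, coinLaw_translate]

variable (A : Finset (Fin n)) (j : Fin n) (ρ : Share n d S → Strategy n S)

/-- The event that the first lie of player `j` happens up to the end of the definitive iteration,
and is the message to player `i` in step `t`. -/
def lieEvent (c : ℕ × Fin n) : Set (S × Coins n d S) :=
  {a | c.1 ≤ 2 * stopIter a.2.1 + 1 ∧ FirstLie A j ρ (shareOf j a) (dat a.2) c.1 c.2}

/-- The event that the deviating player `j` learns the secret. -/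
def winEvent : Set (S × Coins n d S) :=
  {a | j ∈ learnersDev A (profile A a.1 (lastIter a.2.1) (stopIter a.2.1) (dat a.2)) j
    (ρ (shareOf j a)) (a.1 + iterVal A (dat a.2) (stopIter a.2.1))}

/-- The event that the message of player `j` to player `i` in step `t` carries a valid tag. -/
def tagEvent (c : ℕ × Fin n) : Set (S × Coins n d S) :=
  {a | ∃ y, reply A j ρ (shareOf j a) (dat a.2) c.1 c.2 = encode (y, (dat a.2 c.1).2 j c.2 y)}

/-- The event that step `t` belongs to the definitive iteration, and that `j` is not the player who
is idle in that iteration. -/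
def stopEvent (t : ℕ) : Set (S × Coins n d S) :=
  {a | stopIter a.2.1 = t / 2 ∧ t / 2 % n ≠ j}

variable {A j ρ}

/-- A lie carries a valid tag with probability at most `1 / d`: player `j` does not know the tags of
the messages that it ought not to send. -/
theorem tagEvent_le [NeZero n] (hj : j ∈ A) (c : ℕ × Fin n) :
    ∑' a, (tagEvent A j ρ c ∩ lieEvent A j ρ c).indicator (pubLaw n d S) a
      ≤ (d : ℝ≥0∞)⁻¹ * ∑' a, (lieEvent A j ρ c).indicator (pubLaw n d S) a := by
  obtain ⟨t, i⟩ := c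
  set y : S × Coins n d S → S := fun a =>
    (decode (S × ZMod d) (reply A j ρ (shareOf j a) (dat a.2) t i)).1 with hy
  -- A lie with the right piece carries an invalid tag, so it does no harm to exclude this case; the
  -- tag of any other message `y a` can be varied without a trace in the view of player `j`.
  set D : Set (S × Coins n d S) := lieEvent A j ρ (t, i) ∩ {a | y a ≠ (dat a.2 t).1 j} with hD
  set m : ZMod d → S × Coins n d S → S × Coins n d S := fun g a =>
    translateSnd (keyShift t j i (y a) g) a with hm
  have hdat : ∀ a ∈ D, ∀ g, dat (m g a).2 = fun t' => dat a.2 t' + keyShift t j i (y a) g t' := by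
    intro a ha g
    refine dat_translate_eq fun t' ht' => if_neg ?_
    have h1 := stopIter_lt_numSteps a.2.1
    have h2 : t ≤ 2 * stopIter a.2.1 + 1 := ha.1.1
    omega
  have hfst : ∀ a ∈ D, ∀ g t', (dat (m g a).2 t').1 = (dat a.2 t').1 := by
    intro a ha g t'
    rw [hdat a ha]
    simp only [keyShift]
    split_ifs <;> simp
  have hother : ∀ a ∈ D, ∀ g t' k k', k ≠ j → (dat (m g a).2 t').2 k k' = (dat a.2 t').2 k k' := by
    intro a ha g t' k k' hk
    rw [hdat a ha]
    simp only [keyShift]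
    split_ifs <;> simp [hk]
  have hown : ∀ a ∈ D, ∀ g t' k,
      (dat (m g a).2 t').2 j k ((dat a.2 t').1 j) = (dat a.2 t').2 j k ((dat a.2 t').1 j) := by
    intro a ha g t' k
    rw [hdat a ha]
    simp only [keyShift]
    split_ifs with ht
    · subst ht
      have h1 : y a ≠ (dat a.2 t').1 j := ha.2
      by_cases hk : k = i
      · subst hk
        simp [Ne.symm h1]
      · simp [hk]
    · simp
  have hshare : ∀ a ∈ D, ∀ g, shareOf j (m g a) = shareOf j a := by
    intro a ha g
    have hij : i ≠ j := ha.1.2.1.2.1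
    unfold shareOf mkShare
    ext1
    · rfl
    · rfl
    · funext t'
      simp only [hfst a ha]
      rfl
    · funext t' k
      simp only [hfst a ha, hown a ha]
      rfl
    · funext t' k
      have h1 : (dat (m g a).2 t').2 k j = (dat a.2 t').2 k j := by
        by_cases hk : k = j
        · subst hk
          rw [hdat a ha]
          simp only [keyShift]
          split_ifs <;> simp [Ne.symm hij]
        · exact hother a ha g t' k j hk
      simp only [h1]
      rfl
  have hto : ∀ a ∈ D, ∀ g, ∀ t' ≤ t, ∀ k, k ≠ j →
      message A (dat (m g a).2) t' k j = message A (dat a.2) t' k j := fun a ha g t' _ k hk =>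
    message_congr (by rw [hfst a ha]) (by rw [hother a ha g t' k j hk])
  have hfrom : ∀ a ∈ D, ∀ g, ∀ t' ≤ t, ∀ k, k ≠ j →
      message A (dat (m g a).2) t' j k = message A (dat a.2) t' j k := fun a ha g t' _ k _ =>
    message_congr (by rw [hfst a ha]) (by rw [hfst a ha, hown a ha g t' k])
  have hreply : ∀ a ∈ D, ∀ g, reply A j ρ (shareOf j (m g a)) (dat (m g a).2) t
      = reply A j ρ (shareOf j a) (dat a.2) t := fun a ha g => by
    rw [hshare a ha, reply_congr (hto a ha g)]
  have hym : ∀ a ∈ D, ∀ g, y (m g a) = y a := fun a ha g => by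
    simp only [hy]
    rw [hreply a ha g]
  have hmD : ∀ a ∈ D, ∀ g, m g a ∈ D := by
    intro a ha g
    refine ⟨⟨ha.1.1, ?_⟩, ?_⟩
    · rw [hshare a ha, firstLie_congr (hto a ha g) (hfrom a ha g)]
      exact ha.1.2
    · change y (m g a) ≠ (dat (m g a).2 t).1 j
      rw [hym a ha g, hfst a ha]
      exact ha.2
  refine tsum_indicator_le_inv_mul (pubLaw n d S) (B := tagEvent A j ρ (t, i)) (D' := D)
    (NeZero.ne d) ?_ (fun a ha => ⟨ha.1, ha.2, ?_⟩) Set.inter_subset_left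
  · have h1 := card_mul_tsum_le_of_act (pubLaw n d S) m D (tagEvent A j ρ (t, i))
      (fun a _ => translateSnd_zero (keyShift_zero _ _ _ _) a)
      (fun a ha g g' => ?_) hmD (fun a _ g => pubLaw_translateSnd _ a) fun a ha hB g hg => ?_
    · rwa [ZMod.card] at h1
    · simp only [hm]
      have h2 := hym a ha g'
      simp only [hm] at h2
      rw [h2]
      exact translateSnd_translateSnd (keyShift_add _ _ _ _ _ _) a
    · obtain ⟨z, hz⟩ := hB
      obtain ⟨z', hz'⟩ := hg
      have hyz : y a = z := by
        simp only [hy]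
        rw [hz, decode_encode]
      change reply A j ρ (shareOf j (m g a)) (dat (m g a).2) t i = encode (z', _) at hz'
      change reply A j ρ (shareOf j a) (dat a.2) t i = encode (z, _) at hz
      rw [hreply a ha g, hz] at hz'
      have h2 := encode_injective hz'
      simp only [Prod.mk.injEq] at h2
      obtain ⟨h3, h4⟩ := h2
      rw [← h3, hdat a ha] at h4
      simp [keyShift, hyz] at h4
      exact h4
  · obtain ⟨z, hz⟩ := ha.1
    change reply A j ρ (shareOf j a) (dat a.2) t i = encode (z, _) at hz
    have hyz : y a = z := by
      simp only [hy]
      rw [hz, decode_encode]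
    change y a ≠ (dat a.2 t).1 j
    rw [hyz]
    rintro rfl
    obtain ⟨hi, hij, hidle, hne⟩ := ha.2.2.1
    refine hne (hz.trans ?_)
    simp [message, hj, hi, hidle]

/-- If the lie carries an invalid tag and if player `j` cannot complete the definitive iteration by
itself, then it learns the secret with probability at most `1 / |S|`: the player to whom it has lied
falls silent and withholds a piece. -/
theorem winEvent_le [NeZero n] (hj : j ∈ A) (c : ℕ × Fin n) :
    ∑' a, (winEvent A j ρ ∩ (lieEvent A j ρ c \ (tagEvent A j ρ c ∪ stopEvent j c.1))).indicator
        (pubLaw n d S) a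
      ≤ (Fintype.card S : ℝ≥0∞)⁻¹ * ∑' a, (lieEvent A j ρ c).indicator (pubLaw n d S) a := by
  obtain ⟨t, i⟩ := c
  set D : Set (S × Coins n d S) :=
    lieEvent A j ρ (t, i) \ (tagEvent A j ρ (t, i) ∪ stopEvent j t) with hD
  -- The step in which player `i` withholds a piece: a step of the definitive iteration after the
  -- lie, and one in which `i` is not idle.
  set u : S × Coins n d S → ℕ := fun a =>
    if t / 2 < stopIter a.2.1 then 2 * stopIter a.2.1 else 2 * stopIter a.2.1 + 1 with hu
  set m : S → S × Coins n d S → S × Coins n d S := fun g a =>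
    translateSnd (pieceShift (u a) i g) a with hm
  have hutwo : ∀ a, u a / 2 = stopIter a.2.1 := by
    intro a
    simp only [hu]
    split_ifs <;> omega
  have hut : ∀ a ∈ D, t < u a ∧ ¬ Idle (u a) i := by
    intro a ha
    have h1 : t ≤ 2 * stopIter a.2.1 + 1 := ha.1.1
    have hidle : ¬ Idle t j := ha.1.2.1.2.2.1
    have hij : i ≠ j := ha.1.2.1.2.1
    by_cases hlt : t / 2 < stopIter a.2.1
    · simp only [hu, hlt, if_true]
      exact ⟨by omega, fun h => by have := h.1; omega⟩
    · have h2 : stopIter a.2.1 = t / 2 := by omega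
      have h3 : t / 2 % n = j := by
        by_contra h
        exact ha.2 (Or.inr ⟨h2, h⟩)
      have h4 : t % 2 ≠ 1 := fun h => hidle ⟨h, h3⟩
      simp only [hu, hlt, if_false]
      refine ⟨by omega, fun h => hij (Fin.ext ?_)⟩
      have h5 := h.2
      rw [show (2 * stopIter a.2.1 + 1) / 2 = t / 2 by omega] at h5
      exact h5.symm.trans h3
  have hdat : ∀ a, ∀ g, dat (m g a).2 = fun t' => dat a.2 t' + pieceShift (u a) i g t' := by
    intro a g
    have h1 := stopIter_lt_numSteps a.2.1
    have h2 := hutwo a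
    exact dat_translate_eq (pieceShift_eq_zero (by omega) i g)
  have hshare : ∀ a ∈ D, ∀ g, shareOf j (m g a) = shareOf j a := by
    intro a ha g
    have hij : i ≠ j := ha.1.2.1.2.1
    unfold shareOf
    rw [hdat a g]
    exact mkShare_add_pieceShift _ _ _ _ _ (Ne.symm hij) g
  have hle : ∀ a ∈ D, ∀ g, ∀ t' ≤ t, dat (m g a).2 t' = dat a.2 t' := by
    intro a ha g t' ht'
    have h1 := (hut a ha).1
    have h2 : t' ≠ u a := by omega
    rw [hdat a g]
    simp [pieceShift, h2]
  have hmsg : ∀ a ∈ D, ∀ g, ∀ t' ≤ t, ∀ k k',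
      message A (dat (m g a).2) t' k k' = message A (dat a.2) t' k k' := by
    intro a ha g t' ht' k k'
    unfold message
    rw [hle a ha g t' ht']
  have hreply : ∀ a ∈ D, ∀ g, reply A j ρ (shareOf j (m g a)) (dat (m g a).2) t
      = reply A j ρ (shareOf j a) (dat a.2) t := fun a ha g => by
    rw [hshare a ha, reply_congr fun t' ht' k _ => hmsg a ha g t' ht' k j]
  have hmD : ∀ a ∈ D, ∀ g, m g a ∈ D := by
    intro a ha g
    refine ⟨⟨ha.1.1, ?_⟩, fun h => ha.2 (h.imp ?_ id)⟩
    · rw [hshare a ha, firstLie_congr (fun t' ht' k _ => hmsg a ha g t' ht' k j)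
        fun t' ht' k _ => hmsg a ha g t' ht' j k]
      exact ha.1.2
    · rintro ⟨y, hy⟩
      refine ⟨y, ?_⟩
      rw [hreply a ha g, hle a ha g t le_rfl] at hy
      exact hy
  refine tsum_indicator_le_inv_mul (pubLaw n d S) (B := winEvent A j ρ) (D' := D)
    Fintype.card_ne_zero ?_ subset_rfl Set.sdiff_subset
  refine card_mul_tsum_le_of_act (pubLaw n d S) m D (winEvent A j ρ)
    (fun a _ => translateSnd_zero (pieceShift_zero _ _) a)
    (fun a ha g g' => translateSnd_translateSnd (pieceShift_add _ _ _ _) a) hmD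
    (fun a _ g => pubLaw_translateSnd _ a) fun a ha hB g hg => ?_
  have hX : ∀ k, stopIter a.2.1 ≤ lastIter a.2.1 k := stopIter_le a.2.1
  have hforge : ∀ y, reply A j ρ (shareOf j a) (dat a.2) t i ≠ encode (y, (dat a.2 t).2 j i y) :=
    fun y hy => ha.2 (Or.inl ⟨y, hy⟩)
  have h1 := (mem_learnersDev.1 hB).2
  have h2 := (mem_learnersDev.1 hg).2
  rw [Function.update_self] at h1 h2
  have hval : iterVal A (dat (m g a).2) (stopIter a.2.1)
      = iterVal A (dat a.2) (stopIter a.2.1) + g := by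
    have h3 := iterVal_add_pieceShift (dat a.2) ha.1.2.1.1 (hut a ha).2 g
    rw [hutwo a] at h3
    rw [hdat a g, h3]
  have hview : ∀ r, viewsDev A (profile A a.1 (lastIter a.2.1) (stopIter a.2.1) (dat a.2)) j
      (ρ (shareOf j a)) r = viewsDev A (profile A a.1 (lastIter a.2.1) (stopIter a.2.1)
        (dat (m g a).2)) j (ρ (shareOf j a)) r := by
    intro r
    rw [hdat a g]
    exact viewsDev_pieceShift hX ha.1.1 ha.1.2 hj hforge (hut a ha).1 g r
  rw [hshare a ha g] at h2
  change Learns (ρ (shareOf j a)) (fun r => viewsDev A (profile A a.1 (lastIter a.2.1)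
    (stopIter a.2.1) (dat (m g a).2)) j (ρ (shareOf j a)) r j)
    (a.1 + iterVal A (dat (m g a).2) (stopIter a.2.1)) at h2
  simp_rw [← hview] at h2
  have h4 := h1.unique h2
  rw [hval, ← add_assoc] at h4
  exact (left_eq_add.1 h4)

end Cheating

/-! ### The success of a lie: the hazard rate of the definitive iteration -/

section Truncation

/-- The expectation of a function of the first `L` members of a uniform sequence does not depend on
the length of the sequence. -/
theorem tsum_uniform_zeroExtend {β : Type} [Zero β] [Fintype β] {L N : ℕ} (hLN : L ≤ N)
    (f : (ℕ → β) → ℝ≥0∞) (hf : ∀ D D' : ℕ → β, (∀ t < L, D t = D' t) → f D = f D') :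
    ∑' x, PMF.uniformOfFintype (Fin N → β) x * f (zeroExtend x)
      = ∑' x, PMF.uniformOfFintype (Fin L → β) x * f (zeroExtend x) := by
  obtain ⟨M, rfl⟩ := Nat.exists_eq_add_of_le hLN
  have hcard : ∀ (a : Fin L → β) (b : Fin M → β), PMF.uniformOfFintype (Fin (L + M) → β)
      (Fin.append a b) = PMF.uniformOfFintype (Fin L → β) a *
        PMF.uniformOfFintype (Fin M → β) b := by
    intro a b
    simp only [PMF.uniformOfFintype_apply, Fintype.card_fun, Fintype.card_fin, pow_add,
      Nat.cast_mul]
    refine ENNReal.mul_inv (Or.inr (by simp)) (Or.inr ?_)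
    exact_mod_cast pow_ne_zero _ Fintype.card_ne_zero
  have hext : ∀ (a : Fin L → β) (b : Fin M → β),
      f (zeroExtend (Fin.append a b)) = f (zeroExtend a) := by
    intro a b
    refine hf _ _ fun t ht => ?_
    have h1 : t < L + M := by omega
    simp only [zeroExtend, ht, h1, dif_pos]
    exact Fin.append_left a b ⟨t, ht⟩
  rw [← (Fin.appendEquiv L M).tsum_eq, ENNReal.tsum_prod']
  simp only [Fin.appendEquiv, Equiv.coe_fn_mk, hcard, hext]
  refine tsum_congr fun a => ?_
  calc ∑' b, PMF.uniformOfFintype (Fin L → β) a * PMF.uniformOfFintype (Fin M → β) b *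
        f (zeroExtend a)
      = ∑' b, (PMF.uniformOfFintype (Fin L → β) a * f (zeroExtend a)) *
          PMF.uniformOfFintype (Fin M → β) b := tsum_congr fun b => by ring
    _ = _ := by rw [ENNReal.tsum_mul_left, PMF.tsum_coe, mul_one]

end Truncation

section Hazard

variable {n d : ℕ} {S : Type} [AddCommGroup S]

/-- The step data that subtract one from all tags of player `j` after the definitive iteration `X`
and up to its last iteration `l`. -/
def offsetShift (j : Fin n) (l X : ℕ) (t : ℕ) : StepData n d S :=
  if 2 * X + 1 < t ∧ t ≤ 2 * l + 1 then
    (0, fun k i => if k = j ∧ i ≠ j then fun _ => -1 else 0) else 0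

/-- The share of a player who draws the offset of the tags together with the tags does not depend
on the definitive iteration. -/
theorem mkShare_add_offsetShift (e : S) (l X : ℕ) (D : ℕ → StepData n d S) (j : Fin n) :
    mkShare e l X (fun t => D t + offsetShift j l X t) j = mkShare e l l D j := by
  unfold mkShare
  ext1
  · rfl
  · rfl
  · funext t
    simp only [offsetShift]
    split_ifs <;> simp
  · funext t k
    by_cases h1 : t ≤ 2 * l + 1 ∧ k ≠ j
    · have h2 : ¬ 2 * l + 1 < t := not_lt.2 h1.1
      simp only [h1, and_self, if_true, h2, if_false, offsetShift, ne_eq, not_false_eq_true]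
      by_cases h3 : 2 * X + 1 < t <;> simp [h3, h1.2]
    · simp only [if_neg h1]
  · funext t k
    simp only [offsetShift]
    split_ifs <;> simp

variable [Fintype S] [DecidableEq S] [NeZero d]

theorem tsum_pubLaw (f : S × Coins n d S → ℝ≥0∞) :
    ∑' a, pubLaw n d S a * f a = ∑' G, iidLaw (geomLaw d) n G *
      ∑' e, PMF.uniformOfFintype S e * ∑' x, PMF.uniformOfFintype
        (Fin (numSteps G) → StepData n d S) x * f (e, ⟨G, x⟩) := by
  rw [ENNReal.tsum_prod']
  simp_rw [ENNReal.tsum_sigma', pubLaw, prodLaw_apply, coinLaw_apply]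
  rw [ENNReal.tsum_comm]
  refine tsum_congr fun G => ?_
  rw [← ENNReal.tsum_mul_left]
  refine tsum_congr fun e => ?_
  rw [← mul_assoc, ← ENNReal.tsum_mul_left]
  refine tsum_congr fun x => ?_
  ring

variable (A : Finset (Fin n)) (j : Fin n) (ρ : Share n d S → Strategy n S)

open Classical in
/-- The probability of the first lie `c`, for a player whose last iteration is `l`, if the share of
the player does not contain any information on the definitive iteration. -/
noncomputable def lieProb (c : ℕ × Fin n) (l : ℕ) : ℝ≥0∞ :=
  ∑' e, PMF.uniformOfFintype S e * ∑' x, PMF.uniformOfFintype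
    (Fin (2 * l + 2) → StepData n d S) x *
      if FirstLie A j ρ (mkShare e l l (zeroExtend x) j) (zeroExtend x) c.1 c.2 then 1 else 0

variable {A j ρ}

open Classical in
/-- Up to the end of the definitive iteration, the probability of the first lie depends only on the
last iteration of the deviating player. -/
theorem tsum_lie_eq [NeZero n] {c : ℕ × Fin n} {G : Fin n → ℕ} (hc : c.1 ≤ 2 * stopIter G + 1) :
    ∑' e, PMF.uniformOfFintype S e * ∑' x, PMF.uniformOfFintype
        (Fin (numSteps G) → StepData n d S) x *
          (if FirstLie A j ρ (shareOf j (e, ⟨G, x⟩)) (zeroExtend x) c.1 c.2 then 1 else 0)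
      = lieProb A j ρ c (lastIter G j) := by
  obtain ⟨t, i⟩ := c
  unfold lieProb
  refine tsum_congr fun e => ?_
  congr 1
  set l := lastIter G j with hl
  set X := stopIter G with hX
  have hXl : X ≤ l := stopIter_le G j
  have hlN : 2 * l + 1 < numSteps G := lastIter_lt_numSteps G j
  rw [← tsum_uniform_zeroExtend (N := numSteps G) (by omega)
    (fun D => if FirstLie A j ρ (mkShare e l l D j) D t i then 1 else 0)]
  -- Absorb the offset of the tags after the definitive iteration into the uniform tags.
  · rw [← (Equiv.addRight fun t : Fin (numSteps G) =>
      (offsetShift j l X t : StepData n d S)).tsum_eq]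
    refine tsum_congr fun x => ?_
    rw [PMF.uniformOfFintype_apply, PMF.uniformOfFintype_apply]
    congr 1
    set x' : Fin (numSteps G) → StepData n d S :=
      (Equiv.addRight fun t : Fin (numSteps G) => (offsetShift j l X t : StepData n d S)) x with hx'
    have hext : (zeroExtend x' : ℕ → StepData n d S)
        = fun t => zeroExtend x t + offsetShift j l X t := by
      refine dat_translate_eq (ω := ⟨G, x⟩) fun t ht => if_neg ?_
      change numSteps G ≤ t at ht
      omega
    have hshare : shareOf j (e, (⟨G, x'⟩ : Coins n d S)) = mkShare e l l (zeroExtend x) j := by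
      rw [← mkShare_add_offsetShift e l X, ← hext]
      rfl
    have hle : ∀ t' ≤ t, (zeroExtend x' : ℕ → StepData n d S) t' = zeroExtend x t' := by
      intro t' ht'
      rw [hext]
      have h1 : ¬ 2 * X + 1 < t' := by
        change t ≤ 2 * X + 1 at hc
        omega
      simp [offsetShift, h1]
    have hmsg : ∀ t' ≤ t, ∀ k k', message A (zeroExtend x' : ℕ → StepData n d S) t' k k'
        = message A (zeroExtend x) t' k k' := by
      intro t' ht' k k'
      unfold message
      rw [hle t' ht']
    refine if_congr ?_ rfl rfl
    rw [hshare]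
    exact firstLie_congr (fun t' ht' k _ => hmsg t' ht' k j) fun t' ht' k _ => hmsg t' ht' j k
  · intro D D' hDD
    have hle : ∀ t' ≤ 2 * l + 1, D t' = D' t' := fun t' ht' => hDD t' (by omega)
    have hshare : mkShare e l l D j = mkShare e l l D' j := by
      unfold mkShare
      ext1
      · rfl
      · rfl
      · funext t
        by_cases h : t ≤ 2 * l + 1
        · simp only [h, if_true, hle t h]
        · simp only [h, if_false]
      · funext t k
        by_cases h : t ≤ 2 * l + 1
        · simp only [hle t h]
        · simp only [h, false_and, if_false]
      · funext t k
        by_cases h : t ≤ 2 * l + 1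
        · simp only [h, if_true, hle t h]
        · simp only [h, if_false]
    have hmsg : ∀ t' ≤ t, ∀ k k', message A D t' k k' = message A D' t' k k' := by
      intro t' ht' k k'
      change t ≤ 2 * X + 1 at hc
      unfold message
      rw [hle t' (by omega)]
    refine if_congr ?_ rfl rfl
    rw [hshare]
    exact firstLie_congr (fun t' ht' k _ => hmsg t' ht' k j) fun t' ht' k _ => hmsg t' ht' j k

/-- Player `j` meets the definitive iteration with its first lie with probability at most `1 / d`,
unless it is idle in that iteration: the player who is idle determines, by its geometric random
number, whether the iteration is definitive, and the share of player `j` does not tell. -/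
theorem stopEvent_le [NeZero n] (c : ℕ × Fin n) :
    ∑' a, (stopEvent j c.1 ∩ lieEvent A j ρ c).indicator (pubLaw n d S) a
      ≤ (d : ℝ≥0∞)⁻¹ * ∑' a, (lieEvent A j ρ c).indicator (pubLaw n d S) a := by
  classical
  set r := c.1 / 2 with hr
  by_cases hk : r % n = j
  · have : stopEvent j c.1 ∩ lieEvent A j ρ c = ∅ := by
      ext a
      simp only [Set.mem_inter_iff, Set.mem_empty_iff_false, iff_false, not_and]
      exact fun h => absurd hk h.2
    rw [this]
    simp
  set k : Fin n := ⟨r % n, Nat.mod_lt _ (NeZero.pos n)⟩ with hkdef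
  have hjk : j ≠ k := fun h => hk (by rw [h])
  set b := r / n with hb
  have hrb : r = b * n + k := (Nat.div_add_mod' r n).symm
  -- `Q` does not depend on the random number of `k`; iteration `r` is reached if this number is at
  -- least `b`, and it is definitive if the number equals `b`, provided that the others allow it.
  set Q : (Fin n → ℕ) → ℝ≥0∞ := fun G =>
    if ∀ k', k' ≠ k → r ≤ lastIter G k' then lieProb A j ρ c (lastIter G j) else 0 with hQ
  have hQk : ∀ G x, Q (Function.update G k x) = Q G := by
    intro G x
    have h1 : ∀ k', k' ≠ k → lastIter (Function.update G k x) k' = lastIter G k' := by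
      intro k' hk'
      unfold lastIter
      rw [Function.update_of_ne hk']
    simp only [hQ, h1 j hjk]
    refine if_congr (forall_congr' fun k' => forall_congr' fun hk' => ?_) rfl rfl
    rw [h1 k' hk']
  have hlast : ∀ G : Fin n → ℕ, r ≤ lastIter G k ↔ b ≤ G k := by
    intro G
    unfold lastIter
    rw [hrb]
    constructor
    · intro h
      by_contra hlt
      have h1 : G k + 1 ≤ b := by omega
      have h2 := Nat.mul_le_mul_right n h1
      have h3 := NeZero.pos n
      nlinarith
    · intro h
      have h2 := Nat.mul_le_mul_right n h
      omega
  have hle : ∀ G : Fin n → ℕ, r ≤ stopIter G ↔ b ≤ G k ∧ ∀ k', k' ≠ k → r ≤ lastIter G k' := by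
    intro G
    rw [le_stopIter_iff, ← hlast]
    refine ⟨fun h => ⟨h k, fun k' _ => h k'⟩, fun h k' => ?_⟩
    by_cases hk' : k' = k
    · rw [hk']; exact h.1
    · exact h.2 k' hk'
  have heq : ∀ G : Fin n → ℕ, stopIter G = r ↔ G k = b ∧ ∀ k', k' ≠ k → r ≤ lastIter G k' := by
    intro G
    constructor
    · intro h
      refine ⟨?_, ((hle G).1 h.ge).2⟩
      obtain ⟨k', hk'⟩ := exists_stopIter_eq G
      have h1 : G k' * n + k' = r := hk'.trans h
      have h2 : k' = k := by
        apply Fin.ext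
        change (k' : ℕ) = r % n
        rw [← h1, mul_comm, Nat.mul_add_mod, Nat.mod_eq_of_lt k'.2]
      rw [h2] at h1
      rw [hrb] at h1
      exact Nat.eq_of_mul_eq_mul_right (NeZero.pos n) (by omega)
    · rintro ⟨h1, h2⟩
      refine le_antisymm ?_ ((hle G).2 ⟨h1.ge, h2⟩)
      refine (stopIter_le G k).trans (le_of_eq ?_)
      rw [hrb, ← h1]
      rfl
  have hc : ∀ G : Fin n → ℕ, c.1 ≤ 2 * stopIter G + 1 ↔ r ≤ stopIter G := fun G => by omega
  have hmain : ∀ (W : ℕ → Prop) (E : Set (S × Coins n d S)), (∀ x, W x → b ≤ x) →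
      (∀ a, a ∈ E ↔ W (a.2.1 k) ∧ (∀ k', k' ≠ k → r ≤ lastIter a.2.1 k') ∧
        FirstLie A j ρ (shareOf j a) (dat a.2) c.1 c.2) →
      ∑' a, E.indicator (pubLaw n d S) a = (∑' x, geomLaw d x * if W x then 1 else 0) *
        ∑' G, iidLaw (geomLaw d) n G * Q G := by
    intro W E hW hE
    rw [← tsum_iidLaw_split (geomLaw d) k (fun x => if W x then 1 else 0) Q hQk]
    have h1 : ∀ a, E.indicator (pubLaw n d S) a = pubLaw n d S a * if a ∈ E then 1 else 0 := by
      intro a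
      by_cases ha : a ∈ E <;> simp [ha]
    simp_rw [h1]
    rw [tsum_pubLaw]
    refine tsum_congr fun G => ?_
    congr 1
    by_cases hcase : W (G k) ∧ ∀ k', k' ≠ k → r ≤ lastIter G k'
    · have hmem : ∀ e x, (((e, ⟨G, x⟩) : S × Coins n d S) ∈ E) ↔
          FirstLie A j ρ (shareOf j (e, ⟨G, x⟩)) (zeroExtend x) c.1 c.2 := fun e x =>
        (hE _).trans ⟨fun h => h.2.2, fun h => ⟨hcase.1, hcase.2, h⟩⟩
      simp only [hmem, hQ]
      rw [if_pos hcase.1, if_pos hcase.2, one_mul,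
        tsum_lie_eq ((hc G).2 ((hle G).2 ⟨hW _ hcase.1, hcase.2⟩))]
    · have hmem : ∀ e x, ((e, ⟨G, x⟩) : S × Coins n d S) ∉ E := fun e x h =>
        hcase ⟨((hE _).1 h).1, ((hE _).1 h).2.1⟩
      simp only [hmem, if_false, mul_zero, tsum_zero, hQ]
      rw [not_and_or] at hcase
      rcases hcase with h | h
      · rw [if_neg h, zero_mul]
      · rw [if_neg h, mul_zero]
  rw [hmain (fun x => x = b) _ (fun x hx => hx.ge), hmain (fun x => b ≤ x) _ (fun x hx => hx)]
  · rw [← mul_assoc]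
    refine mul_le_mul_left (le_of_eq ?_) _
    simp only [mul_ite, mul_one, mul_zero]
    rw [tsum_ite_eq, ← geomLaw_hazard, ← mul_assoc,
      ENNReal.inv_mul_cancel (by simpa using NeZero.ne d) (ENNReal.natCast_ne_top d), one_mul]
  · intro a
    rw [← and_assoc, ← hle, ← hc]
    exact Iff.rfl
  · intro a
    rw [← and_assoc, ← heq]
    exact ⟨fun h => ⟨h.1.1, h.2.2⟩, fun h => ⟨⟨h.1, hk⟩, (hc _).2 h.1.ge, h.2⟩⟩

end Hazard

/-! ### The iterated protocol is an equilibrium -/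

section Equilibrium

variable {n d : ℕ} {S : Type} [AddCommGroup S] [Fintype S] [DecidableEq S] [NeZero d]

/-- The secret and the dealer's coins, in terms of the public element and the dealer's coins. -/
theorem map_pubLaw (A : Finset (Fin n)) :
    (pubLaw n d S).map (fun a => (a.1 + iterVal A (dat a.2) (stopIter a.2.1), a.2))
      = prodLaw (PMF.uniformOfFintype S) (coinLaw n d S) := by
  classical
  ext ⟨s, ω⟩
  rw [PMF.map_apply, tsum_eq_single (s - iterVal A (dat ω) (stopIter ω.1), ω), if_pos (by simp)]
  · unfold pubLaw
    rw [prodLaw_apply, prodLaw_apply, PMF.uniformOfFintype_apply, PMF.uniformOfFintype_apply]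
  · rintro ⟨e, ω'⟩ hne
    rw [if_neg]
    intro h
    rw [Prod.mk.injEq] at h
    obtain ⟨h1, rfl⟩ := h
    exact hne (by rw [h1, add_sub_cancel_right])

theorem winEvent_inter_lieEvent_le [NeZero n] {A : Finset (Fin n)} {j : Fin n}
    {ρ : Share n d S → Strategy n S} (hj : j ∈ A) (c : ℕ × Fin n) :
    ∑' a, (winEvent A j ρ ∩ lieEvent A j ρ c).indicator (pubLaw n d S) a ≤
      ((d : ℝ≥0∞)⁻¹ + ((d : ℝ≥0∞)⁻¹ + (Fintype.card S : ℝ≥0∞)⁻¹)) *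
        ∑' a, (lieEvent A j ρ c).indicator (pubLaw n d S) a := by
  refine (tsum_indicator_mono _ (E := (tagEvent A j ρ c ∩ lieEvent A j ρ c) ∪
    ((stopEvent j c.1 ∩ lieEvent A j ρ c) ∪
      (winEvent A j ρ ∩ (lieEvent A j ρ c \ (tagEvent A j ρ c ∪ stopEvent j c.1))))) ?_).trans ?_
  · rintro a ⟨hw, hl⟩
    by_cases h1 : a ∈ tagEvent A j ρ c
    · exact Or.inl ⟨h1, hl⟩
    · by_cases h2 : a ∈ stopEvent j c.1
      · exact Or.inr (Or.inl ⟨h2, hl⟩)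
      · exact Or.inr (Or.inr ⟨hw, hl, fun h => h.elim h1 h2⟩)
  · refine (tsum_indicator_union_le _ _ _).trans ?_
    rw [add_mul, add_mul]
    exact add_le_add (tagEvent_le hj c) ((tsum_indicator_union_le _ _ _).trans
      (add_le_add (stopEvent_le c) (winEvent_le hj c)))

/-- With at least three active players, the iterated protocol is an equilibrium. -/
theorem protocol_isNash [NeZero n] [Fact (1 < d)] {A : Finset (Fin n)} (hA : 3 ≤ A.card)
    {u : Fin n → Finset (Fin n) → ℝ} (hu : LearningPreferring u) {U : ℝ}
    (hU : ∀ j, (bestLearning u j - bestNotLearning u j) /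
      (worstLearning u j - bestNotLearning u j) ≤ U)
    (hd : 2 / (d : ℝ) + 1 / (Fintype.card S : ℝ) ≤ 1 / U) :
    (protocol (S := S) d A).IsNash A Set.univ (protocol d A).exists_mem_univ u := by
  intro j hj ρ₀
  rw [Protocol.expUtility_outcome _ (allLearn (by omega)), Protocol.outcomeDev_eq_map]
  let ρ : Share n d S → Strategy n S := ρ₀
  set f : S × Coins n d S → Finset (Fin n) := fun a =>
    learnersDev A (profile A a.1 (lastIter a.2.1) (stopIter a.2.1) (dat a.2)) j
      (ρ (shareOf j a)) (a.1 + iterVal A (dat a.2) (stopIter a.2.1)) with hf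
  have hlaw : (prodLaw (PMF.uniformOfFintype S) (protocol (S := S) d A).coins).map (fun x =>
      learnersDev A ((protocol d A).strat A x.1 x.2) j (ρ₀ ((protocol d A).deal x.1 x.2 j)) x.1)
      = (pubLaw n d S).map f := by
    change (prodLaw (PMF.uniformOfFintype S) (coinLaw n d S)).map (fun x =>
      learnersDev A (profile A (x.1 - iterVal A (dat x.2) (stopIter x.2.1)) (lastIter x.2.1)
        (stopIter x.2.1) (dat x.2)) j (ρ (mkShare (x.1 - iterVal A (dat x.2) (stopIter x.2.1))
          (lastIter x.2.1 j) (stopIter x.2.1) (dat x.2) j)) x.1) = _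
    rw [← map_pubLaw A, PMF.map_comp]
    congr 1
    funext a
    simp only [Function.comp, add_sub_cancel_right]
    rfl
  rw [hlaw]
  refine expUtility_map_le (pubLaw n d S) f (⋃ c, lieEvent A j ρ c) hj hu (hU j)
    (fun a ha => ?_) ?_
  · refine learnersDev_of_not_lie (stopIter_le a.2.1) hA fun t ht i hl => ha ?_
    obtain ⟨t', ht', i', h⟩ := exists_firstLie ht hl
    exact Set.mem_iUnion.2 ⟨(t', i'), ht', h⟩
  · refine (tsum_inter_iUnion_le (pubLaw n d S) (winEvent A j ρ) (lieEvent A j ρ)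
      (fun a c c' h h' => Prod.ext (h.2.unique h'.2).1 (h.2.unique h'.2).2) _
      (winEvent_inter_lieEvent_le hj)).trans ?_
    gcongr
    have hdpos : (0 : ℝ) < d := by exact_mod_cast NeZero.pos d
    have hSpos : (0 : ℝ) < Fintype.card S := by exact_mod_cast Fintype.card_pos
    have h1 : ((d : ℝ≥0∞))⁻¹ = ENNReal.ofReal ((d : ℝ)⁻¹) := by
      rw [ENNReal.ofReal_inv_of_pos hdpos, ENNReal.ofReal_natCast]
    have h2 : ((Fintype.card S : ℝ≥0∞))⁻¹ = ENNReal.ofReal ((Fintype.card S : ℝ)⁻¹) := by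
      rw [ENNReal.ofReal_inv_of_pos hSpos, ENNReal.ofReal_natCast]
    rw [h1, h2, ← ENNReal.ofReal_add (by positivity) (by positivity),
      ← ENNReal.ofReal_add (by positivity) (by positivity)]
    refine ENNReal.ofReal_le_ofReal (le_trans (le_of_eq ?_) hd)
    ring

theorem protocol_handles [NeZero n] [Fact (1 < d)] {A : Finset (Fin n)} (hA : 2 ≤ A.card)
    {U C thr : ℝ} (hthr : thr ≤ (A.card : ℝ) / n)
    (hd : 1 ≤ U → 2 / (d : ℝ) + 1 / (Fintype.card S : ℝ) ≤ 1 / U)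
    (hbits : (((n * (Nat.log 2 (Fintype.card (S × ZMod d)) + 1) * 2) * (d * n) +
        n * (Nat.log 2 (Fintype.card (S × ZMod d)) + 1) * 3 : ℕ) : ℝ) ≤ C * Real.log n ^ 2)
    (hlat : ((2 * (d * n) + 3 : ℕ) : ℝ) ≤ C * Real.log n) :
    (protocol (S := S) d A).Handles A U C thr where
  nash h u hu hU := by
    refine protocol_isNash ?_ hu hU (hd (hu.one_le_of_ratio_le (hU 0)))
    rcases h with h | h
    · omega
    · exact absurd h (not_lt.2 hthr)
  learn _ := allLearn hA
  bits s i hi := (expBits_le hA s hi).trans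
    (by rw [← ENNReal.ofReal_natCast]; exact ENNReal.ofReal_le_ofReal hbits)
  latency s := (expLatency_le hA s).trans
    (by rw [← ENNReal.ofReal_natCast]; exact ENNReal.ofReal_le_ofReal hlat)

end Equilibrium

end Iterated

/-! ### The choice of the protocol and of the constants -/

section Existence

theorem natLog_two_le {x : ℕ} (hx : x ≠ 0) : (Nat.log 2 x : ℝ) ≤ 2 * Real.log x := by
  have h1 : ((2 ^ Nat.log 2 x : ℕ) : ℝ) ≤ x := by exact_mod_cast Nat.pow_log_le_self 2 hx
  have h2 := Real.log_le_log (by positivity) h1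
  rw [Nat.cast_pow, Real.log_pow, Nat.cast_ofNat] at h2
  have h3 := Real.log_two_gt_d9
  have h4 : (0 : ℝ) ≤ Nat.log 2 x := Nat.cast_nonneg _
  nlinarith

theorem one_le_log {n : ℕ} (hn : 3 ≤ n) : 1 ≤ Real.log n := by
  rw [Real.le_log_iff_exp_le (by positivity)]
  have h1 := Real.exp_one_lt_d9
  have h2 : (3 : ℝ) ≤ n := by exact_mod_cast hn
  linarith

/-- The parameter `d` of the iterated protocol depends only on the bound for the utility ratio. -/
theorem exists_iterated_parameter (U : ℝ) : ∃ d : ℕ, 1 < d ∧ ∀ N : ℕ, U < N → 1 ≤ U →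
    2 / (d : ℝ) + 1 / (N : ℝ) ≤ 1 / U := by
  by_cases hU : 1 ≤ U
  · have hM : U < (⌊U⌋₊ + 1 : ℕ) := by exact_mod_cast Nat.lt_floor_add_one U
    set M := ⌊U⌋₊ + 1 with hMdef
    have hδ : 0 < 1 / U - 1 / (M : ℝ) := sub_pos.2 (one_div_lt_one_div_of_lt (by linarith) hM)
    set δ := 1 / U - 1 / (M : ℝ) with hδdef
    refine ⟨max 2 ⌈2 / δ⌉₊, lt_of_lt_of_le one_lt_two (le_max_left _ _), fun N hN _ => ?_⟩
    have h1 : 2 / δ ≤ (max 2 ⌈2 / δ⌉₊ : ℕ) :=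
      (Nat.le_ceil _).trans (by exact_mod_cast le_max_right _ _)
    have hd : (0 : ℝ) < (max 2 ⌈2 / δ⌉₊ : ℕ) := lt_of_lt_of_le (by positivity) h1
    have h2 : 2 / ((max 2 ⌈2 / δ⌉₊ : ℕ) : ℝ) ≤ δ := by
      rw [div_le_iff₀ hδ] at h1
      rw [div_le_iff₀ hd]
      linarith
    have h3 : M ≤ N := Nat.succ_le_of_lt ((Nat.floor_lt (by linarith)).2 hN)
    have h4 : 1 / (N : ℝ) ≤ 1 / (M : ℝ) :=
      one_div_le_one_div_of_le (by linarith) (by exact_mod_cast h3)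
    linarith
  · exact ⟨2, one_lt_two, fun _ _ h => absurd h hU⟩

/-- For every `n` there is a protocol that deals with all active sets. -/
theorem exists_protocol (lam τ U B : ℝ) (hlam : 0 < lam) :
    ∃ C : ℝ, ∀ n : ℕ, 3 ≤ n → ∀ (S : Type) [Fintype S] [Nonempty S],
      U < (Fintype.card S : ℝ) → (Fintype.card S : ℝ) ≤ B * n →
      ∃ P : Protocol n S, (∀ A, P.Handles A U C (τ + lam)) ∧
        ∀ A : Finset (Fin n), (A.card : ℝ) / n ≤ τ - lam → P.HiddenFrom A := by
  classical
  obtain ⟨d, hd1, hd⟩ := exists_iterated_parameter U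
  have : Fact (1 < d) := ⟨hd1⟩
  have : NeZero d := ⟨by omega⟩
  set K := ⌈3 / lam⌉₊ with hK
  set b := |Real.log B| + 1 with hb
  have hb0 : 0 ≤ b := by positivity
  set N₀ := ⌈3 / (2 * lam)⌉₊ with hN₀
  set M₀ := ⌈B * N₀ * d⌉₊ + 1 with hM₀
  set C₁ : ℝ := 3 * (K * (2 * 2 ^ K * b + 1)) with hC₁
  set C₂ : ℕ := (N₀ * M₀ * 2) * (d * N₀) + N₀ * M₀ * 3 with hC₂
  set C₃ : ℕ := 2 * (d * N₀) + 3 with hC₃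
  have hC₁0 : 0 ≤ C₁ := by positivity
  have hC₂0 : (0 : ℝ) ≤ C₂ := Nat.cast_nonneg _
  have hC₃0 : (3 : ℝ) ≤ C₃ := by exact_mod_cast Nat.le_add_left _ _
  refine ⟨C₁ + C₂ + C₃, fun n hn S _ _ hUS hSB => ?_⟩
  have hn0 : (0 : ℝ) < n := by positivity
  have : NeZero n := ⟨by omega⟩
  have hlog := one_le_log hn
  set c := Fintype.card S with hc
  have hc0 : c ≠ 0 := Fintype.card_ne_zero
  have : NeZero c := ⟨hc0⟩
  let φ : S ≃ ZMod c := Fintype.equivOfCardEq (ZMod.card c).symm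
  let : AddCommGroup S := φ.addCommGroup
  by_cases hT : (τ - lam) * n < 1
  · refine ⟨plainProtocol n S, fun A => plainProtocol_handles A _ _ _, fun A hA => ?_⟩
    rw [div_le_iff₀ hn0] at hA
    have h1 : (A.card : ℝ) < 1 := lt_of_le_of_lt hA hT
    have h2 : A.card = 0 := by
      have : A.card < 1 := by exact_mod_cast h1
      omega
    rw [Finset.card_eq_zero.1 h2]
    exact plainProtocol_hiddenFrom_empty
  rw [not_lt] at hT
  -- Singletons are among the sets that must not know anything about the secret.
  have hsmall : ∀ j : Fin n, ((({j} : Finset (Fin n)).card : ℝ)) / n ≤ τ - lam := by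
    intro j
    rw [div_le_iff₀ hn0, Finset.card_singleton, Nat.cast_one]
    exact hT
  suffices h : ∀ A : Finset (Fin n), ∃ P : Protocol n S,
      P.Handles A U (C₁ + C₂ + C₃) (τ + lam) ∧
        ∀ A' : Finset (Fin n), (A'.card : ℝ) / n ≤ τ - lam → P.HiddenFrom A' by
    choose I hI hid using h
    exact Protocol.exists_handles_all hsmall I hI hid
  intro A
  rcases lt_or_ge ((A.card : ℝ) / n) (τ + lam) with hA | hA
  · exact ⟨guessProtocol n S, guessProtocol_handles hA, fun A' _ => guessProtocol_hiddenFrom A'⟩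
  have hA' : 1 + 2 * lam * n ≤ A.card := by
    have h1 := hA
    rw [le_div_iff₀ hn0] at h1
    linarith
  have hdiff : ∀ A' : Finset (Fin n), (A'.card : ℝ) / n ≤ τ - lam →
      2 * lam * n ≤ (A \ A').card := by
    intro A' h
    rw [div_le_iff₀ hn0] at h
    rw [le_div_iff₀ hn0] at hA
    have h1 : (A.card : ℝ) ≤ (A \ A').card + A'.card := by
      exact_mod_cast Finset.card_le_card_sdiff_add_card
    linarith
  have hAn : A.card ≤ n := by simpa using Finset.card_le_univ A
  have hcard2 : 2 ≤ A.card := by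
    have h1 : (1 : ℝ) < A.card := by
      have : 0 < 2 * lam * n := by positivity
      linarith
    exact_mod_cast h1
  have hlog0 : 0 ≤ Real.log n := by linarith
  have hsq : Real.log n ≤ Real.log n ^ 2 := by nlinarith
  by_cases hlarge : 3 ≤ 2 * lam * n
  · set q := ⌊2 * lam * n / 3⌋₊ with hq
    have hq1 : 1 ≤ q := Nat.le_floor (by push_cast; linarith)
    have hqle : (q : ℝ) ≤ 2 * lam * n / 3 := Nat.floor_le (by positivity)
    set L := Nat.log 2 q with hL
    have hLq : ((2 ^ L : ℕ) : ℝ) ≤ q := by exact_mod_cast Nat.pow_log_le_self 2 (by omega)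
    have hqL : q + 1 ≤ 2 * 2 ^ L := by
      have := Nat.lt_pow_succ_log_self (b := 2) one_lt_two q
      rw [← hL, pow_succ] at this
      omega
    have h1 : 3 * 2 ^ L ≤ A.card := by
      have : ((3 * 2 ^ L : ℕ) : ℝ) ≤ A.card := by
        push_cast at hLq ⊢
        linarith
      exact_mod_cast this
    have h2 : A.card ≤ K * 2 ^ L := by
      have h3 : 2 * lam * n / 3 < q + 1 := Nat.lt_floor_add_one _
      have h4 : ((q + 1 : ℕ) : ℝ) ≤ ((2 * 2 ^ L : ℕ) : ℝ) := by exact_mod_cast hqL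
      have h5 : 3 / lam ≤ K := Nat.le_ceil _
      have h6 : (n : ℝ) ≤ ((K * 2 ^ L : ℕ) : ℝ) := by
        push_cast at h4 ⊢
        have h7 : lam * n ≤ 3 * 2 ^ L := by linarith
        have h8 : (n : ℝ) ≤ 3 / lam * 2 ^ L := by
          rw [div_mul_eq_mul_div, le_div_iff₀ hlam]
          linarith
        exact h8.trans (by gcongr)
      exact hAn.trans (by exact_mod_cast h6)
    obtain ⟨β⟩ := Blocks.exists_of_card h1 h2
    have hLn : ((L + 1 : ℕ) : ℝ) ≤ 3 * Real.log n := by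
      have h3 : L ≤ Nat.log 2 n := by
        refine Nat.le_log_of_pow_le one_lt_two ?_
        omega
      have h4 : (L : ℝ) ≤ Nat.log 2 n := by exact_mod_cast h3
      have h5 := natLog_two_le (x := n) (by omega)
      push_cast
      linarith
    have hbit : ((Nat.log 2 (Fintype.card (Finset (Fin K) → S)) + 1 : ℕ) : ℝ)
        ≤ (2 * 2 ^ K * b + 1) * Real.log n := by
      have hcardfun : Fintype.card (Finset (Fin K) → S) = c ^ 2 ^ K := by
        simp [hc]
      have h3 := natLog_two_le (x := Fintype.card (Finset (Fin K) → S)) Fintype.card_ne_zero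
      rw [hcardfun, Nat.cast_pow, Real.log_pow] at h3
      have hc1 : (1 : ℝ) ≤ c := by exact_mod_cast Nat.one_le_iff_ne_zero.2 hc0
      have hB : 0 < B := by
        by_contra hB
        have : B * n ≤ 0 := mul_nonpos_of_nonpos_of_nonneg (not_lt.1 hB) hn0.le
        linarith
      have h4 : Real.log c ≤ b * Real.log n := by
        calc Real.log c ≤ Real.log (B * n) := Real.log_le_log (by linarith) hSB
          _ = Real.log B + Real.log n := Real.log_mul hB.ne' hn0.ne'
          _ ≤ |Real.log B| * Real.log n + Real.log n := by
              have := le_abs_self (Real.log B)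
              have := abs_nonneg (Real.log B)
              nlinarith
          _ = b * Real.log n := by rw [hb]; ring
      rw [hcardfun]
      push_cast at h3 ⊢
      have h5 : (2 : ℝ) * (2 ^ K * Real.log c) ≤ 2 * (2 ^ K * (b * Real.log n)) := by gcongr
      linarith
    refine ⟨β.protocol S, β.protocol_handles hcard2 ?_ ?_, fun A'' h => β.protocol_hiddenFrom ?_⟩
    · rw [Nat.cast_mul, Nat.cast_mul]
      calc ((L + 1 : ℕ) : ℝ) * (K * ((Nat.log 2 (Fintype.card (Finset (Fin K) → S)) + 1 : ℕ) : ℝ))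
          ≤ (3 * Real.log n) * (K * ((2 * 2 ^ K * b + 1) * Real.log n)) := by gcongr
        _ = C₁ * Real.log n ^ 2 := by rw [hC₁]; ring
        _ ≤ _ := by
            gcongr
            linarith
    · refine hLn.trans ?_
      gcongr
      linarith
    · have h3 := hdiff A'' h
      have h4 : ((2 * 2 ^ L : ℕ) : ℝ) < (A \ A'').card := by
        push_cast at hLq ⊢
        have : (0 : ℝ) < 2 ^ L := by positivity
        linarith
      exact_mod_cast h4
  · rw [not_le] at hlarge
    have hnN : n ≤ N₀ := by
      have h1 : (n : ℝ) ≤ 3 / (2 * lam) := by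
        rw [le_div_iff₀ (by positivity)]
        linarith
      exact_mod_cast h1.trans (Nat.le_ceil _)
    have hM : Nat.log 2 (Fintype.card (S × ZMod d)) + 1 ≤ M₀ := by
      have h1 : Nat.log 2 (Fintype.card (S × ZMod d)) ≤ c * d := by
        rw [Fintype.card_prod, ZMod.card]
        exact Nat.log_le_self _ _
      have h2 : ((c * d : ℕ) : ℝ) ≤ B * N₀ * d := by
        push_cast
        have hB : 0 ≤ B := by
          by_contra hB
          have h3 : B * n < 0 := mul_neg_of_neg_of_pos (not_le.1 hB) hn0
          have h4 : (0 : ℝ) ≤ c := Nat.cast_nonneg _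
          linarith
        have h3 : (n : ℝ) ≤ N₀ := by exact_mod_cast hnN
        have h4 : (c : ℝ) ≤ B * N₀ := hSB.trans (by gcongr)
        gcongr
      have h3 : c * d ≤ ⌈B * N₀ * d⌉₊ := by exact_mod_cast h2.trans (Nat.le_ceil _)
      omega
    refine ⟨Iterated.protocol d A, Iterated.protocol_handles hcard2 hA (hd c hUS) ?_ ?_,
      fun A'' h => Iterated.hiddenFrom fun hsub => ?_⟩
    · refine le_trans (b := (C₂ : ℝ)) ?_ ?_
      · refine Nat.cast_le.2 ?_
        rw [hC₂]
        gcongr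
      · have : (1 : ℝ) ≤ Real.log n ^ 2 := by linarith
        nlinarith
    · refine le_trans (b := (C₃ : ℝ)) ?_ ?_
      · refine Nat.cast_le.2 ?_
        rw [hC₃]
        gcongr
      · nlinarith
    · have h1 := hdiff A'' h
      rw [Finset.sdiff_eq_empty_iff_subset.2 hsub, Finset.card_empty, Nat.cast_zero] at h1
      have : 0 < 2 * lam * n := by positivity
      linarith

end Existence

end RationalSharing

theorem theorem2 (k lam τ U B : ℝ) (hk : 0 < k) (hlam : 0 < lam) :
    ∃ C : ℝ, ∀ n : ℕ, 3 ≤ n →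
      ∀ (S : Type) [Fintype S] [Nonempty S],
        U < (Fintype.card S : ℝ) → (Fintype.card S : ℝ) ≤ B * n →
      ∃ P : RationalSharing.Protocol n S,
        ∀ A : Finset (Fin n),
        ∃ (E : Set P.Coins) (hE : ∃ ω ∈ E, ω ∈ P.coins.support),
          ENNReal.ofReal (1 - 1 / (n : ℝ) ^ k) ≤ P.coins.toOuterMeasure E ∧
          ((A.card ≠ 2 ∨ (A.card : ℝ) / n < τ + lam) →
            ∀ u : Fin n → Finset (Fin n) → ℝ,
              RationalSharing.LearningPreferring u →
              (∀ j, (RationalSharing.bestLearning u j - RationalSharing.bestNotLearning u j) /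
                (RationalSharing.worstLearning u j - RationalSharing.bestNotLearning u j) ≤ U) →
              P.IsNash A E hE u) ∧
          (τ + lam ≤ (A.card : ℝ) / n → P.AllLearn A E) ∧
          ((A.card : ℝ) / n ≤ τ - lam → P.Hidden A E hE) ∧
          (∀ s : S, ∀ i ∈ A, P.expBits A E hE s i ≤ ENNReal.ofReal (C * Real.log n ^ 2)) ∧
          (∀ s : S, P.expLatency A E hE s ≤ ENNReal.ofReal (C * Real.log n)) := by
  obtain ⟨C, hC⟩ := RationalSharing.exists_protocol lam τ U B hlam
  refine ⟨C, fun n hn S _ _ hUS hSB => ?_⟩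
  obtain ⟨P, hP, hid⟩ := hC n hn S hUS hSB
  refine ⟨P, fun A => ⟨Set.univ, P.exists_mem_univ, ?_, (hP A).nash, (hP A).learn, hid A,
    (hP A).bits, (hP A).latency⟩⟩
  rw [(P.coins.toOuterMeasure_apply_eq_one_iff Set.univ).2 (Set.subset_univ _)]
  refine ENNReal.ofReal_le_one.2 (sub_le_self _ ?_)
  positivity
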